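/- **Setting.** There are clients $i=1,\dots,M$ and a new client $M+1$. Client $i$ observes samples $(x_{ij},y_{ij})\in\mathbb R^d\times\mathbb R$, $j=1,\dots,n_i$; all samples, within and across the $M+1$ clients, are independent. They satisfy $y_{ij}=x_{ij}^\top\theta_i^\star+\xi_{ij}$, where $\xi_{ij}$ is independent of $x_{ij}$, has mean zero and is sub-gaussian with variance proxy $\sigma^2$, and $x_{ij}$ has mean zero, covariance $\mathbb E[x_{ij}x_{ij}^\top]=\Gamma_i$ and is sub-gaussian with variance proxy $\gamma^2$ (a real variable $X$ is sub-gaussian with variance proxy $s$ if $\mathbb E\,e^{t(X-\mathbb EX)}\le e^{st^2/2}$ for all $t\in\mathbb R$, and a random vector is if all its projections onto unit vectors are). Write $\lambda_r(A)$ for the $r$-th largest eigenvalue of a symmetric matrix $A$. Assume for constants $\kappa,g,a$ with $g>0$ that $\lambda_1(\Gamma_i)\le\kappa\,\lambda_d(\Gamma_i)$ and $\lambda_1(\Gamma_i)\ge g$ for all $i$, and that $\Gamma_{M+1}=I_d$. There are $1\le k\le d$, a matrix $B^\star\in\mathbb R^{d\times k}$ with orthonormal columns and vectors $\alpha_i^\star\in\mathbb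 R^k$ with $\|\alpha_i^\star\|\le a$ and $\Gamma_i\theta_i^\star=B^\star\alpha_i^\star$ for all $i\le M+1$. Suppose $n_i\ge2$ for $i\le M$, $n_{M+1}\ge1$ and $n_{M+1}\ge k\log n_{M+1}$. Let $N=\sum_{i=1}^M n_i$ and $D=\frac1N\sum_{i=1}^M n_i\alpha_i^\star(\alpha_i^\star)^\top$, and suppose that the problem is well-represented: $c_1/k\le\lambda_k(D)\le\lambda_1(D)\le c_2/k$ for constants $c_1>0$ and $c_2$. **Estimators.** For $i\le M$ let $\bar z_i$ be the average of $y_{ij}x_{ij}$ over $j\le\lfloor n_i/2\rfloor$ and $\tilde z_i$ the average of $y_{ij}x_{ij}$ over $\lfloor n_i/2\rfloor<j\le n_i$. Let $\hat B$, a measurable function of the data of the clients $1,\dots,M$, be a $d\times k$ matrix of right (or left) singular vectors for the $k$ largest singular values of $Z=\sum_{i=1}^M n_i\bar z_i\tilde z_i^\top$. The new client takes any $$\hat\alpha_{M+1}\in\arg\min_{\alpha\in\mathbb R^k}\sum_{j=1}^{n_{M+1}}\big(x_{M+1,j}^\top\hat B\alpha-y_{M+1,j}\big)^2 .$$ **Claim.**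 There are an absolute exponent $p$ and a constant $C>0$ depending only on $\sigma^2,\gamma^2,\kappa,g,a,c_1,c_2$ such that, with probability at least $1-C(d+N)^{-10}-C\,n_{M+1}^{-100}$, $$\big\|\hat B\hat\alpha_{M+1}-B^\star\alpha_{M+1}^\star\big\|\le C\log^p(d+N+n_{M+1})\left(\sqrt{\frac{dk}{N}}+\sqrt{\frac{Mdk^2}{N^2}}+\sqrt{\frac{k}{n_{M+1}}}\right).$$ -/

import Mathlib

open MeasureTheory ProbabilityTheory
open scoped NNReal ENNReal Matrix

noncomputable section

namespace SharedRep

/-- `Eucl d` is `ℝ^d` with the Euclidean norm. -/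
abbrev Eucl (d : ℕ) : Type := EuclideanSpace ℝ (Fin d)

/-- The matrix-vector product `A v`, as a map between Euclidean spaces. -/
def mulV {p q : ℕ} (A : Matrix (Fin p) (Fin q) ℝ) (v : Eucl q) : Eucl p :=
  WithLp.toLp 2 (A *ᵥ v.ofLp)

/-- `eig A r` is the `r`-th largest eigenvalue `λ_r(A)` (counted with multiplicity, `1 ≤ r ≤ d`)
of a real symmetric `d × d` matrix `A`. Outside this range the value is `0` by convention. -/
def eig {d : ℕ} (A : Matrix (Fin d) (Fin d) ℝ) (r : ℕ) : ℝ :=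
  open Classical in
  if h : A.IsHermitian ∧ 1 ≤ r ∧ r ≤ d then
    h.1.eigenvalues₀ ⟨r - 1, by rw [Fintype.card_fin]; omega⟩
  else 0

/-- A real random variable is sub-gaussian with variance proxy `c`:
`E[exp (t (X - E X))] ≤ exp (c t² / 2)` for all real `t`. -/
def IsSubG {Ω : Type*} [MeasurableSpace Ω] (μ : Measure Ω) (X : Ω → ℝ) (c : ℝ≥0) : Prop :=
  HasSubgaussianMGF (fun ω => X ω - ∫ ω', X ω' ∂μ) c μ

/-- A random vector is sub-gaussian with variance proxy `c` if all its one-dimensional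
projections along unit vectors are. -/
def IsSubGVec {Ω : Type*} [MeasurableSpace Ω] (μ : Measure Ω) {d : ℕ} (X : Ω → Eucl d)
    (c : ℝ≥0) : Prop :=
  ∀ u : Eucl d, ‖u‖ = 1 → IsSubG μ (fun ω => inner ℝ u (X ω)) c

/-- The noise `ξ = y - xᵀ θ` of a sample `(x, y)`. -/
def noise {Ω : Type*} {d : ℕ} (x : Ω → Eucl d) (y : Ω → ℝ) (θ : Eucl d) (ω : Ω) : ℝ :=
  y ω - inner ℝ (x ω) θ

/-- The statistical model: `m` clients, client `i` observing the samples `(x i j, y i j)`,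
`j < n i`, with covariance `Γ i`, local parameter `θ i`, shared representation `B` and
low-dimensional parameters `α i`. The constants are the variance proxies `σ2` (noise) and `γ2`
(covariates), a bound `κ` on the condition numbers of the covariances, a lower bound `g` on their
top eigenvalues, and a bound `a` on the norms of the `α i`. -/
structure IsModel {Ω : Type*} [MeasurableSpace Ω] (μ : Measure Ω) {m d k : ℕ} (n : Fin m → ℕ)
    (x : (i : Fin m) → Fin (n i) → Ω → Eucl d) (y : (i : Fin m) → Fin (n i) → Ω → ℝ)
    (Γ : Fin m → Matrix (Fin d) (Fin d) ℝ) (θ : Fin m → Eucl d)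
    (B : Matrix (Fin d) (Fin k) ℝ) (α : Fin m → Eucl k)
    (σ2 γ2 : ℝ≥0) (κ g a : ℝ) : Prop where
  measurable_x : ∀ i j, Measurable (x i j)
  measurable_y : ∀ i j, Measurable (y i j)
  /-- All samples, within and across clients, are independent. -/
  samples_indep :
    iIndepFun (fun (s : (i : Fin m) × Fin (n i)) (ω : Ω) => (x s.1 s.2 ω, y s.1 s.2 ω)) μ
  /-- The noise is independent of the covariate and centred; thus `E[y | x] = xᵀ θ`. -/
  noise_indep : ∀ i j, IndepFun (noise (x i j) (y i j) (θ i)) (x i j) μ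
  noise_mean : ∀ i j, ∫ ω, noise (x i j) (y i j) (θ i) ω ∂μ = 0
  noise_subG : ∀ i j, IsSubG μ (noise (x i j) (y i j) (θ i)) σ2
  x_mean : ∀ i j, ∫ ω, x i j ω ∂μ = 0
  x_subG : ∀ i j, IsSubGVec μ (x i j) γ2
  /-- `Γ i = E[x xᵀ]` for every covariate of client `i`. -/
  x_cov : ∀ i j p q, ∫ ω, x i j ω p * x i j ω q ∂μ = Γ i p q
  cov_cond : ∀ i, eig (Γ i) 1 ≤ κ * eig (Γ i) d
  cov_scale : ∀ i, g ≤ eig (Γ i) 1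
  /-- `B` has orthonormal columns. -/
  B_orth : Bᵀ * B = 1
  low_dim : ∀ i, mulV (Γ i) (θ i) = mulV B (α i)
  alpha_bound : ∀ i, ‖α i‖ ≤ a

/-- The client diversity matrix `D = N⁻¹ ∑ n_i α_i α_iᵀ`, where `N = ∑ n_i`. -/
def diversity {M k : ℕ} (n : Fin M → ℕ) (α : Fin M → Eucl k) : Matrix (Fin k) (Fin k) ℝ :=
  ((∑ i, n i : ℕ) : ℝ)⁻¹ • ∑ i, (n i : ℝ) • Matrix.vecMulVec (α i).ofLp (α i).ofLp

/-- A dataset of `M` clients: client `i` holds `n i` pairs `(x, y)`. -/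
abbrev Dataset {M : ℕ} (n : Fin M → ℕ) (d : ℕ) : Type := (i : Fin M) → Fin (n i) → Eucl d × ℝ

/-- The average of `y x` over the first `⌊n_i / 2⌋` samples of client `i`. -/
def avgFst {M d : ℕ} {n : Fin M → ℕ} (S : Dataset n d) (i : Fin M) : Fin d → ℝ :=
  ((n i / 2 : ℕ) : ℝ)⁻¹ •
    ∑ j : Fin (n i) with j.val < n i / 2, (S i j).2 • (S i j).1.ofLp

/-- The average of `y x` over the other samples of client `i`
(the last `n_i / 2` ones if `n_i` is even). -/
def avgSnd {M d : ℕ} {n : Fin M → ℕ} (S : Dataset n d) (i : Fin M) : Fin d → ℝ :=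
  ((n i - n i / 2 : ℕ) : ℝ)⁻¹ •
    ∑ j : Fin (n i) with n i / 2 ≤ j.val, (S i j).2 • (S i j).1.ofLp

/-- The matrix `Z = ∑ n_i z̄_i z̃_iᵀ` built from the two independent local averages. -/
def crossMat {M d : ℕ} {n : Fin M → ℕ} (S : Dataset n d) : Matrix (Fin d) (Fin d) ℝ :=
  ∑ i, (n i : ℝ) • Matrix.vecMulVec (avgFst S i) (avgSnd S i)

/-- The columns of `V` are right singular vectors of `Z` for its `k` largest singular values:
they are the first `k` columns of `W` in some singular value decomposition `Z = U diag(s) Wᵀ`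
with `s` non-increasing. -/
def IsTopRightSingular {d k : ℕ} (Z : Matrix (Fin d) (Fin d) ℝ) (V : Matrix (Fin d) (Fin k) ℝ) :
    Prop :=
  ∃ (hk : k ≤ d) (U W : Matrix (Fin d) (Fin d) ℝ) (s : Fin d → ℝ),
    Uᵀ * U = 1 ∧ Wᵀ * W = 1 ∧ (∀ r, 0 ≤ s r) ∧ Antitone s ∧
      Z = U * Matrix.diagonal s * Wᵀ ∧ ∀ p r, V p r = W p (Fin.castLE hk r)

/-- The spectral estimator: a (measurable) function of the dataset whose value is always a matrix
of top-`k` right singular vectors of `Z`, or always one of top-`k` left singular vectors. -/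
structure IsSpectralEstimator {M d k : ℕ} {n : Fin M → ℕ}
    (Bhat : Dataset n d → Matrix (Fin d) (Fin k) ℝ) : Prop where
  measurable : ∀ p r, Measurable fun S => Bhat S p r
  top : (∀ S, IsTopRightSingular (crossMat S) (Bhat S)) ∨
    (∀ S, IsTopRightSingular (crossMat S)ᵀ (Bhat S))

/-- `b` minimizes the least squares loss `∑_j (x_jᵀ B b - y_j)²`. -/
def IsLeastSquares {d k l : ℕ} (B : Matrix (Fin d) (Fin k) ℝ) (x : Fin l → Eucl d)
    (y : Fin l → ℝ) (b : Eucl k) : Prop :=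
  ∀ b' : Eucl k,
    ∑ j, (inner ℝ (x j) (mulV B b) - y j) ^ 2 ≤ ∑ j, (inner ℝ (x j) (mulV B b') - y j) ^ 2

end SharedRep

end

noncomputable section

namespace SharedRep

set_option linter.unusedSectionVars false

/-! ### Exponential moments: sub-gaussian and sub-exponential variables. -/

section Exponential

variable {Ω : Type*} {mΩ : MeasurableSpace Ω} {μ : Measure Ω}

/-! The noise is centred and independent of the covariate, so `E[y x] = Γ_i θ_i = B α_i` for every
sample. The two half-averages of a client are independent, hence `Z` has mean `N B D Bᵀ`. This
matrix has the range of `B`, and its `k`-th eigenvalue is at least `N c₁ / k`. If `Z` is within `ε`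
of its mean in operator norm, the span of its top `k` singular vectors `V`, left or right, almost
contains `B α`: the residual `B α - V Vᵀ B α` has norm at most `2 ε a k / (N c₁)`
(`IsTopRightSingular.norm_sub_proj_le`).

To bound `ε`, the responses are truncated at a level of order `√(log (d + N))`. Truncation makes `y
x` sub-gaussian up to logarithms, is inactive at all samples with high probability, and costs a bias
of order `1 / (d + N)`. At fixed unit vectors the bilinear form of `Z` is a sum of products `(p_i +
E_i) (q_i + F_i)` with means `p_i`, `q_i` and independent fluctuations `E_i`, `F_i`. Up to
logarithms, at the confidence needed for a union bound over nets of `5 ^ d` points, the linear terms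
are of order `√(N d / k)`, thanks to the upper bound on `D`, and the products `E_i F_i` contribute
`√(M d) + d` (`measure_sum_mul_sub_le`, `IsModel.measure_trunc_le`,
`IsModel.exists_crossMat_sub_le`). Multiplication by `k / N` gives the first two terms of the claim.
If `d k > N` the claim on the subspace is trivial, because the residual is at most `a`.

The estimator `V` is independent of the new client, so it can be frozen (`measure_le_of_indepFun`).
As the new covariance is the identity, `θ = B α`, and the best predictor with coefficient in the
range of `V` is `V Vᵀ θ`. Its prediction error `y - xᵀ V Vᵀ θ` is sub-gaussian with bounded proxy
and uncorrelated with `xᵀ V`, so the misspecification of `V` acts as extra noise. Regression in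
dimension `k` then costs `√(k / n')` up to logarithms (`IsModel.measure_not_isGoodSample_le`,
`IsGoodSample.norm_le`), on top of the residual of `θ`. Here `k log n' ≤ n'` makes the projected
empirical covariance well conditioned once `n'` exceeds a constant; below that constant the allowed
failure probability exceeds one. -/

lemma exp_le_add_exp_sq (x : ℝ) : Real.exp x ≤ x + Real.exp (x ^ 2) := by
  rcases le_or_gt |x| 1 with h | h
  · have h1 := Real.abs_exp_sub_one_sub_id_le h
    have h2 := Real.add_one_le_exp (x ^ 2)
    have h3 := (abs_le.1 h1).2
    linarith
  · rcases le_or_gt x 0 with hx | hx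
    · rw [abs_of_nonpos hx] at h
      have h2 := Real.add_one_le_exp (x ^ 2)
      have h3 : Real.exp x ≤ 1 := Real.exp_le_one_iff.2 hx
      nlinarith
    · rw [abs_of_pos hx] at h
      have h3 : Real.exp x ≤ Real.exp (x ^ 2) := Real.exp_le_exp.2 (by nlinarith)
      linarith

/-- The constant and linear terms are kept exact, so that after integration the linear term is the
mean, which centring removes. -/
lemma exp_le_one_add_add_sq_mul_exp (x : ℝ) :
    Real.exp x ≤ 1 + x + x ^ 2 * Real.exp |x| := by
  have h := Complex.norm_exp_sub_sum_le_norm_mul_exp (x : ℂ) 2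
  have e : Complex.exp x - ∑ m ∈ Finset.range 2, (x : ℂ) ^ m / (m.factorial : ℂ)
      = ((Real.exp x - (1 + x) : ℝ) : ℂ) := by
    simp [Finset.sum_range_succ]
  rw [e, Complex.norm_real, Complex.norm_real, Real.norm_eq_abs, Real.norm_eq_abs, sq_abs] at h
  linarith [(abs_le.1 h).2]

lemma exp_mul_integral_le [IsProbabilityMeasure μ] {X : Ω → ℝ} (hX : Integrable X μ) (t : ℝ)
    (h : Integrable (fun ω => Real.exp (t * X ω)) μ) :
    Real.exp (t * ∫ ω, X ω ∂μ) ≤ ∫ ω, Real.exp (t * X ω) ∂μ := by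
  set m := ∫ ω, X ω ∂μ
  have h1 : ∫ ω, Real.exp (t * m) * (1 + t * (X ω - m)) ∂μ = Real.exp (t * m) := by
    have h2 : ∫ ω, t * (X ω - m) ∂μ = 0 := by
      rw [integral_const_mul, integral_sub hX (integrable_const _)]
      simp [m]
    have h3 : Integrable (fun ω => t * (X ω - m)) μ := (hX.sub (integrable_const _)).const_mul _
    rw [integral_const_mul, integral_add (integrable_const _) h3, h2]
    simp
  rw [← h1]
  refine integral_mono ?_ h fun ω => ?_
  · exact ((integrable_const _).add ((hX.sub (integrable_const _)).const_mul _)).const_mul _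
  · have := Real.add_one_le_exp (t * (X ω - m))
    calc Real.exp (t * m) * (1 + t * (X ω - m))
        ≤ Real.exp (t * m) * Real.exp (t * (X ω - m)) := by gcongr; linarith
      _ = Real.exp (t * X ω) := by rw [← Real.exp_add]; ring_nf

/-- Jensen's inequality bounds the factor `exp (-t E X)` by `E exp (-t X)`. If the bounds at `t` and
`-t` are `G + t E X` and `G - t E X`, their product is at most `G²`, so the mean disappears. -/
lemma mgf_sub_integral_le [IsProbabilityMeasure μ] {X : Ω → ℝ} (hX : Integrable X μ) {t A B : ℝ}
    (h : Integrable (fun ω => Real.exp (t * X ω)) μ)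
    (h' : Integrable (fun ω => Real.exp (-t * X ω)) μ)
    (hA : mgf X μ t ≤ A) (hB : mgf X μ (-t) ≤ B) :
    Integrable (fun ω => Real.exp (t * (X ω - ∫ ω', X ω' ∂μ))) μ ∧
      mgf (fun ω => X ω - ∫ ω', X ω' ∂μ) μ t ≤ A * B := by
  set m := ∫ ω, X ω ∂μ with hm
  have e : (fun ω => Real.exp (t * (X ω - m))) =
      fun ω => Real.exp (-t * m) * Real.exp (t * X ω) := by
    funext ω; rw [← Real.exp_add]; ring_nf
  have h2 := exp_mul_integral_le hX (-t) h'
  unfold mgf at *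
  rw [e]
  refine ⟨h.const_mul _, ?_⟩
  rw [integral_const_mul, mul_comm A]
  have : 0 ≤ ∫ ω, Real.exp (t * X ω) ∂μ := integral_nonneg fun _ => (Real.exp_pos _).le
  exact mul_le_mul (h2.trans hB) hA this (((Real.exp_pos _).le.trans h2).trans hB)

lemma one_div_sqrt_one_sub_le {z : ℝ} (h0 : 0 ≤ z) (h1 : z ≤ 1 / 2) :
    1 / √(1 - z) ≤ Real.exp z := by
  rw [div_le_iff₀ (Real.sqrt_pos.2 (by linarith))]
  have h2 : Real.exp (-z) ≤ √(1 - z) := by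
    apply Real.le_sqrt_of_sq_le
    have h3 : Real.exp (-z) ^ 2 = (Real.exp (2 * z))⁻¹ := by
      rw [sq, ← Real.exp_add, ← Real.exp_neg]; ring_nf
    rw [h3, inv_le_comm₀ (Real.exp_pos _) (by linarith)]
    refine le_trans ?_ (Real.add_one_le_exp (2 * z))
    rw [inv_le_iff_one_le_mul₀ (by linarith)]
    nlinarith
  calc (1 : ℝ) = Real.exp z * Real.exp (-z) := by rw [← Real.exp_add]; simp
    _ ≤ _ := by gcongr

/-- Moment generating function of the square of a centred Gaussian variable. -/
lemma lintegral_exp_mul_sq_gaussianReal {v : ℝ≥0} {r : ℝ} (hr : r * v < 1) :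
    ∫⁻ g, ENNReal.ofReal (Real.exp (r * g ^ 2 / 2)) ∂(gaussianReal 0 v)
      = ENNReal.ofReal (1 / √(1 - r * v)) := by
  by_cases hv : v = 0
  · subst hv; simp
  have hv' : (0 : ℝ) < v := by positivity
  have hb : (0 : ℝ) < (1 - r * v) / (2 * v) := by apply div_pos <;> linarith
  rw [gaussianReal_of_var_ne_zero _ hv, lintegral_withDensity_eq_lintegral_mul _
    (measurable_gaussianPDF _ _) (by fun_prop)]
  have e : ∀ g : ℝ, (gaussianPDF 0 v * fun g => ENNReal.ofReal (Real.exp (r * g ^ 2 / 2))) g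
      = ENNReal.ofReal ((√(2 * Real.pi * v))⁻¹ * Real.exp (-((1 - r * v) / (2 * v)) * g ^ 2)) := by
    intro g
    simp only [Pi.mul_apply, gaussianPDF, gaussianPDFReal]
    rw [← ENNReal.ofReal_mul (by positivity), mul_assoc, ← Real.exp_add]
    congr 3
    field_simp
    ring_nf
  simp_rw [e]
  rw [← ofReal_integral_eq_lintegral_ofReal ((integrable_exp_neg_mul_sq hb).const_mul _)
    (Filter.Eventually.of_forall fun _ => by positivity), integral_const_mul, integral_gaussian]
  congr 1
  rw [← Real.sqrt_inv, ← Real.sqrt_mul (by positivity), one_div, ← Real.sqrt_inv]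
  congr 1
  have : 1 - r * v ≠ 0 := by linarith
  field_simp

/-- Gaussian linearisation: `exp (c w²) = E exp (w g)` for an independent `g` of variance `2 c`.
After exchanging the integrals, the sub-gaussian bound on `w` leaves a Gaussian integral. -/
lemma lintegral_exp_mul_sq_le [IsProbabilityMeasure μ] {w : Ω → ℝ} {s : ℝ≥0}
    (h : HasSubgaussianMGF w s μ) {c : ℝ} (hc : 0 ≤ c) (hcs : 4 * c * s ≤ 1) :
    ∫⁻ ω, ENNReal.ofReal (Real.exp (c * w ω ^ 2)) ∂μ ≤ ENNReal.ofReal (Real.exp (2 * c * s)) := by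
  lift c to ℝ≥0 using hc
  have hmg : ∀ r : ℝ, ENNReal.ofReal (Real.exp (c * r ^ 2))
      = ∫⁻ g, ENNReal.ofReal (Real.exp (r * g)) ∂(gaussianReal 0 (2 * c)) := by
    intro r
    rw [← ofReal_integral_eq_lintegral_ofReal]
    · have := mgf_gaussianReal (p := gaussianReal 0 (2 * c)) (X := id) (μ := 0) (v := 2 * c) (by simp) r
      simp only [mgf, id] at this
      rw [this]
      congr 2
      push_cast; ring_nf
    · have := integrable_exp_mul_gaussianReal (μ := 0) (v := 2 * c) r
      exact this
    · exact Filter.Eventually.of_forall fun _ => (Real.exp_pos _).le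
  calc ∫⁻ ω, ENNReal.ofReal (Real.exp (c * w ω ^ 2)) ∂μ
      = ∫⁻ ω, ∫⁻ g, ENNReal.ofReal (Real.exp (w ω * g)) ∂(gaussianReal 0 (2 * c)) ∂μ := by
        simp_rw [hmg]
    _ = ∫⁻ g, ∫⁻ ω, ENNReal.ofReal (Real.exp (w ω * g)) ∂μ ∂(gaussianReal 0 (2 * c)) := by
        refine lintegral_lintegral_swap ?_
        have := h.aemeasurable.comp_fst (ν := gaussianReal 0 (2 * c))
        have h2 : AEMeasurable (fun z : Ω × ℝ => z.2) (μ.prod (gaussianReal 0 (2 * c))) := by fun_prop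
        exact ENNReal.measurable_ofReal.comp_aemeasurable
          (Real.measurable_exp.comp_aemeasurable (this.mul h2))
    _ ≤ ∫⁻ g, ENNReal.ofReal (Real.exp (s * g ^ 2 / 2)) ∂(gaussianReal 0 (2 * c)) := by
        refine lintegral_mono fun g => ?_
        have h1 := h.integrable_exp_mul g
        have h2 := h.mgf_le g
        simp_rw [mul_comm _ g]
        rw [← ofReal_integral_eq_lintegral_ofReal h1
          (Filter.Eventually.of_forall fun _ => (Real.exp_pos _).le)]
        exact ENNReal.ofReal_le_ofReal h2
    _ = ENNReal.ofReal (1 / √(1 - s * (2 * c : ℝ≥0))) :=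
        lintegral_exp_mul_sq_gaussianReal (by push_cast; linarith)
    _ ≤ _ := by
        refine ENNReal.ofReal_le_ofReal ((one_div_sqrt_one_sub_le ?_ ?_).trans_eq ?_)
        · positivity
        · push_cast; linarith
        · push_cast; ring_nf

lemma integrable_and_integral_le_of_lintegral {f : Ω → ℝ} (hf : AEStronglyMeasurable f μ)
    (h0 : ∀ ω, 0 ≤ f ω) {A : ℝ} (hA : 0 ≤ A)
    (h : ∫⁻ ω, ENNReal.ofReal (f ω) ∂μ ≤ ENNReal.ofReal A) :
    Integrable f μ ∧ ∫ ω, f ω ∂μ ≤ A := by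
  refine ⟨⟨hf, ?_⟩, ?_⟩
  · rw [hasFiniteIntegral_iff_ofReal (Filter.Eventually.of_forall h0)]
    exact h.trans_lt ENNReal.ofReal_lt_top
  · rw [integral_eq_lintegral_of_nonneg_ae (Filter.Eventually.of_forall h0) hf]
    exact ENNReal.toReal_le_of_le_ofReal hA h

lemma integral_exp_mul_sq_le [IsProbabilityMeasure μ] {w : Ω → ℝ} {s : ℝ≥0}
    (h : HasSubgaussianMGF w s μ) {c : ℝ} (hc : 0 ≤ c) (hcs : 4 * c * s ≤ 1) :
    Integrable (fun ω => Real.exp (c * w ω ^ 2)) μ ∧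
      ∫ ω, Real.exp (c * w ω ^ 2) ∂μ ≤ Real.exp (2 * c * s) := by
  refine integrable_and_integral_le_of_lintegral ?_ (fun _ => (Real.exp_pos _).le)
    (Real.exp_pos _).le (lintegral_exp_mul_sq_le h hc hcs)
  have := h.aestronglyMeasurable
  fun_prop

/-- The product of two independent sub-gaussian variables is sub-exponential. -/
lemma integral_exp_mul_mul_le [IsProbabilityMeasure μ] {X Y : Ω → ℝ} {s s' : ℝ≥0}
    (hX : HasSubgaussianMGF X s μ) (hY : HasSubgaussianMGF Y s' μ) (hXY : IndepFun X Y μ)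
    {t : ℝ} (ht : 2 * t ^ 2 * s * s' ≤ 1) :
    Integrable (fun ω => Real.exp (t * (X ω * Y ω))) μ ∧
      ∫ ω, Real.exp (t * (X ω * Y ω)) ∂μ ≤ Real.exp (t ^ 2 * (s * s')) := by
  have hXm := hX.aemeasurable
  have hYm := hY.aemeasurable
  refine integrable_and_integral_le_of_lintegral ?_ (fun _ => (Real.exp_pos _).le)
    (Real.exp_pos _).le ?_
  · have h1 := hX.aestronglyMeasurable
    have h2 := hY.aestronglyMeasurable
    fun_prop
  have hmap := (indepFun_iff_map_prod_eq_prod_map_map hXm hYm).1 hXY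
  have : IsProbabilityMeasure (μ.map X) := Measure.isProbabilityMeasure_map hXm
  have : IsProbabilityMeasure (μ.map Y) := Measure.isProbabilityMeasure_map hYm
  have hmeas : Measurable fun z : ℝ × ℝ => ENNReal.ofReal (Real.exp (t * (z.1 * z.2))) := by fun_prop
  calc ∫⁻ ω, ENNReal.ofReal (Real.exp (t * (X ω * Y ω))) ∂μ
      = ∫⁻ z, ENNReal.ofReal (Real.exp (t * (z.1 * z.2))) ∂(μ.map fun ω => (X ω, Y ω)) := by
        rw [lintegral_map' hmeas.aemeasurable (hXm.prodMk hYm)]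
    _ = ∫⁻ y, ∫⁻ x, ENNReal.ofReal (Real.exp (t * (x * y))) ∂(μ.map X) ∂(μ.map Y) := by
        rw [hmap, lintegral_prod_symm' _ hmeas]
    -- With `Y` frozen at `y`, the inner integral is the moment generating function of `X` at `t y`.
    _ ≤ ∫⁻ y, ENNReal.ofReal (Real.exp (t ^ 2 * s / 2 * y ^ 2)) ∂(μ.map Y) := by
        refine lintegral_mono fun y => ?_
        rw [lintegral_map' (by fun_prop) hXm]
        have h1 := hX.integrable_exp_mul (t * y)
        have h2 := hX.mgf_le (t * y)
        have e : ∀ x : ℝ, t * (x * y) = t * y * x := fun x => by ring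
        simp_rw [e]
        rw [← ofReal_integral_eq_lintegral_ofReal h1
          (Filter.Eventually.of_forall fun _ => (Real.exp_pos _).le)]
        refine ENNReal.ofReal_le_ofReal (h2.trans_eq ?_)
        ring_nf
    _ = ∫⁻ ω, ENNReal.ofReal (Real.exp (t ^ 2 * s / 2 * Y ω ^ 2)) ∂μ := by
        rw [lintegral_map' (by fun_prop) hYm]
    _ ≤ _ := by
        refine (lintegral_exp_mul_sq_le hY (by positivity) (by linarith)).trans_eq ?_
        ring_nf

lemma _root_.ProbabilityTheory.HasSubgaussianMGF.mono {X : Ω → ℝ} {c c' : ℝ≥0}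
    (h : HasSubgaussianMGF X c μ) (hc : c ≤ c') : HasSubgaussianMGF X c' μ where
  integrable_exp_mul := h.integrable_exp_mul
  mgf_le t := (h.mgf_le t).trans (Real.exp_le_exp.2 (by gcongr))

lemma integral_exp_mul_abs_le {w : Ω → ℝ} {s : ℝ≥0}
    (h : HasSubgaussianMGF w s μ) (t : ℝ) :
    Integrable (fun ω => Real.exp (t * |w ω|)) μ ∧
      ∫ ω, Real.exp (t * |w ω|) ∂μ ≤ 2 * Real.exp (s * t ^ 2 / 2) := by
  have h1 := h.integrable_exp_mul t
  have h2 := h.integrable_exp_mul (-t)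
  have hm := h.aestronglyMeasurable
  have hle : ∀ ω, Real.exp (t * |w ω|) ≤ Real.exp (t * w ω) + Real.exp (-t * w ω) := by
    intro ω
    rcases abs_cases (w ω) with ⟨e, _⟩ | ⟨e, _⟩ <;> rw [e]
    · linarith [Real.exp_pos (-t * w ω)]
    · rw [mul_neg, ← neg_mul]; linarith [Real.exp_pos (t * w ω)]
  have hi : Integrable (fun ω => Real.exp (t * |w ω|)) μ := by
    refine (h1.add h2).mono' ?_ (Filter.Eventually.of_forall fun ω => ?_)
    · have : AEStronglyMeasurable (fun ω => |w ω|) μ := hm.norm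
      fun_prop
    · rw [Real.norm_of_nonneg (Real.exp_pos _).le]; exact hle ω
  refine ⟨hi, (integral_mono hi (h1.add h2) hle).trans ?_⟩
  simp only [Pi.add_apply]
  rw [integral_add h1 h2]
  have e1 := h.mgf_le t
  have e2 := h.mgf_le (-t)
  unfold mgf at e1 e2
  rw [neg_sq] at e2
  linarith

/-- A variable dominated by a sub-gaussian one is, after centring, sub-gaussian. -/
lemma hasSubgaussianMGF_sub_integral_of_abs_le [IsProbabilityMeasure μ] {X w : Ω → ℝ} {s : ℝ≥0}
    (hX : AEStronglyMeasurable X μ) (hw : HasSubgaussianMGF w s μ) (hle : ∀ ω, |X ω| ≤ |w ω|) :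
    HasSubgaussianMGF (fun ω => X ω - ∫ ω', X ω' ∂μ) (14 * s) μ := by
  have hXi : Integrable X μ := hw.integrable.mono hX (Filter.Eventually.of_forall hle)
  have hint : ∀ t : ℝ, Integrable (fun ω => Real.exp (t * X ω)) μ := by
    intro t
    refine (integral_exp_mul_abs_le hw |t|).1.mono' (by fun_prop) (Filter.Eventually.of_forall fun ω => ?_)
    rw [Real.norm_of_nonneg (Real.exp_pos _).le]
    refine Real.exp_le_exp.2 ((le_abs_self _).trans ?_)
    rw [abs_mul]
    exact mul_le_mul_of_nonneg_left (hle ω) (abs_nonneg _)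
  have habs : ∀ t : ℝ, mgf X μ t ≤ 2 * Real.exp (s * t ^ 2 / 2) := by
    intro t
    have h1 := integral_exp_mul_abs_le hw |t|
    rw [sq_abs] at h1
    refine (integral_mono (hint t) h1.1 fun ω => ?_).trans h1.2
    refine Real.exp_le_exp.2 ((le_abs_self _).trans ?_)
    rw [abs_mul]
    exact mul_le_mul_of_nonneg_left (hle ω) (abs_nonneg _)
  have hsq : ∀ t : ℝ, 4 * t ^ 2 * s ≤ 1 →
      mgf X μ t ≤ t * ∫ ω, X ω ∂μ + Real.exp (2 * t ^ 2 * s) := by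
    intro t ht
    obtain ⟨h1, h2⟩ := integral_exp_mul_sq_le hw (sq_nonneg t) ht
    have h3 : Integrable (fun ω => t * X ω + Real.exp (t ^ 2 * w ω ^ 2)) μ :=
      (hXi.const_mul t).add h1
    calc mgf X μ t ≤ ∫ ω, t * X ω + Real.exp (t ^ 2 * w ω ^ 2) ∂μ := by
          refine integral_mono (hint t) h3 fun ω => ?_
          refine (exp_le_add_exp_sq _).trans ?_
          simp only [mul_pow]
          gcongr t * X ω + Real.exp (t ^ 2 * ?_)
          exact sq_le_sq.2 (hle ω)
      _ ≤ _ := by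
          rw [integral_add (hXi.const_mul t) h1, integral_const_mul]
          gcongr
  -- For `4 t² s ≤ 1` the second-order bound applies and the mean cancels. For larger `t` the crude
  -- bound `4 exp (s t²)` is enough, because `4 ≤ exp (3/2) ≤ exp (6 s t²)`; this regime dictates
  -- the constant `7`, hence the proxy `14 s`.
  have key : ∀ t : ℝ, mgf (fun ω => X ω - ∫ ω', X ω' ∂μ) μ t ≤ Real.exp (7 * s * t ^ 2) := by
    intro t
    by_cases ht : 4 * t ^ 2 * s ≤ 1
    · refine (mgf_sub_integral_le hXi (hint t) (hint (-t)) (hsq t ht)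
        (hsq (-t) (by rwa [neg_sq]))).2.trans ?_
      rw [neg_sq]
      set m := ∫ ω, X ω ∂μ
      calc (t * m + Real.exp (2 * t ^ 2 * s)) * (-t * m + Real.exp (2 * t ^ 2 * s))
          ≤ Real.exp (2 * t ^ 2 * s) * Real.exp (2 * t ^ 2 * s) := by nlinarith [sq_nonneg (t * m)]
        _ ≤ _ := by
          rw [← Real.exp_add]
          refine Real.exp_le_exp.2 ?_
          have : 0 ≤ s * t ^ 2 := by positivity
          nlinarith
    · push Not at ht
      refine (mgf_sub_integral_le hXi (hint t) (hint (-t)) (habs t) (habs (-t))).2.trans ?_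
      rw [neg_sq]
      have h4 : (4 : ℝ) ≤ Real.exp (3 / 2) := by
        have h5 := Real.exp_one_gt_d9
        have h6 : (16 : ℝ) ≤ Real.exp (3 / 2) ^ 2 := by
          rw [← Real.exp_nat_mul]
          have : ((2 : ℕ) : ℝ) * (3 / 2) = ((3 : ℕ) : ℝ) * 1 := by norm_num
          rw [this, Real.exp_nat_mul]
          have : (2.71 : ℝ) ^ 3 ≤ Real.exp 1 ^ 3 := by gcongr; linarith
          norm_num at this ⊢
          linarith
        nlinarith [Real.exp_pos (3 / 2)]
      calc 2 * Real.exp (s * t ^ 2 / 2) * (2 * Real.exp (s * t ^ 2 / 2))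
          = 4 * Real.exp (s * t ^ 2) := by
            have : Real.exp (s * t ^ 2) = Real.exp (s * t ^ 2 / 2) * Real.exp (s * t ^ 2 / 2) := by
              rw [← Real.exp_add, add_halves]
            rw [this]; ring
        _ ≤ Real.exp (3 / 2) * Real.exp (s * t ^ 2) := by gcongr
        _ ≤ _ := by
          rw [← Real.exp_add]
          refine Real.exp_le_exp.2 ?_
          nlinarith
  refine ⟨fun t => ?_, fun t => (key t).trans_eq ?_⟩
  · exact (mgf_sub_integral_le hXi (hint t) (hint (-t)) (habs t) (habs (-t))).1
  · congr 1; push_cast; ring_nf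

/-- Sub-exponential control of the moment generating function: `E[exp (t X)] ≤ exp (K t²)`
for `|t| ≤ b`. -/
def HasSubexpMGF (X : Ω → ℝ) (K b : ℝ) (μ : Measure Ω) : Prop :=
  ∀ t, |t| ≤ b → Integrable (fun ω => Real.exp (t * X ω)) μ ∧ mgf X μ t ≤ Real.exp (K * t ^ 2)

lemma HasSubexpMGF.mono {X : Ω → ℝ} {K K' b b' : ℝ} (h : HasSubexpMGF X K b μ) (hK : K ≤ K')
    (hb : b' ≤ b) : HasSubexpMGF X K' b' μ := fun t ht =>
  ⟨(h t (ht.trans hb)).1, (h t (ht.trans hb)).2.trans (Real.exp_le_exp.2 (by gcongr))⟩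

lemma _root_.ProbabilityTheory.HasSubgaussianMGF.hasSubexpMGF {X : Ω → ℝ} {c : ℝ≥0}
    (h : HasSubgaussianMGF X c μ) (b : ℝ) : HasSubexpMGF X (c / 2) b μ := fun t _ =>
  ⟨h.integrable_exp_mul t, (h.mgf_le t).trans_eq (by ring_nf)⟩

lemma HasSubexpMGF.neg {X : Ω → ℝ} {K b : ℝ} (h : HasSubexpMGF X K b μ) :
    HasSubexpMGF (fun ω => - X ω) K b μ := by
  intro t ht
  have h1 := h (-t) (by rwa [abs_neg])
  rw [neg_sq] at h1
  simp only [neg_mul] at h1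
  simp only [mgf, mul_neg] at *
  simp only [neg_mul] at h1
  exact h1

lemma HasSubexpMGF.sum {ι : Type*} {X : ι → Ω → ℝ} {K : ι → ℝ} {b : ℝ} [IsFiniteMeasure μ]
    (hi : iIndepFun X μ) (hm : ∀ i, Measurable (X i)) (s : Finset ι)
    (h : ∀ i ∈ s, HasSubexpMGF (X i) (K i) b μ) :
    HasSubexpMGF (fun ω => ∑ i ∈ s, X i ω) (∑ i ∈ s, K i) b μ := by
  intro t ht
  have e : (fun ω => ∑ i ∈ s, X i ω) = ∑ i ∈ s, X i := by ext; simp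
  constructor
  · have := hi.integrable_exp_mul_sum hm (s := s) (t := t) fun i hs => (h i hs t ht).1
    simpa [Finset.sum_apply] using this
  · rw [e, hi.mgf_sum hm, Finset.sum_mul, Real.exp_sum]
    exact Finset.prod_le_prod (fun _ _ => mgf_nonneg) fun i hs => (h i hs t ht).2

/-- Bernstein's bound by Chernoff's method: the unconstrained optimum `√(s / K)` is used when it is
admissible, and otherwise the endpoint `b`. Each case needs only one of the two terms of the
threshold. -/
lemma HasSubexpMGF.measure_ge_le [IsProbabilityMeasure μ] {X : Ω → ℝ} {K b s : ℝ}
    (h : HasSubexpMGF X K b μ) (hK : 0 < K) (hb : 0 < b) (hs : 0 ≤ s) :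
    μ.real {ω | 2 * √(K * s) + 2 * s / b ≤ X ω} ≤ Real.exp (-s) := by
  set t := min (√(s / K)) b with ht
  have ht0 : 0 ≤ t := le_min (Real.sqrt_nonneg _) hb.le
  have htb : |t| ≤ b := by rw [abs_of_nonneg ht0]; exact min_le_right _ _
  obtain ⟨h1, h2⟩ := h t htb
  refine (measure_ge_le_exp_mul_mgf _ ht0 h1).trans ?_
  refine (mul_le_mul_of_nonneg_left h2 (Real.exp_pos _).le).trans ?_
  rw [← Real.exp_add]
  refine Real.exp_le_exp.2 ?_
  have hsb : 0 ≤ 2 * s / b := by positivity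
  rcases min_cases (√(s / K)) b with ⟨e, h3⟩ | ⟨e, h3⟩
  · rw [e] at ht
    have e1 : t * √(K * s) = s := by
      rw [ht, ← Real.sqrt_mul (by positivity), show s / K * (K * s) = s ^ 2 by field_simp,
        Real.sqrt_sq hs]
    have e2 : K * t ^ 2 = s := by
      rw [ht, Real.sq_sqrt (by positivity)]; field_simp
    nlinarith [mul_nonneg ht0 hsb]
  · rw [e] at ht
    have e1 : t * (2 * s / b) = 2 * s := by rw [ht]; field_simp
    have e2 : K * t ^ 2 ≤ s := by
      have : t ^ 2 ≤ s / K := by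
        rw [ht]; exact (Real.le_sqrt' hb).1 h3.le
      rwa [le_div_iff₀ hK, mul_comm] at this
    nlinarith [mul_nonneg ht0 (Real.sqrt_nonneg (K * s))]

lemma HasSubexpMGF.measure_abs_ge_le [IsProbabilityMeasure μ] {X : Ω → ℝ} {K b s : ℝ}
    (h : HasSubexpMGF X K b μ) (hK : 0 < K) (hb : 0 < b) (hs : 0 ≤ s) :
    μ {ω | 2 * √(K * s) + 2 * s / b ≤ |X ω|} ≤ ENNReal.ofReal (2 * Real.exp (-s)) := by
  have h1 := h.measure_ge_le hK hb hs
  have h2 := h.neg.measure_ge_le hK hb hs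
  rw [← ENNReal.ofReal_toReal (measure_ne_top μ _)]
  refine ENNReal.ofReal_le_ofReal ?_
  refine (measureReal_mono (s₂ := {ω | 2 * √(K * s) + 2 * s / b ≤ X ω} ∪
    {ω | 2 * √(K * s) + 2 * s / b ≤ - X ω}) ?_).trans ((measureReal_union_le _ _).trans (by linarith))
  intro ω hω
  have h3 : 2 * √(K * s) + 2 * s / b ≤ |X ω| := hω
  exact le_abs.1 h3

/-- A sub-gaussian variable has sub-gaussian tails. -/
lemma _root_.ProbabilityTheory.HasSubgaussianMGF.measure_abs_ge_le [IsProbabilityMeasure μ]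
    {X : Ω → ℝ} {c : ℝ≥0} (h : HasSubgaussianMGF X c μ) {K s : ℝ} (hK : 0 < K) (hcK : c ≤ K)
    (hs : 0 < s) :
    μ {ω | 4 * √(K * s) ≤ |X ω|} ≤ ENNReal.ofReal (2 * Real.exp (-s)) := by
  -- A sub-gaussian variable leaves `b` free; with `b = √(s / K)` both terms of Bernstein's
  -- threshold equal `2 √(K s)`.
  have hb : 0 < √(s / K) := Real.sqrt_pos.2 (by positivity)
  have h1 := ((h.hasSubexpMGF (√(s / K))).mono (K' := K) (by have := c.2; simp only [NNReal.val_eq_coe] at this; linarith)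
    le_rfl).measure_abs_ge_le hK hb hs.le
  have e : 2 * √(K * s) + 2 * s / √(s / K) = 4 * √(K * s) := by
    have : √(K * s) * √(s / K) = s := by
      rw [← Real.sqrt_mul (by positivity), show K * s * (s / K) = s ^ 2 by field_simp,
        Real.sqrt_sq hs.le]
    have : 2 * s / √(s / K) = 2 * √(K * s) := by
      rw [div_eq_iff hb.ne']; linarith
    linarith
  rwa [e] at h1

/-- A variable dominated by the squares of two sub-gaussian ones is, after centring,
sub-exponential. -/
lemma hasSubexpMGF_sub_integral_of_abs_le [IsProbabilityMeasure μ] {X w w' : Ω → ℝ} {s : ℝ≥0}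
    (hs : 0 < s) (hX : AEStronglyMeasurable X μ) (hw : HasSubgaussianMGF w s μ)
    (hw' : HasSubgaussianMGF w' s μ) (hle : ∀ ω, |X ω| ≤ (w ω ^ 2 + w' ω ^ 2) / 2) :
    Integrable X μ ∧
      HasSubexpMGF (fun ω => X ω - ∫ ω', X ω' ∂μ) (512 * s ^ 2) (1 / (8 * s)) μ := by
  have hs' : (0 : ℝ) < s := hs
  set c : ℝ := 1 / (8 * s) with hc
  have hc0 : 0 < c := by positivity
  have hcs : c * s = 1 / 8 := by rw [hc]; field_simp
  obtain ⟨i1, b1⟩ := integral_exp_mul_sq_le hw (c := 2 * c) (by positivity) (by linarith)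
  obtain ⟨i2, b2⟩ := integral_exp_mul_sq_le hw' (c := 2 * c) (by positivity) (by linarith)
  have hexp2 : Real.exp (1 / 2) ≤ 2 := by
    have h5 := Real.exp_one_lt_d9
    have h6 : Real.exp (1 / 2) ^ 2 ≤ 2 ^ 2 := by
      rw [← Real.exp_nat_mul]; norm_num; linarith
    exact le_of_sq_le_sq h6 (by norm_num)
  rw [show 2 * (2 * c) * s = 1 / 2 by linarith] at b1 b2
  -- Arithmetic-geometric mean for `exp (c w²)` and `exp (c w'²)`: exponential moments of `|X|`
  -- follow from those of the squares, whether or not `w` and `w'` are independent.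
  have hdom : ∀ ω, Real.exp (2 * c * |X ω|) ≤
      (Real.exp (2 * c * w ω ^ 2) + Real.exp (2 * c * w' ω ^ 2)) / 2 := by
    intro ω
    have h1 : Real.exp (2 * c * |X ω|) ≤ Real.exp (c * w ω ^ 2) * Real.exp (c * w' ω ^ 2) := by
      rw [← Real.exp_add]
      refine Real.exp_le_exp.2 ?_
      nlinarith [hle ω]
    have h2 : Real.exp (2 * c * w ω ^ 2) = Real.exp (c * w ω ^ 2) ^ 2 := by
      rw [← Real.exp_nat_mul]; push_cast; ring_nf
    have h3 : Real.exp (2 * c * w' ω ^ 2) = Real.exp (c * w' ω ^ 2) ^ 2 := by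
      rw [← Real.exp_nat_mul]; push_cast; ring_nf
    rw [h2, h3]
    nlinarith [sq_nonneg (Real.exp (c * w ω ^ 2) - Real.exp (c * w' ω ^ 2))]
  have hXa : AEStronglyMeasurable (fun ω => |X ω|) μ := hX.norm
  have iabs : Integrable (fun ω => Real.exp (2 * c * |X ω|)) μ := by
    refine ((i1.add i2).div_const 2).mono' (by fun_prop) (Filter.Eventually.of_forall fun ω => ?_)
    rw [Real.norm_of_nonneg (Real.exp_pos _).le]; exact hdom ω
  have babs : ∫ ω, Real.exp (2 * c * |X ω|) ∂μ ≤ 2 := by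
    refine (integral_mono iabs ((i1.add i2).div_const 2) hdom).trans ?_
    simp only [Pi.add_apply]
    rw [integral_div, integral_add i1 i2]
    linarith
  have hXi : Integrable X μ := by
    refine (iabs.const_mul (2 * c)⁻¹).mono' hX (Filter.Eventually.of_forall fun ω => ?_)
    rw [Real.norm_eq_abs, inv_mul_eq_div, le_div_iff₀ (by positivity)]
    linarith [Real.add_one_le_exp (2 * c * |X ω|)]
  refine ⟨hXi, ?_⟩
  have hint : ∀ t : ℝ, |t| ≤ c → Integrable (fun ω => Real.exp (t * X ω)) μ := by
    intro t ht
    refine iabs.mono' (by fun_prop) (Filter.Eventually.of_forall fun ω => ?_)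
    rw [Real.norm_of_nonneg (Real.exp_pos _).le]
    refine Real.exp_le_exp.2 ((le_abs_self _).trans ?_)
    rw [abs_mul]
    gcongr
    linarith
  -- The quadratic remainder is absorbed by half of the exponential moment at `2 c`: `(c |X|)² ≤ 2
  -- exp (c |X|)`, and the other half covers `exp |t X|`.
  have hmgf : ∀ t : ℝ, |t| ≤ c →
      mgf X μ t ≤ t * ∫ ω, X ω ∂μ + Real.exp (256 * s ^ 2 * t ^ 2) := by
    intro t ht
    have hpt : ∀ ω, Real.exp (t * X ω) ≤
        1 + t * X ω + 2 * (t / c) ^ 2 * Real.exp (2 * c * |X ω|) := by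
      intro ω
      refine (exp_le_one_add_add_sq_mul_exp _).trans ?_
      have h1 : (c * |X ω|) ^ 2 ≤ 2 * Real.exp (c * |X ω|) := by
        have := Real.quadratic_le_exp_of_nonneg (x := c * |X ω|) (by positivity)
        have : 0 ≤ c * |X ω| := by positivity
        linarith
      have h2 : Real.exp |t * X ω| ≤ Real.exp (c * |X ω|) := by
        refine Real.exp_le_exp.2 ?_
        rw [abs_mul]; gcongr
      have h3 : (t * X ω) ^ 2 = (t / c) ^ 2 * (c * |X ω|) ^ 2 := by
        rw [mul_pow, mul_pow, div_pow, sq_abs]; field_simp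
      have h4 : Real.exp (2 * c * |X ω|) = Real.exp (c * |X ω|) * Real.exp (c * |X ω|) := by
        rw [← Real.exp_add]; ring_nf
      rw [h3, h4]
      have : (t / c) ^ 2 * (c * |X ω|) ^ 2 * Real.exp |t * X ω| ≤
          (t / c) ^ 2 * (2 * Real.exp (c * |X ω|)) * Real.exp (c * |X ω|) := by gcongr
      linarith
    have ia : Integrable (fun ω => 1 + t * X ω) μ := (integrable_const _).add (hXi.const_mul t)
    have ib := iabs.const_mul (2 * (t / c) ^ 2)
    refine (integral_mono (hint t ht) (ia.add ib) hpt).trans ?_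
    simp only [Pi.add_apply]
    rw [integral_add ia ib, integral_add (integrable_const _) (hXi.const_mul t),
      integral_const_mul, integral_const_mul]
    have h1 := Real.add_one_le_exp (256 * s ^ 2 * t ^ 2)
    have h2 : (t / c) ^ 2 = 64 * s ^ 2 * t ^ 2 := by rw [hc]; field_simp; norm_num
    rw [h2]
    have h3 : 2 * (64 * s ^ 2 * t ^ 2) * ∫ ω, Real.exp (2 * c * |X ω|) ∂μ ≤
      2 * (64 * s ^ 2 * t ^ 2) * 2 := by gcongr
    simp
    linarith
  intro t ht
  have ht' : |-t| ≤ c := by rwa [abs_neg]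
  obtain ⟨h1, h2⟩ := mgf_sub_integral_le hXi (hint t ht) (hint (-t) ht') (hmgf t ht) (hmgf (-t) ht')
  refine ⟨h1, h2.trans ?_⟩
  rw [neg_sq]
  set m := ∫ ω, X ω ∂μ
  calc (t * m + Real.exp (256 * s ^ 2 * t ^ 2)) * (-t * m + Real.exp (256 * s ^ 2 * t ^ 2))
      ≤ Real.exp (256 * s ^ 2 * t ^ 2) * Real.exp (256 * s ^ 2 * t ^ 2) := by
        nlinarith [sq_nonneg (t * m)]
    _ = _ := by rw [← Real.exp_add]; ring_nf

end Exponential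

/-! ### Nets of Euclidean balls and the norms of linear and bilinear forms. -/

section Nets

/-- The unit ball of `ℝ^m` has a `1/2`-net of cardinality at most `5^m`. -/
lemma exists_net (m : ℕ) : ∃ T : Finset (Eucl m), T.card ≤ 5 ^ m ∧ (∀ u ∈ T, ‖u‖ ≤ 1) ∧
    ∀ v : Eucl m, ‖v‖ ≤ 1 → ∃ u ∈ T, ‖v - u‖ ≤ 1 / 2 := by
  classical
  let P : Finset (Eucl m) → Prop := fun T => (∀ u ∈ T, ‖u‖ ≤ 1) ∧
    ∀ u ∈ T, ∀ v ∈ T, u ≠ v → 1 / 2 ≤ ‖u - v‖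
  have hcard : ∀ T, P T → T.card ≤ 5 ^ m := by
    intro T hT
    have hinj : Function.Injective (fun u : Eucl m => (2 : ℝ) • u) :=
      smul_right_injective _ (by norm_num)
    -- Doubling turns a `1/2`-separated subset of the unit ball into a `1`-separated subset of the
    -- ball of radius `2`, the normalisation of the packing bound.
    have := Besicovitch.card_le_of_separated (T.image fun u => (2 : ℝ) • u) ?_ ?_
    · rwa [Finset.card_image_of_injective _ hinj, finrank_euclideanSpace_fin] at this
    · intro c hc
      obtain ⟨u, hu, rfl⟩ := Finset.mem_image.1 hc
      rw [norm_smul]; norm_num; exact hT.1 u hu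
    · intro c hc e he hne
      obtain ⟨u, hu, rfl⟩ := Finset.mem_image.1 hc
      obtain ⟨v, hv, rfl⟩ := Finset.mem_image.1 he
      have := hT.2 u hu v hv (fun h => hne (by rw [h]))
      rw [← smul_sub, norm_smul, Real.norm_of_nonneg (by norm_num)]
      linarith
  have hP0 : P ∅ := ⟨by simp, by simp⟩
  -- The packing bound provides a separated set of maximal cardinality; a point far from it could be
  -- added, so it is a net.
  obtain ⟨T, hT, hTmax⟩ : ∃ T, P T ∧ ∀ T', P T' → T'.card ≤ T.card := by
    have hne : (Set.range fun T : {T // P T} => T.1.card).Nonempty := ⟨_, ⟨⟨∅, hP0⟩, rfl⟩⟩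
    have hbd : BddAbove (Set.range fun T : {T // P T} => T.1.card) :=
      ⟨5 ^ m, by rintro _ ⟨T, rfl⟩; exact hcard _ T.2⟩
    obtain ⟨T, hT⟩ := Nat.sSup_mem hne hbd
    refine ⟨T.1, T.2, fun T' hT' => ?_⟩
    simp only at hT
    rw [hT]
    exact le_csSup hbd ⟨⟨T', hT'⟩, rfl⟩
  refine ⟨T, hcard T hT, hT.1, fun v hv => ?_⟩
  by_contra! hcon
  have hvT : v ∉ T := fun h => by have := hcon v h; simp at this; linarith
  have : P (insert v T) := by
    refine ⟨?_, ?_⟩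
    · intro u hu
      rcases Finset.mem_insert.1 hu with rfl | hu
      · exact hv
      · exact hT.1 u hu
    · intro u hu w hw hne
      rcases Finset.mem_insert.1 hu with rfl | hu' <;> rcases Finset.mem_insert.1 hw with rfl | hw'
      · exact absurd rfl hne
      · exact (hcon w hw').le
      · rw [norm_sub_rev]; exact (hcon u hu').le
      · exact hT.2 u hu' w hw' hne
  have := hTmax _ this
  rw [Finset.card_insert_of_notMem hvT] at this
  omega

/-- A linear form bounded by `t` on a `1/2`-net of the unit ball has norm at most `2 t`. -/
lemma linear_le_of_net {m : ℕ} {T : Finset (Eucl m)}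
    (hT : ∀ v : Eucl m, ‖v‖ ≤ 1 → ∃ u ∈ T, ‖v - u‖ ≤ 1 / 2) (f : Eucl m →ₗ[ℝ] ℝ) {t : ℝ}
    (h : ∀ u ∈ T, |f u| ≤ t) (v : Eucl m) : |f v| ≤ 2 * t * ‖v‖ := by
  set F := LinearMap.toContinuousLinearMap f
  have hF : ∀ v, F v = f v := fun _ => rfl
  -- A unit vector is a net point plus a vector of norm at most `1/2`, and the latter contribution
  -- is absorbed on the left.
  have key : ‖F‖ ≤ t + ‖F‖ / 2 := by
    obtain ⟨u0, hu0, _⟩ := hT 0 (by simp)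
    have ht : 0 ≤ t := (abs_nonneg _).trans (h u0 hu0)
    refine ContinuousLinearMap.opNorm_le_of_unit_norm (by positivity) fun v hv => ?_
    obtain ⟨u, hu, huv⟩ := hT v hv.le
    have e : F v = f u + F (v - u) := by rw [map_sub, hF u]; ring
    have h1 := F.le_opNorm (v - u)
    rw [e]
    refine (norm_add_le _ _).trans (add_le_add (h u hu) (h1.trans ?_))
    nlinarith [norm_nonneg F]
  have := F.le_opNorm v
  rw [hF, Real.norm_eq_abs] at this
  exact this.trans (by nlinarith [norm_nonneg v])

/-- A bilinear form bounded by `t` on `1/2`-nets of the unit balls has norm at most `4 t`. -/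
lemma bilinear_le_of_net {p q : ℕ} {T : Finset (Eucl p)} {T' : Finset (Eucl q)}
    (hT : ∀ v : Eucl p, ‖v‖ ≤ 1 → ∃ u ∈ T, ‖v - u‖ ≤ 1 / 2)
    (hT' : ∀ v : Eucl q, ‖v‖ ≤ 1 → ∃ u ∈ T', ‖v - u‖ ≤ 1 / 2)
    (f : Eucl p →ₗ[ℝ] Eucl q →ₗ[ℝ] ℝ) {t : ℝ} (h : ∀ u ∈ T, ∀ v ∈ T', |f u v| ≤ t)
    (u : Eucl p) (v : Eucl q) : |f u v| ≤ 4 * t * ‖u‖ * ‖v‖ := by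
  have h1 : ∀ u ∈ T, |f.flip v u| ≤ 2 * t * ‖v‖ := fun u hu =>
    linear_le_of_net hT' (f u) (h u hu) v
  have := linear_le_of_net hT (f.flip v) h1 u
  rw [LinearMap.flip_apply] at this
  linarith

end Nets

/-! ### Singular subspaces, their perturbation, and extreme eigenvalues. -/

section LinearAlgebra

variable {p q r d k : ℕ}

lemma mulV_apply (A : Matrix (Fin p) (Fin q) ℝ) (v : Eucl q) (i : Fin p) :
    mulV A v i = ∑ j, A i j * v j := rfl

lemma mulV_add (A : Matrix (Fin p) (Fin q) ℝ) (u v : Eucl q) :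
    mulV A (u + v) = mulV A u + mulV A v := by
  ext i; simp [mulV_apply, mul_add, Finset.sum_add_distrib]

lemma mulV_smul (A : Matrix (Fin p) (Fin q) ℝ) (c : ℝ) (v : Eucl q) :
    mulV A (c • v) = c • mulV A v := by
  ext i
  simp only [mulV_apply, PiLp.smul_apply, smul_eq_mul, Finset.mul_sum]
  exact Finset.sum_congr rfl fun _ _ => by ring

/-- `mulV A` as a linear map. -/
def mulVₗ (A : Matrix (Fin p) (Fin q) ℝ) : Eucl q →ₗ[ℝ] Eucl p where
  toFun := mulV A
  map_add' := mulV_add A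
  map_smul' := mulV_smul A

lemma mulVₗ_apply (A : Matrix (Fin p) (Fin q) ℝ) (v : Eucl q) : mulVₗ A v = mulV A v := rfl

lemma mulV_sub (A : Matrix (Fin p) (Fin q) ℝ) (u v : Eucl q) :
    mulV A (u - v) = mulV A u - mulV A v := map_sub (mulVₗ A) u v

lemma sub_mulV (A B : Matrix (Fin p) (Fin q) ℝ) (v : Eucl q) :
    mulV (A - B) v = mulV A v - mulV B v := by
  ext i; simp [mulV_apply, sub_mul, Finset.sum_sub_distrib]

lemma mulV_mulV (A : Matrix (Fin p) (Fin q) ℝ) (B : Matrix (Fin q) (Fin r) ℝ) (v : Eucl r) :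
    mulV A (mulV B v) = mulV (A * B) v := by
  simp [mulV, Matrix.mulVec_mulVec]

lemma one_mulV (v : Eucl p) : mulV 1 v = v := by simp [mulV]

lemma inner_eq_sum (u v : Eucl p) : inner ℝ u v = ∑ i, u i * v i := by
  simp [PiLp.inner_apply, mul_comm]

lemma inner_mulV (A : Matrix (Fin p) (Fin q) ℝ) (u : Eucl p) (v : Eucl q) :
    inner ℝ u (mulV A v) = inner ℝ (mulV Aᵀ u) v := by
  simp only [inner_eq_sum, mulV_apply, Matrix.transpose_apply, Finset.mul_sum, Finset.sum_mul]
  rw [Finset.sum_comm]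
  exact Finset.sum_congr rfl fun _ _ => Finset.sum_congr rfl fun _ _ => by ring

lemma norm_mulV_of_orth {A : Matrix (Fin p) (Fin q) ℝ} (h : Aᵀ * A = 1) (v : Eucl q) :
    ‖mulV A v‖ = ‖v‖ := by
  have : ‖mulV A v‖ ^ 2 = ‖v‖ ^ 2 := by
    rw [← real_inner_self_eq_norm_sq, inner_mulV, mulV_mulV, h, one_mulV,
      real_inner_self_eq_norm_sq]
  exact (sq_eq_sq₀ (norm_nonneg _) (norm_nonneg _)).1 this

lemma inner_mulV_mulV_of_orth {A : Matrix (Fin p) (Fin q) ℝ} (h : Aᵀ * A = 1) (u v : Eucl q) :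
    inner ℝ (mulV A u) (mulV A v) = inner ℝ u v := by
  rw [inner_mulV, mulV_mulV, h, one_mulV]

lemma norm_mulV_transpose_le {A : Matrix (Fin p) (Fin q) ℝ} (h : Aᵀ * A = 1) (v : Eucl p) :
    ‖mulV Aᵀ v‖ ≤ ‖v‖ := by
  have h1 : ‖mulV Aᵀ v‖ ^ 2 ≤ ‖mulV Aᵀ v‖ * ‖v‖ := by
    rw [← real_inner_self_eq_norm_sq, ← inner_mulV]
    refine (real_inner_le_norm _ _).trans_eq ?_
    rw [norm_mulV_of_orth h, mul_comm]
  rcases (norm_nonneg (mulV Aᵀ v)).eq_or_lt with h0 | h0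
  · rw [← h0]; exact norm_nonneg _
  · nlinarith

lemma inner_sum_vecMulVec {ι : Type*} (s : Finset ι) (c : ι → ℝ) (a : ι → Fin p → ℝ)
    (b : ι → Fin q → ℝ) (u : Eucl p) (v : Eucl q) :
    inner ℝ u (mulV (∑ i ∈ s, c i • Matrix.vecMulVec (a i) (b i)) v) =
      ∑ i ∈ s, c i * (inner ℝ u (WithLp.toLp 2 (a i)) * inner ℝ v (WithLp.toLp 2 (b i))) := by
  simp only [inner_eq_sum, mulV_apply, Matrix.sum_apply, Matrix.smul_apply, Matrix.vecMulVec_apply,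
    Finset.mul_sum, Finset.sum_mul, smul_eq_mul]
  have : ∀ x : Fin p, ∑ y : Fin q, ∑ i ∈ s, u x * (c i * (a i x * b i y) * v y) =
      ∑ i ∈ s, ∑ y : Fin q, u x * (c i * (a i x * b i y) * v y) := fun x => Finset.sum_comm
  simp_rw [this]
  rw [Finset.sum_comm]
  refine Finset.sum_congr rfl fun i _ => ?_
  rw [Finset.sum_comm]
  exact Finset.sum_congr rfl fun _ _ => Finset.sum_congr rfl fun _ _ => by ring

lemma norm_sq_mulV_diagonal {Z U W : Matrix (Fin d) (Fin d) ℝ} {s : Fin d → ℝ} (hU : Uᵀ * U = 1)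
    (hZ : Z = U * Matrix.diagonal s * Wᵀ) (v : Eucl d) :
    ‖mulV Z v‖ ^ 2 = ∑ i, (s i * mulV Wᵀ v i) ^ 2 := by
  rw [hZ, ← mulV_mulV, ← mulV_mulV, norm_mulV_of_orth hU, EuclideanSpace.real_norm_sq_eq]
  refine Finset.sum_congr rfl fun i _ => ?_
  rw [mulV_apply, Finset.sum_eq_single i]
  · simp
  · intro j _ hj; simp [Matrix.diagonal_apply_ne _ hj.symm]
  · simp

lemma IsTopRightSingular.orth {Z : Matrix (Fin d) (Fin d) ℝ} {V : Matrix (Fin d) (Fin k) ℝ}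
    (h : IsTopRightSingular Z V) : Vᵀ * V = 1 := by
  obtain ⟨hk, U, W, s, -, hW, -, -, -, hV⟩ := h
  ext i j
  have := congrFun (congrFun hW (Fin.castLE hk i)) (Fin.castLE hk j)
  simp only [Matrix.mul_apply, Matrix.transpose_apply] at this ⊢
  simp_rw [hV, this, Matrix.one_apply, Fin.castLE_inj]

/-- The residual lies in the span of the remaining right singular vectors, on which `Z` is bounded
by its singular value number `k + 1`. That value is at most `ε`: by a dimension count, the first `k
+ 1` right singular vectors span a nonzero `v` with `Bᵀ v = 0`, where `A` vanishes and `Z` acts as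
`Z - A`. -/
lemma IsTopRightSingular.norm_mulV_residual_le {Z A : Matrix (Fin d) (Fin d) ℝ}
    {V B : Matrix (Fin d) (Fin k) ℝ} (h : IsTopRightSingular Z V)
    (hA : ∀ v, mulV Bᵀ v = 0 → mulV A v = 0) {ε : ℝ} (hε : 0 ≤ ε)
    (hZA : ∀ u v, |inner ℝ u (mulV (Z - A) v)| ≤ ε * ‖u‖ * ‖v‖) (x : Eucl d) :
    ‖mulV Z (x - mulV V (mulV Vᵀ x))‖ ≤ ε * ‖x - mulV V (mulV Vᵀ x)‖ := by
  have hVV := h.orth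
  obtain ⟨hk, U, W, s, hU, hW, hs0, hs, hZ, hV⟩ := h
  set u := x - mulV V (mulV Vᵀ x) with hu
  have hW' : Wᵀᵀ * Wᵀ = 1 := by rw [Matrix.transpose_transpose]; exact mul_eq_one_comm.1 hW
  have hnorm : ∀ v : Eucl d, ‖v‖ ^ 2 = ∑ i, mulV Wᵀ v i ^ 2 := fun v => by
    rw [← norm_mulV_of_orth hW' v, EuclideanSpace.real_norm_sq_eq]
  have hlow : ∀ i : Fin d, i.val < k → mulV Wᵀ u i = 0 := by
    intro i hi
    have h1 : mulV Vᵀ u = 0 := by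
      rw [hu, mulV_sub, mulV_mulV Vᵀ V, hVV, one_mulV, sub_self]
    have h2 := congrArg (fun z : Eucl k => z ⟨i, hi⟩) h1
    simp only [mulV_apply, Matrix.transpose_apply, hV, PiLp.zero_apply] at h2
    exact h2
  -- The free bound `σ` also covers `k = d`, where no singular value remains and `σ = 0` is allowed.
  have key : ∀ σ : ℝ, 0 ≤ σ → σ ≤ ε → (∀ i : Fin d, k ≤ i.val → s i ≤ σ) →
      ‖mulV Z u‖ ≤ ε * ‖u‖ := by
    intro σ hσ hσε hi
    refine le_trans (abs_le_of_sq_le_sq' ?_ (by positivity)).2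
      (mul_le_mul_of_nonneg_right hσε (norm_nonneg _))
    rw [mul_pow, norm_sq_mulV_diagonal hU hZ, hnorm u, Finset.mul_sum]
    refine Finset.sum_le_sum fun i _ => ?_
    rcases lt_or_ge i.val k with hik | hik
    · simp [hlow i hik]
    · rw [mul_pow]
      exact mul_le_mul_of_nonneg_right (pow_le_pow_left₀ (hs0 i) (hi i hik) 2) (sq_nonneg _)
  rcases lt_or_ge k d with hkd | hkd
  swap
  · exact key 0 le_rfl hε fun i hi => absurd i.2 (by omega)
  refine key (s ⟨k, hkd⟩) (hs0 _) ?_ fun i hi => hs (by exact hi)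
  let W' : Matrix (Fin d) (Fin (k + 1)) ℝ := Matrix.of fun i j => W i (Fin.castLE hkd j)
  have hWW' : ∀ i j, (Wᵀ * W') i j = if i = Fin.castLE hkd j then 1 else 0 := by
    intro i j
    have := congrFun (congrFun hW i) (Fin.castLE hkd j)
    rw [Matrix.one_apply] at this
    exact this
  obtain ⟨c, hc, hc0⟩ := Submodule.exists_mem_ne_zero_of_ne_bot
    (LinearMap.ker_ne_bot_of_finrank_lt (f := mulVₗ (Bᵀ * W')) (by simp))
  rw [LinearMap.mem_ker, mulVₗ_apply, ← mulV_mulV] at hc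
  set v := mulV W' c with hv
  have hWv : ∀ i, mulV Wᵀ v i = ∑ j, if i = Fin.castLE hkd j then c j else 0 := by
    intro i
    rw [hv, mulV_mulV, mulV_apply]
    exact Finset.sum_congr rfl fun j _ => by rw [hWW', ite_mul, one_mul, zero_mul]
  have hv0 : v ≠ 0 := by
    intro h0
    apply hc0
    ext j
    have h1 := hWv (Fin.castLE hkd j)
    rw [h0] at h1
    simp only [Fin.castLE_inj, Finset.sum_ite_eq, Finset.mem_univ, if_true] at h1
    rw [← h1]
    simp [mulV_apply]
  have h1 : s ⟨k, hkd⟩ * ‖v‖ ≤ ‖mulV Z v‖ := by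
    refine (abs_le_of_sq_le_sq' ?_ (by positivity)).2
    rw [mul_pow, norm_sq_mulV_diagonal hU hZ, hnorm v, Finset.mul_sum]
    refine Finset.sum_le_sum fun i _ => ?_
    rcases le_or_gt i.val k with hik | hik
    · rw [mul_pow]
      exact mul_le_mul_of_nonneg_right (pow_le_pow_left₀ (hs0 _) (hs (by exact hik)) 2) (sq_nonneg _)
    · have : mulV Wᵀ v i = 0 := by
        rw [hWv]
        refine Finset.sum_eq_zero fun j _ => if_neg fun h => ?_
        have := congrArg Fin.val h
        simp only [Fin.val_castLE] at this
        omega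
      simp [this]
  have h2 : ‖mulV Z v‖ ≤ ε * ‖v‖ := by
    have e : mulV (Z - A) v = mulV Z v := by rw [sub_mulV, hA v hc, sub_zero]
    have h3 := hZA (mulV Z v) v
    rw [e, real_inner_self_eq_norm_sq, abs_of_nonneg (sq_nonneg _)] at h3
    rcases (norm_nonneg (mulV Z v)).eq_or_lt with h0 | h0
    · rw [← h0]; positivity
    · nlinarith
  exact le_of_mul_le_mul_right (h1.trans h2) (norm_pos_iff.2 hv0)

/-- A `sin Θ` bound for the top right singular vectors of a perturbation of `B D Bᵀ`. -/
lemma IsTopRightSingular.norm_sub_proj_le {Z : Matrix (Fin d) (Fin d) ℝ} {D : Matrix (Fin k) (Fin k) ℝ}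
    {V B : Matrix (Fin d) (Fin k) ℝ} (h : IsTopRightSingular Z V) (hB : Bᵀ * B = 1) {ε c a : ℝ}
    (hε : 0 ≤ ε) (hc : 0 < c) (hD : ∀ w : Eucl k, c * ‖w‖ ^ 2 ≤ inner ℝ w (mulV D w))
    (hZA : ∀ u v, |inner ℝ u (mulV (Z - B * D * Bᵀ) v)| ≤ ε * ‖u‖ * ‖v‖) (α : Eucl k)
    (ha : ‖α‖ ≤ a) :
    ‖mulV B α - mulV V (mulV Vᵀ (mulV B α))‖ ≤ 2 * ε * a / c := by
  have hres := h.norm_mulV_residual_le (A := B * D * Bᵀ) (B := B)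
    (fun v hv => by rw [← mulV_mulV, hv]; exact (mulVₗ _).map_zero) hε hZA (mulV B α)
  have hVV := h.orth
  set u := mulV B α - mulV V (mulV Vᵀ (mulV B α)) with hu
  set w := mulV Bᵀ u with hw
  -- The form of `D` at `w = Bᵀ u` is that of `B D Bᵀ` between `B w` and `u`. It splits into the
  -- parts of `Z` and of the perturbation, each at most `ε ‖u‖ ‖w‖`.
  have h1 : c * ‖w‖ ^ 2 ≤ 2 * ε * ‖u‖ * ‖w‖ := by
    have e : inner ℝ w (mulV D w) =
        inner ℝ (mulV B w) (mulV Z u) - inner ℝ (mulV B w) (mulV (Z - B * D * Bᵀ) u) := by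
      rw [← inner_sub_right, ← sub_mulV, sub_sub_cancel, ← mulV_mulV, ← mulV_mulV,
        inner_mulV_mulV_of_orth hB]
    have h2 := hZA (mulV B w) u
    have h3 := real_inner_le_norm (mulV B w) (mulV Z u)
    rw [norm_mulV_of_orth hB] at h2 h3
    have h4 := (abs_le.1 h2).1
    have h5 := mul_le_mul_of_nonneg_left hres (norm_nonneg w)
    have := hD w
    rw [e] at this
    linarith
  have h2 : c * ‖w‖ ≤ 2 * ε * ‖u‖ := by
    rcases (norm_nonneg w).eq_or_lt with h0 | h0
    · rw [← h0]; simp; positivity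
    · nlinarith
  -- The residual `u` is orthogonal to the range of `V`, so its squared norm is its inner product
  -- with `B α`, which only sees `w`.
  have h3 : ‖u‖ ^ 2 = inner ℝ w α := by
    rw [← real_inner_self_eq_norm_sq, hw, ← inner_mulV]
    have h4 : inner ℝ u (mulV V (mulV Vᵀ (mulV B α))) = 0 := by
      rw [inner_mulV]
      have : mulV Vᵀ u = 0 := by
        rw [hu, mulV_sub, mulV_mulV Vᵀ V, hVV, one_mulV, sub_self]
      rw [this, inner_zero_left]
    conv_lhs => rw [hu, inner_sub_right]
    rw [h4, sub_zero]
  have h4 : ‖u‖ ^ 2 ≤ ‖w‖ * a := by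
    rw [h3]
    exact (real_inner_le_norm _ _).trans (mul_le_mul_of_nonneg_left ha (norm_nonneg _))
  rw [le_div_iff₀ hc]
  rcases (norm_nonneg u).eq_or_lt with h0 | h0
  · rw [← h0]
    have : 0 ≤ a := (norm_nonneg _).trans ha
    simp; positivity
  · have ha0 : 0 ≤ a := (norm_nonneg _).trans ha
    have : ‖u‖ * (‖u‖ * c) ≤ ‖u‖ * (2 * ε * a) := by nlinarith
    exact le_of_mul_le_mul_left this h0

lemma norm_sub_proj_le {V : Matrix (Fin d) (Fin k) ℝ} (hV : Vᵀ * V = 1) (x : Eucl d) :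
    ‖x - mulV V (mulV Vᵀ x)‖ ≤ ‖x‖ := by
  have h : ‖x - mulV V (mulV Vᵀ x)‖ ^ 2 = ‖x‖ ^ 2 - ‖mulV Vᵀ x‖ ^ 2 := by
    rw [norm_sub_sq_real, inner_mulV, real_inner_self_eq_norm_sq, norm_mulV_of_orth hV]
    ring
  exact (abs_le_of_sq_le_sq' (by rw [h]; linarith [sq_nonneg ‖mulV Vᵀ x‖]) (norm_nonneg _)).2

lemma inner_mulV_eq_sum_eigenvalues {A : Matrix (Fin d) (Fin d) ℝ} (hA : A.IsHermitian) (w : Eucl d) :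
    inner ℝ w (mulV A w) = ∑ i, hA.eigenvalues i * inner ℝ (hA.eigenvectorBasis i) w ^ 2 := by
  rw [← hA.eigenvectorBasis.sum_inner_mul_inner w (mulV A w)]
  refine Finset.sum_congr rfl fun i _ => ?_
  have hT : Aᵀ = A := (Matrix.conjTranspose_eq_transpose_of_trivial A).symm.trans hA
  have : mulV A (hA.eigenvectorBasis i) = hA.eigenvalues i • hA.eigenvectorBasis i := by
    ext j
    exact congrFun (hA.mulVec_eigenvectorBasis i) j
  rw [inner_mulV, hT, this, real_inner_smul_left, real_inner_comm w]
  ring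

lemma eig_bounds {A : Matrix (Fin d) (Fin d) ℝ} (hA : A.IsHermitian) (hd : 1 ≤ d) (w : Eucl d) :
    eig A d * ‖w‖ ^ 2 ≤ inner ℝ w (mulV A w) ∧ inner ℝ w (mulV A w) ≤ eig A 1 * ‖w‖ ^ 2 := by
  rw [inner_mulV_eq_sum_eigenvalues hA, ← hA.eigenvectorBasis.sum_sq_norm_inner_right w,
    Finset.mul_sum, Finset.mul_sum]
  have h1 : eig A d = hA.eigenvalues₀ ⟨d - 1, by rw [Fintype.card_fin]; omega⟩ :=
    dif_pos ⟨hA, hd, le_rfl⟩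
  have h2 : eig A 1 = hA.eigenvalues₀ ⟨1 - 1, by rw [Fintype.card_fin]; omega⟩ :=
    dif_pos ⟨hA, le_rfl, hd⟩
  simp only [Real.norm_eq_abs, sq_abs]
  constructor <;> refine Finset.sum_le_sum fun i _ => mul_le_mul_of_nonneg_right ?_ (sq_nonneg _)
  · rw [h1]
    refine hA.eigenvalues₀_antitone ?_
    rw [Fin.le_def]
    have := ((Fintype.equivOfCardEq (Fintype.card_fin _)).symm i : Fin (Fintype.card (Fin d))).2
    exact Nat.le_sub_one_of_lt (this.trans_eq (Fintype.card_fin d))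
  · rw [h2]
    refine hA.eigenvalues₀_antitone ?_
    rw [Fin.le_def]
    simp

lemma eig_nonneg {A : Matrix (Fin d) (Fin d) ℝ} (hA : A.IsHermitian)
    (h : ∀ w : Eucl d, 0 ≤ inner ℝ w (mulV A w)) (r : ℕ) : 0 ≤ eig A r := by
  unfold eig
  split_ifs with h1
  · have hps : A.PosSemidef := by
      refine Matrix.PosSemidef.of_dotProduct_mulVec_nonneg hA fun x => ?_
      have := h (WithLp.toLp 2 x)
      rw [inner_eq_sum] at this
      simpa [dotProduct, mulV] using this
    have := hps.eigenvalues_nonneg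
      ((Fintype.equivOfCardEq (Fintype.card_fin _)) ⟨r - 1, by rw [Fintype.card_fin]; omega⟩)
    simpa [Matrix.IsHermitian.eigenvalues] using this
  · exact le_rfl

end LinearAlgebra

/-! ### Moments of one sample, and truncation. -/

section Samples

variable {Ω : Type*} {mΩ : MeasurableSpace Ω} {μ : Measure Ω} [IsProbabilityMeasure μ] {d : ℕ}

lemma IsSubG.integrable {X : Ω → ℝ} {c : ℝ≥0} (h : IsSubG μ X c) : Integrable X μ := by
  have h1 := HasSubgaussianMGF.integrable h
  refine (h1.add (integrable_const (∫ ω', X ω' ∂μ))).congr (Filter.Eventually.of_forall fun ω => ?_)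
  simp

lemma IsSubG.hasSubgaussianMGF {X : Ω → ℝ} {c : ℝ≥0} (h : IsSubG μ X c) (h0 : ∫ ω, X ω ∂μ = 0) :
    HasSubgaussianMGF X c μ := by
  unfold IsSubG at h
  simpa [h0] using h

lemma IsSubGVec.integrable {x : Ω → Eucl d} {c : ℝ≥0} (h : IsSubGVec μ x c) : Integrable x μ := by
  have h1 : ∀ p, Integrable (fun ω => x ω p) μ := by
    intro p
    have := (h (EuclideanSpace.single p 1) (by simp)).integrable
    simpa [EuclideanSpace.inner_single_left] using this
  have h2 : x = fun ω => ∑ p, x ω p • EuclideanSpace.single p (1 : ℝ) := by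
    funext ω
    ext q
    simp [Finset.sum_apply, Pi.single_apply]
  rw [h2]
  exact integrable_finsetSum _ fun p _ => (h1 p).smul_const _

lemma IsSubGVec.hasSubgaussianMGF {x : Ω → Eucl d} {c : ℝ≥0} (h : IsSubGVec μ x c)
    (h0 : ∫ ω, x ω ∂μ = 0) (u : Eucl d) {c' : ℝ≥0} (hc : ‖u‖ ^ 2 * c ≤ c') :
    HasSubgaussianMGF (fun ω => inner ℝ u (x ω)) c' μ := by
  by_cases hu : u = 0
  · subst hu
    simp only [inner_zero_left]
    exact HasSubgaussianMGF.fun_zero.mono zero_le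
  have hu' : ‖u‖ ≠ 0 := norm_ne_zero_iff.2 hu
  have h1 : HasSubgaussianMGF (fun ω => inner ℝ (‖u‖⁻¹ • u) (x ω)) c μ := by
    refine (h _ (by rw [norm_smul, norm_inv, norm_norm, inv_mul_cancel₀ hu'])).hasSubgaussianMGF ?_
    rw [integral_inner h.integrable, h0, inner_zero_right]
  have h2 := h1.const_mul ‖u‖
  refine HasSubgaussianMGF.mono (c := ⟨‖u‖ ^ 2, by positivity⟩ * c) ?_ ?_
  · refine h2.congr (Filter.Eventually.of_forall fun ω => ?_)
    simp only [real_inner_smul_left]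
    field_simp
  · exact_mod_cast hc

lemma IsSubGVec.integral_inner_mul_inner {x : Ω → Eucl d} {c : ℝ≥0} (h : IsSubGVec μ x c)
    (h0 : ∫ ω, x ω ∂μ = 0) {Γ : Matrix (Fin d) (Fin d) ℝ}
    (hΓ : ∀ p q, ∫ ω, x ω p * x ω q ∂μ = Γ p q) (u v : Eucl d) :
    ∫ ω, inner ℝ u (x ω) * inner ℝ v (x ω) ∂μ = inner ℝ u (mulV Γ v) := by
  have hL : ∀ p, MemLp (fun ω => x ω p) 2 μ := by
    intro p
    have := (h.hasSubgaussianMGF h0 (EuclideanSpace.single p 1) (c' := c) (by simp)).memLp 2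
    simpa [EuclideanSpace.inner_single_left] using this
  have hi : ∀ p q, Integrable (fun ω => x ω p * x ω q) μ := fun p q =>
    (hL p).integrable_mul (hL q)
  have e : ∀ ω, inner ℝ u (x ω) * inner ℝ v (x ω) =
      ∑ p, ∑ q, (u p * v q) * (x ω p * x ω q) := by
    intro ω
    rw [inner_eq_sum, inner_eq_sum, Finset.sum_mul_sum]
    exact Finset.sum_congr rfl fun _ _ => Finset.sum_congr rfl fun _ _ => by ring
  simp_rw [e]
  rw [integral_finsetSum _ fun p _ => integrable_finsetSum _ fun q _ => (hi p q).const_mul _,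
    inner_eq_sum]
  refine Finset.sum_congr rfl fun p _ => ?_
  rw [integral_finsetSum _ fun q _ => (hi p q).const_mul _, mulV_apply, Finset.mul_sum]
  refine Finset.sum_congr rfl fun q _ => ?_
  rw [integral_const_mul, hΓ]; ring

lemma _root_.ProbabilityTheory.HasSubgaussianMGF.memLp_two {w : Ω → ℝ} {s : ℝ≥0}
    (h : HasSubgaussianMGF w s μ) : MemLp w 2 μ := by
  simpa using h.memLp 2

lemma integral_pow_four_le {w : Ω → ℝ} {s : ℝ≥0} (h : HasSubgaussianMGF w s μ) :
    Integrable (fun ω => w ω ^ 4) μ ∧ ∫ ω, w ω ^ 4 ∂μ ≤ 48 * Real.exp (s / 2) := by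
  obtain ⟨h1, h2⟩ := integral_exp_mul_abs_le h 1
  have hle : ∀ ω, w ω ^ 4 ≤ 24 * Real.exp (1 * |w ω|) := by
    intro ω
    have := Real.pow_div_factorial_le_exp |w ω| (abs_nonneg _) 4
    rw [div_le_iff₀ (by positivity), Even.pow_abs (by decide)] at this
    norm_num [Nat.factorial] at this
    rw [one_mul]; linarith
  have hi : Integrable (fun ω => w ω ^ 4) μ := by
    have hm := h.aestronglyMeasurable
    refine (h1.const_mul 24).mono' (by fun_prop) (Filter.Eventually.of_forall fun ω => ?_)
    rw [Real.norm_of_nonneg (by positivity)]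
    exact hle ω
  refine ⟨hi, (integral_mono hi (h1.const_mul 24) hle).trans ?_⟩
  rw [integral_const_mul]
  norm_num at h2
  norm_num
  linarith

/-- Truncation of a real number at level `L`. -/
def trunc (L y : ℝ) : ℝ := if |y| ≤ L then y else 0

lemma measurable_trunc (L : ℝ) : Measurable (trunc L) := by
  unfold trunc
  exact Measurable.ite (measurableSet_le (by fun_prop) measurable_const) measurable_id measurable_const

lemma abs_trunc_le {L : ℝ} (hL : 0 ≤ L) (y : ℝ) : |trunc L y| ≤ L := by
  unfold trunc
  split_ifs with h
  · exact h
  · simpa using hL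

lemma trunc_of_le {L y : ℝ} (h : |y| ≤ L) : trunc L y = y := if_pos h

/-- The truncated and weighted projection of a covariate is sub-gaussian after centring. -/
lemma hasSubgaussianMGF_trunc_mul {y w : Ω → ℝ} {s : ℝ≥0} (hy : AEStronglyMeasurable y μ)
    (hw : HasSubgaussianMGF w s μ) {L : ℝ} (hL : 0 ≤ L) {c : ℝ≥0} (hc : 14 * L ^ 2 * s ≤ c) :
    HasSubgaussianMGF (fun ω => trunc L (y ω) * w ω - ∫ ω', trunc L (y ω') * w ω' ∂μ) c μ := by
  have hm : AEStronglyMeasurable (fun ω => trunc L (y ω)) μ :=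
    ((measurable_trunc L).comp_aemeasurable hy.aemeasurable).aestronglyMeasurable
  refine (hasSubgaussianMGF_sub_integral_of_abs_le (hm.mul hw.aestronglyMeasurable)
    (hw.const_mul L) fun ω => ?_).mono ?_
  · simp only [Pi.mul_apply]
    rw [abs_mul, abs_mul, abs_of_nonneg hL]
    exact mul_le_mul_of_nonneg_right (abs_trunc_le hL _) (abs_nonneg _)
  · rw [← NNReal.coe_le_coe]
    refine le_trans (le_of_eq ?_) hc
    push_cast
    change 14 * (L ^ 2 * (s : ℝ)) = _
    ring

lemma integrable_trunc_mul {y w : Ω → ℝ} (hy : AEStronglyMeasurable y μ)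
    (hw : Integrable w μ) {L : ℝ} (hL : 0 ≤ L) :
    Integrable (fun ω => trunc L (y ω) * w ω) μ := by
  have hm : AEStronglyMeasurable (fun ω => trunc L (y ω)) μ :=
    ((measurable_trunc L).comp_aemeasurable hy.aemeasurable).aestronglyMeasurable
  exact hw.bdd_mul hm (Filter.Eventually.of_forall fun ω => abs_trunc_le hL _)

/-- The bias of the truncated projection. -/
lemma abs_integral_sub_trunc_le {y w : Ω → ℝ} {τ s : ℝ≥0} (hy : HasSubgaussianMGF y τ μ)
    (hw : HasSubgaussianMGF w s μ) {K r : ℝ} (hK : 0 < K) (hτ : τ ≤ K) (hr : 0 < r) :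
    |∫ ω, y ω * w ω ∂μ - ∫ ω, trunc (4 * √(K * (12 * r))) (y ω) * w ω ∂μ| ≤
      (12 * (Real.exp (τ / 2) + Real.exp (s / 2)) + 1) * Real.exp (-r) := by
  set L := 4 * √(K * (12 * r)) with hL
  have hL0 : 0 ≤ L := by positivity
  set η := Real.exp (-r) with hη
  have hη0 : 0 < η := Real.exp_pos _
  obtain ⟨iy, by4⟩ := integral_pow_four_le hy
  obtain ⟨iw, bw4⟩ := integral_pow_four_le hw
  have hyw : Integrable (fun ω => y ω * w ω) μ := (hy.memLp_two).integrable_mul (hw.memLp_two)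
  have htw := integrable_trunc_mul hy.aestronglyMeasurable hw.integrable hL0
  have hms : NullMeasurableSet {ω | L ≤ |y ω|} μ :=
    nullMeasurableSet_le aemeasurable_const (hy.aestronglyMeasurable.norm.aemeasurable)
  have hind : Integrable (Set.indicator {ω | L ≤ |y ω|} fun _ => (1 : ℝ)) μ :=
    (integrable_const _).indicator₀ hms
  have hprob : ∫ ω, Set.indicator {ω | L ≤ |y ω|} (fun _ => (1 : ℝ)) ω ∂μ ≤
      2 * Real.exp (-(12 * r)) := by
    rw [integral_indicator₀ hms]
    simp only [integral_const, smul_eq_mul, mul_one, measureReal_restrict_apply_univ]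
    exact ENNReal.toReal_le_of_le_ofReal (by positivity)
      (hy.measure_abs_ge_le hK hτ (s := 12 * r) (by positivity))
  -- The weight `η = exp (-r)` balances fourth moments against the probability `2 exp (-12 r)` of
  -- truncation: even divided by `η`, that probability is of order at most `η`.
  rw [← integral_sub hyw htw]
  have hpt : ∀ ω, |y ω * w ω - trunc L (y ω) * w ω| ≤
      η / 4 * (y ω ^ 4 + w ω ^ 4) + η⁻¹ / 2 * Set.indicator {ω | L ≤ |y ω|} (fun _ => (1 : ℝ)) ω := by
    intro ω
    by_cases h : |y ω| ≤ L
    · rw [trunc_of_le h, sub_self, abs_zero]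
      have : 0 ≤ Set.indicator {ω | L ≤ |y ω|} (fun _ => (1 : ℝ)) ω :=
        Set.indicator_nonneg (fun _ _ => zero_le_one) _
      positivity
    · have h1 : trunc L (y ω) = 0 := if_neg h
      push Not at h
      rw [h1, Set.indicator_of_mem (show ω ∈ {ω | L ≤ |y ω|} from h.le), zero_mul, sub_zero]
      have e1 : |y ω * w ω| ≤ η / 2 * (y ω * w ω) ^ 2 + η⁻¹ / 2 := by
        have h2 : η * η⁻¹ = 1 := mul_inv_cancel₀ hη0.ne'
        have h3 : 0 ≤ η⁻¹ * (η * |y ω * w ω| - 1) ^ 2 := by positivity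
        have h4 : η⁻¹ * (η * |y ω * w ω| - 1) ^ 2 =
          (η * η⁻¹) * η * |y ω * w ω| ^ 2 - 2 * (η * η⁻¹) * |y ω * w ω| + η⁻¹ := by ring
        rw [h4, h2, sq_abs] at h3
        linarith
      have e2 : (y ω * w ω) ^ 2 ≤ (y ω ^ 4 + w ω ^ 4) / 2 := by
        nlinarith [sq_nonneg (y ω ^ 2 - w ω ^ 2)]
      have e3 := mul_le_mul_of_nonneg_left e2 (show 0 ≤ η / 2 by positivity)
      linarith
  have i1 : Integrable (fun ω => η / 4 * (y ω ^ 4 + w ω ^ 4)) μ := (iy.add iw).const_mul _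
  have i2 := hind.const_mul (η⁻¹ / 2)
  refine (abs_integral_le_integral_abs).trans ((integral_mono (hyw.sub htw).abs (i1.add i2) hpt).trans ?_)
  simp only [Pi.add_apply]
  rw [integral_add i1 i2, integral_const_mul, integral_const_mul, integral_add iy iw]
  have e4 : η⁻¹ * Real.exp (-(12 * r)) ≤ η := by
    rw [hη, ← Real.exp_neg, ← Real.exp_add]
    exact Real.exp_le_exp.2 (by linarith)
  have e5 := mul_le_mul_of_nonneg_left hprob (show 0 ≤ η⁻¹ / 2 by positivity)
  have e6 := mul_le_mul_of_nonneg_left (add_le_add by4 bw4) (show 0 ≤ η / 4 by positivity)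
  linarith

end Samples

/-! ### Sub-gaussian residuals and bounded parameters in the model. -/

section Model

variable {Ω : Type*} [MeasurableSpace Ω] {μ : Measure Ω} [IsProbabilityMeasure μ] {m d k : ℕ}
  {n : Fin m → ℕ} {x : (i : Fin m) → Fin (n i) → Ω → Eucl d} {y : (i : Fin m) → Fin (n i) → Ω → ℝ}
  {Γ : Fin m → Matrix (Fin d) (Fin d) ℝ} {θ : Fin m → Eucl d}
  {B : Matrix (Fin d) (Fin k) ℝ} {α : Fin m → Eucl k} {σ2 γ2 : ℝ≥0} {κ g a : ℝ}

lemma IsModel.noise_hasSubgaussianMGF (h : IsModel μ n x y Γ θ B α σ2 γ2 κ g a) (i : Fin m)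
    (j : Fin (n i)) : HasSubgaussianMGF (noise (x i j) (y i j) (θ i)) σ2 μ :=
  (h.noise_subG i j).hasSubgaussianMGF (h.noise_mean i j)

lemma IsModel.inner_hasSubgaussianMGF (h : IsModel μ n x y Γ θ B α σ2 γ2 κ g a) (i : Fin m)
    (j : Fin (n i)) {u : Eucl d} {r : ℝ} (hu : ‖u‖ ≤ r) {c : ℝ≥0} (hc : r ^ 2 * γ2 ≤ c) :
    HasSubgaussianMGF (fun ω => inner ℝ u (x i j ω)) c μ :=
  (h.x_subG i j).hasSubgaussianMGF (h.x_mean i j) u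
    ((mul_le_mul_of_nonneg_right (pow_le_pow_left₀ (norm_nonneg _) hu 2) γ2.2).trans hc)

lemma IsModel.integral_inner_mul_inner (h : IsModel μ n x y Γ θ B α σ2 γ2 κ g a) (i : Fin m)
    (j : Fin (n i)) (u v : Eucl d) :
    ∫ ω, inner ℝ u (x i j ω) * inner ℝ v (x i j ω) ∂μ = inner ℝ u (mulV (Γ i) v) :=
  (h.x_subG i j).integral_inner_mul_inner (h.x_mean i j) (h.x_cov i j) u v

/-- Residuals `y - xᵀ v` are sub-gaussian. -/
lemma IsModel.residual_hasSubgaussianMGF (h : IsModel μ n x y Γ θ B α σ2 γ2 κ g a) (i : Fin m)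
    (j : Fin (n i)) (v : Eucl d) {r : ℝ} (hv : ‖θ i - v‖ ≤ r) {c : ℝ≥0}
    (hc : r ^ 2 * γ2 + σ2 ≤ c) :
    HasSubgaussianMGF (fun ω => y i j ω - inner ℝ v (x i j ω)) c μ := by
  have h1 := h.inner_hasSubgaussianMGF i j hv (c := Real.toNNReal (r ^ 2 * γ2))
    (Real.le_coe_toNNReal _)
  have hind : IndepFun (noise (x i j) (y i j) (θ i)) (fun ω => inner ℝ (θ i - v) (x i j ω)) μ :=
    (h.noise_indep i j).comp (φ := id) (ψ := fun z => inner ℝ (θ i - v) z) measurable_id (by fun_prop)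
  have h2 := (h.noise_hasSubgaussianMGF i j).add_of_indepFun h1 hind
  refine (h2.congr (Filter.Eventually.of_forall fun ω => ?_)).mono ?_
  · simp only [noise, inner_sub_left, real_inner_comm (θ i)]
    ring
  · rw [← NNReal.coe_le_coe]
    push_cast
    rw [Real.coe_toNNReal _ (by positivity)]
    linarith

lemma IsModel.integral_residual_mul_inner (h : IsModel μ n x y Γ θ B α σ2 γ2 κ g a) (i : Fin m)
    (j : Fin (n i)) (v u : Eucl d) :
    ∫ ω, (y i j ω - inner ℝ v (x i j ω)) * inner ℝ u (x i j ω) ∂μ =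
      inner ℝ u (mulV (Γ i) (θ i - v)) := by
  have hu : HasSubgaussianMGF (fun ω => inner ℝ u (x i j ω)) _ μ := h.inner_hasSubgaussianMGF i j
    (u := u) le_rfl (c := Real.toNNReal (‖u‖ ^ 2 * γ2)) (Real.le_coe_toNNReal _)
  have hv : HasSubgaussianMGF (fun ω => inner ℝ (θ i - v) (x i j ω)) _ μ :=
    h.inner_hasSubgaussianMGF i j (u := θ i - v) le_rfl
      (c := Real.toNNReal (‖θ i - v‖ ^ 2 * γ2)) (Real.le_coe_toNNReal _)
  have hind : IndepFun (noise (x i j) (y i j) (θ i)) (fun ω => inner ℝ u (x i j ω)) μ :=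
    (h.noise_indep i j).comp (φ := id) (ψ := fun z => inner ℝ u z) measurable_id (by fun_prop)
  have hn := h.noise_hasSubgaussianMGF i j
  have e : ∀ ω, (y i j ω - inner ℝ v (x i j ω)) * inner ℝ u (x i j ω) =
      noise (x i j) (y i j) (θ i) ω * inner ℝ u (x i j ω) +
        inner ℝ u (x i j ω) * inner ℝ (θ i - v) (x i j ω) := by
    intro ω
    simp only [noise, inner_sub_left, real_inner_comm (θ i)]
    ring
  simp_rw [e]
  have i1 : Integrable (fun ω => noise (x i j) (y i j) (θ i) ω * inner ℝ u (x i j ω)) μ :=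
    hn.memLp_two.integrable_mul hu.memLp_two
  have i2 : Integrable (fun ω => inner ℝ u (x i j ω) * inner ℝ (θ i - v) (x i j ω)) μ :=
    hu.memLp_two.integrable_mul hv.memLp_two
  rw [integral_add i1 i2, h.integral_inner_mul_inner,
    hind.integral_fun_mul_eq_mul_integral hn.aestronglyMeasurable hu.aestronglyMeasurable,
    h.noise_mean, zero_mul, zero_add]

lemma IsModel.a_nonneg (h : IsModel μ n x y Γ θ B α σ2 γ2 κ g a) (i : Fin m) : 0 ≤ a :=
  (norm_nonneg _).trans (h.alpha_bound i)

/-- Testing `Γ θ = B α` against `θ` gives `λ_d ‖θ‖ ≤ a`, while `g ≤ λ_1 ≤ κ λ_d`. A sample `j` is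
needed because only the samples tie `Γ i` to a covariance, hence make it symmetric and positive. -/
lemma IsModel.norm_theta_le (h : IsModel μ n x y Γ θ B α σ2 γ2 κ g a) (hg : 0 < g) (hd : 1 ≤ d)
    (i : Fin m) (j : Fin (n i)) : ‖θ i‖ ≤ a * κ / g := by
  have hsym : (Γ i).IsHermitian := by
    ext p q
    simp only [Matrix.conjTranspose_apply, star_trivial]
    rw [← h.x_cov i j, ← h.x_cov i j]
    simp_rw [mul_comm]
  have hpsd : ∀ w : Eucl d, 0 ≤ inner ℝ w (mulV (Γ i) w) := by
    intro w
    rw [← h.integral_inner_mul_inner i j]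
    exact integral_nonneg fun ω => mul_self_nonneg _
  have hd0 : 0 ≤ eig (Γ i) d := eig_nonneg hsym hpsd d
  have h1 := h.cov_cond i
  have h2 := h.cov_scale i
  have hκ : 0 < κ := by
    by_contra hκ
    nlinarith
  have h3 := (eig_bounds hsym hd (θ i)).1
  have h4 : inner ℝ (θ i) (mulV (Γ i) (θ i)) ≤ ‖θ i‖ * a := by
    rw [h.low_dim i]
    refine (real_inner_le_norm _ _).trans ?_
    rw [norm_mulV_of_orth h.B_orth]
    exact mul_le_mul_of_nonneg_left (h.alpha_bound i) (norm_nonneg _)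
  have ha := h.a_nonneg i
  rw [le_div_iff₀ hg]
  rcases (norm_nonneg (θ i)).eq_or_lt with h0 | h0
  · rw [← h0, zero_mul]; positivity
  · have h5 : eig (Γ i) d * ‖θ i‖ ≤ a := by
      have : ‖θ i‖ * (eig (Γ i) d * ‖θ i‖) ≤ ‖θ i‖ * a := by nlinarith
      exact le_of_mul_le_mul_left this h0
    nlinarith

end Model

/-! ### Independent blocks and sums of products. -/

section Independence

variable {Ω : Type*} {mΩ : MeasurableSpace Ω} {μ : Measure Ω} [IsProbabilityMeasure μ]

/-- Grouping independent variables into blocks yields independent blocks. -/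
lemma iIndepFun_curry {ι : Type*} {κ : ι → Type*} {β : Type*} [MeasurableSpace β]
    {X : (i : ι) → κ i → Ω → β} (mX : ∀ i j, Measurable (X i j))
    (h : iIndepFun (fun (s : (i : ι) × κ i) ω => X s.1 s.2 ω) μ) :
    iIndepFun (fun i ω j => X i j ω) μ := by
  have hp : ∀ i j, IsProbabilityMeasure (μ.map (X i j)) :=
    fun i j => Measure.isProbabilityMeasure_map (mX i j).aemeasurable
  have h2 : ∀ i, iIndepFun (X i) μ := fun i =>
    h.precomp (g := fun j : κ i => (⟨i, j⟩ : (i : ι) × κ i)) (fun a b hab => by simpa using hab)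
  have e : (MeasurableEquiv.piCurry fun (i : ι) (_ : κ i) => β) ∘ (fun ω p => X p.1 p.2 ω) =
      fun ω i j => X i j ω := by
    ext; simp [Sigma.curry]
  rw [iIndepFun_iff_map_fun_eq_infinitePi_map (by fun_prop), ← e,
    ← Measure.map_map (by fun_prop) (by fun_prop),
    (iIndepFun_iff_map_fun_eq_infinitePi_map (by fun_prop)).1 h,
    Measure.infinitePi_map_piCurry (fun i j => μ.map (X i j))]
  congrm Measure.infinitePi fun i => ?_
  rw [(iIndepFun_iff_map_fun_eq_infinitePi_map (by fun_prop)).1 (h2 i)]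

/-- Sums over disjoint sets of independent variables are independent. -/
lemma indepFun_sum_of_disjoint {ι : Type*} {X : ι → Ω → ℝ × ℝ} (mX : ∀ i, Measurable (X i))
    (h : iIndepFun X μ) {S T : Finset ι} (hST : Disjoint S T) :
    IndepFun (fun ω => ∑ j ∈ S, (X j ω).1) (fun ω => ∑ j ∈ T, (X j ω).2) μ := by
  have h1 := (h.indepFun_finset S T hST mX).comp
    (φ := fun z : S → ℝ × ℝ => ∑ j, (z j).1) (ψ := fun z : T → ℝ × ℝ => ∑ j, (z j).2)
    (by fun_prop) (by fun_prop)
  convert h1 using 1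
  · funext ω; exact (Finset.sum_coe_sort S fun j => (X j ω).1).symm
  · funext ω; exact (Finset.sum_coe_sort T fun j => (X j ω).2).symm

/-- If two variables are independent, an event which has small probability for every value of the
first one has small probability. -/
lemma measure_le_of_indepFun {β γ : Type*} [MeasurableSpace β] [MeasurableSpace γ] {X : Ω → β}
    {Y : Ω → γ} (hX : Measurable X) (hY : Measurable Y) (h : IndepFun X Y μ) {S : Set (β × γ)}
    (hS : MeasurableSet S) {δ : ℝ≥0∞} (hδ : ∀ ω', μ {ω | (X ω', Y ω) ∈ S} ≤ δ) :
    μ {ω | (X ω, Y ω) ∈ S} ≤ δ := by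
  have hmap := (indepFun_iff_map_prod_eq_prod_map_map hX.aemeasurable hY.aemeasurable).1 h
  have : IsProbabilityMeasure (μ.map X) := Measure.isProbabilityMeasure_map hX.aemeasurable
  have : IsProbabilityMeasure (μ.map Y) := Measure.isProbabilityMeasure_map hY.aemeasurable
  have e : μ {ω | (X ω, Y ω) ∈ S} = μ.map (fun ω => (X ω, Y ω)) S := by
    rw [Measure.map_apply (hX.prodMk hY) hS]; rfl
  -- Fubini for the product law. The bound is only requested at values taken by `X`, so properties
  -- of those values, such as orthonormality, may be used to prove it.
  rw [e, hmap, Measure.prod_apply hS, lintegral_map (measurable_measure_prodMk_left hS) hX]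
  calc ∫⁻ ω', μ.map Y (Prod.mk (X ω') ⁻¹' S) ∂μ ≤ ∫⁻ _, δ ∂μ := by
        refine lintegral_mono fun ω' => ?_
        rw [Measure.map_apply hY (measurable_prodMk_left hS)]
        exact hδ ω'
    _ = δ := by simp

lemma _root_.ProbabilityTheory.HasSubgaussianMGF.const_mul_of_le {X : Ω → ℝ} {c c' : ℝ≥0}
    (h : HasSubgaussianMGF X c μ) {r : ℝ} (hc : r ^ 2 * c ≤ c') :
    HasSubgaussianMGF (fun ω => r * X ω) c' μ :=
  (h.const_mul r).mono hc

/-- The factor `3` accounts for rounding: each half of `n ≥ 2` samples contains at least `n / 3` of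
them, with equality at `n = 3`. -/
lemma hasSubgaussianMGF_normalized_sum {ι : Type*} {Y : ι → Ω → ℝ} {c : ℝ≥0} (hY : iIndepFun Y μ)
    (hc : ∀ j, HasSubgaussianMGF (Y j) c μ) {S : Finset ι} {n : ℕ} (h0 : 0 < S.card)
    (hn : n ≤ 3 * S.card) :
    HasSubgaussianMGF (fun ω => √n * (S.card : ℝ)⁻¹ * ∑ j ∈ S, Y j ω) (3 * c) μ := by
  refine (HasSubgaussianMGF.sum_of_iIndepFun hY (s := S) fun j _ => hc j).const_mul_of_le ?_
  simp only [Finset.sum_const, nsmul_eq_mul, NNReal.coe_mul, NNReal.coe_natCast, NNReal.coe_ofNat]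
  have h1 : (0 : ℝ) < S.card := by exact_mod_cast h0
  have h2 : (n : ℝ) ≤ 3 * S.card := by exact_mod_cast hn
  rw [mul_pow, Real.sq_sqrt (by positivity)]
  calc (n : ℝ) * (S.card : ℝ)⁻¹ ^ 2 * (S.card * c) = n / S.card * c := by field_simp
    _ ≤ 3 * c := by
      refine mul_le_mul_of_nonneg_right ?_ c.2
      rw [div_le_iff₀ h1]; exact h2

/-- Concentration of a sum of products of independent pairs of noisy observations. -/
lemma measure_sum_mul_sub_le {M : ℕ} {E F : Fin M → Ω → ℝ} (hEm : ∀ i, Measurable (E i))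
    (hFm : ∀ i, Measurable (F i)) (hind : iIndepFun (fun i ω => (E i ω, F i ω)) μ)
    (hEF : ∀ i, IndepFun (E i) (F i) μ) {c : ℝ≥0} (hE : ∀ i, HasSubgaussianMGF (E i) c μ)
    (hF : ∀ i, HasSubgaussianMGF (F i) c μ) (p q : Fin M → ℝ) {K Q s : ℝ} (hK : 0 < K)
    (hcK : c ≤ K) (hQ : 0 < Q) (hp : ∑ i, p i ^ 2 ≤ Q) (hq : ∑ i, q i ^ 2 ≤ Q) (hs : 0 < s)
    (hM : 1 ≤ M) :
    μ {ω | 8 * √(K * Q * s) + (2 * √(K ^ 2 * M * s) + 4 * K * s) ≤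
      |∑ i, (p i + E i ω) * (q i + F i ω) - ∑ i, p i * q i|} ≤
        ENNReal.ofReal (6 * Real.exp (-s)) := by
  have hlin : ∀ (G : Fin M → Ω → ℝ) (w : Fin M → ℝ), iIndepFun G μ →
      (∀ i, HasSubgaussianMGF (G i) c μ) → ∑ i, w i ^ 2 ≤ Q →
      μ {ω | 4 * √(K * Q * s) ≤ |∑ i, w i * G i ω|} ≤ ENNReal.ofReal (2 * Real.exp (-s)) := by
    intro G w hG hGc hw
    have h1 : iIndepFun (fun i ω => w i * G i ω) μ :=
      hG.comp (fun i z => w i * z) fun i => by fun_prop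
    have h2 := HasSubgaussianMGF.sum_of_iIndepFun h1 (s := Finset.univ)
      fun i _ => (hGc i).const_mul_of_le (r := w i) (c' := Real.toNNReal (w i ^ 2) * c)
        (by rw [NNReal.coe_mul, Real.coe_toNNReal _ (sq_nonneg _)])
    refine h2.measure_abs_ge_le (by positivity) ?_ hs
    simp only [NNReal.coe_sum, NNReal.coe_mul, Real.coe_toNNReal _ (sq_nonneg _)]
    rw [← Finset.sum_mul, mul_comm]
    exact mul_le_mul hcK hw (Finset.sum_nonneg fun _ _ => sq_nonneg _) hK.le
  have hEi : iIndepFun E μ := hind.comp (fun _ z => z.1) fun _ => measurable_fst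
  have hFi : iIndepFun F μ := hind.comp (fun _ z => z.2) fun _ => measurable_snd
  have hEFi : iIndepFun (fun i ω => E i ω * F i ω) μ :=
    hind.comp (fun _ z => z.1 * z.2) fun _ => by fun_prop
  have hc0 : (0 : ℝ) ≤ c := c.2
  -- On this range of `t` one has `t² c² ≤ 1/4`, within the domain of the bound for products of
  -- independent sub-gaussian variables.
  have hquad : HasSubexpMGF (fun ω => ∑ i, E i ω * F i ω) (∑ _i : Fin M, K ^ 2) (1 / (2 * K)) μ := by
    refine HasSubexpMGF.sum hEFi (fun i => (hEm i).mul (hFm i)) _ fun i _ t ht => ?_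
    have ht2 : t ^ 2 ≤ 1 / (4 * K ^ 2) := by
      have := pow_le_pow_left₀ (abs_nonneg t) ht 2
      rw [sq_abs] at this
      refine this.trans_eq ?_
      field_simp; norm_num
    have hcc : (c : ℝ) * c ≤ K ^ 2 := by nlinarith
    have ht3 : t ^ 2 * (c * c) ≤ 1 / 4 := by
      calc t ^ 2 * (c * c) ≤ 1 / (4 * K ^ 2) * K ^ 2 := by gcongr
        _ = 1 / 4 := by field_simp
    obtain ⟨h1, h2⟩ := integral_exp_mul_mul_le (hE i) (hF i) (hEF i) (t := t) (by nlinarith)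
    refine ⟨h1, h2.trans (Real.exp_le_exp.2 ?_)⟩
    nlinarith [sq_nonneg t]
  have hMpos : (0 : ℝ) < M := by exact_mod_cast hM
  have h3 := hquad.measure_abs_ge_le (s := s) (by simp; positivity) (by positivity) hs.le
  have e : 2 * √((∑ _i : Fin M, K ^ 2) * s) + 2 * s / (1 / (2 * K)) =
      2 * √(K ^ 2 * M * s) + 4 * K * s := by
    simp only [Finset.sum_const, Finset.card_univ, Fintype.card_fin, nsmul_eq_mul]
    rw [mul_comm (M : ℝ)]
    field_simp
    ring
  rw [e] at h3
  have h1 := hlin E q hEi hE hq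
  have h2 := hlin F p hFi hF hp
  have hsub : {ω | 8 * √(K * Q * s) + (2 * √(K ^ 2 * M * s) + 4 * K * s) ≤
      |∑ i, (p i + E i ω) * (q i + F i ω) - ∑ i, p i * q i|} ⊆
      {ω | 4 * √(K * Q * s) ≤ |∑ i, q i * E i ω|} ∪ ({ω | 4 * √(K * Q * s) ≤ |∑ i, p i * F i ω|} ∪
        {ω | 2 * √(K ^ 2 * M * s) + 4 * K * s ≤ |∑ i, E i ω * F i ω|}) := by
    intro ω hω
    by_contra hcon
    simp only [Set.mem_union, Set.mem_ofPred_eq, not_or, not_le] at hcon hω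
    -- Two linear terms with weights of squared length at most `Q`, plus the purely random products.
    have e2 : ∑ i, (p i + E i ω) * (q i + F i ω) - ∑ i, p i * q i =
        ∑ i, q i * E i ω + ∑ i, p i * F i ω + ∑ i, E i ω * F i ω := by
      rw [← Finset.sum_sub_distrib, ← Finset.sum_add_distrib, ← Finset.sum_add_distrib]
      exact Finset.sum_congr rfl fun _ _ => by ring
    rw [e2] at hω
    have := abs_add_three (∑ i, q i * E i ω) (∑ i, p i * F i ω) (∑ i, E i ω * F i ω)
    linarith [hcon.1, hcon.2.1, hcon.2.2]
  refine (measure_mono hsub).trans ((measure_union_le _ _).trans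
    ((add_le_add h1 ((measure_union_le _ _).trans (add_le_add h2 h3))).trans_eq ?_))
  rw [← ENNReal.ofReal_add (by positivity) (by positivity),
    ← ENNReal.ofReal_add (by positivity) (by positivity)]
  congr 1
  ring

lemma card_filter_lt_half (n : ℕ) :
    (Finset.univ.filter fun j : Fin n => j.val < n / 2).card = n / 2 ∧
      (Finset.univ.filter fun j : Fin n => n / 2 ≤ j.val).card = n - n / 2 := by
  have h1 : (Finset.univ.filter fun j : Fin n => j.val < n / 2).card = n / 2 := by
    rw [← Finset.card_map Fin.valEmbedding]
    conv_rhs => rw [← Finset.card_range (n / 2)]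
    congr 1
    ext a
    simp only [Finset.mem_map, Finset.mem_filter, Finset.mem_univ, true_and, Fin.valEmbedding_apply,
      Finset.mem_range]
    exact ⟨by rintro ⟨j, hj, rfl⟩; exact hj, fun h => ⟨⟨a, by omega⟩, h, rfl⟩⟩
  refine ⟨h1, ?_⟩
  have h2 := Finset.card_filter_add_card_filter_not (s := (Finset.univ : Finset (Fin n))) (fun j : Fin n => j.val < n / 2)
  simp only [not_lt, Finset.card_univ, Fintype.card_fin] at h2
  omega

end Independence

/-! ### Concentration of the cross matrix in operator norm. -/

section CrossMatrix

lemma inner_smul_sum_smul {ι : Type*} {d : ℕ} (u : Eucl d) (c : ℝ) (S : Finset ι) (y : ι → ℝ)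
    (x : ι → Eucl d) :
    inner ℝ u (WithLp.toLp 2 (c • ∑ j ∈ S, y j • (x j).ofLp)) =
      c * ∑ j ∈ S, y j * inner ℝ u (x j) := by
  have e : (WithLp.toLp 2 (c • ∑ j ∈ S, y j • (x j).ofLp) : Eucl d) = c • ∑ j ∈ S, y j • x j := by
    ext p
    simp
  rw [e, real_inner_smul_right, inner_sum]
  simp_rw [real_inner_smul_right]

lemma abs_average_sub_le {ι : Type*} {S : Finset ι} (hS : 0 < S.card) {f : ι → ℝ} {b β : ℝ}
    (h : ∀ j, |f j - b| ≤ β) : |(S.card : ℝ)⁻¹ * ∑ j ∈ S, f j - b| ≤ β := by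
  have h0 : (0 : ℝ) < S.card := by exact_mod_cast hS
  have e : (S.card : ℝ)⁻¹ * ∑ j ∈ S, f j - b = (S.card : ℝ)⁻¹ * ∑ j ∈ S, (f j - b) := by
    rw [Finset.sum_sub_distrib, mul_sub]
    simp [h0.ne']
  rw [e, abs_mul, abs_of_pos (inv_pos.2 h0), inv_mul_le_iff₀ h0]
  refine (Finset.abs_sum_le_sum_abs _ _).trans ((Finset.sum_le_card_nsmul _ _ β fun j _ => h j).trans_eq ?_)
  rw [nsmul_eq_mul]

variable {Ω : Type*} [MeasurableSpace Ω] {μ : Measure Ω} [IsProbabilityMeasure μ] {m d k : ℕ}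
  {n : Fin m → ℕ} {x : (i : Fin m) → Fin (n i) → Ω → Eucl d} {y : (i : Fin m) → Fin (n i) → Ω → ℝ}
  {Γ : Fin m → Matrix (Fin d) (Fin d) ℝ} {θ : Fin m → Eucl d}
  {B : Matrix (Fin d) (Fin k) ℝ} {α : Fin m → Eucl k} {σ2 γ2 : ℝ≥0} {κ g a : ℝ}

/-- The first clients of a model form a model. -/
lemma IsModel.castSucc {n : Fin (m + 1) → ℕ} {x : (i : Fin (m + 1)) → Fin (n i) → Ω → Eucl d}
    {y : (i : Fin (m + 1)) → Fin (n i) → Ω → ℝ} {Γ : Fin (m + 1) → Matrix (Fin d) (Fin d) ℝ}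
    {θ : Fin (m + 1) → Eucl d} {α : Fin (m + 1) → Eucl k}
    (h : IsModel μ n x y Γ θ B α σ2 γ2 κ g a) :
    IsModel μ (fun i : Fin m => n i.castSucc) (fun i => x i.castSucc) (fun i => y i.castSucc)
      (fun i => Γ i.castSucc) (fun i => θ i.castSucc) B (fun i => α i.castSucc) σ2 γ2 κ g a where
  measurable_x _ := h.measurable_x _
  measurable_y _ := h.measurable_y _
  samples_indep := h.samples_indep.precomp
    (g := fun s : (i : Fin m) × Fin (n i.castSucc) =>
      (⟨s.1.castSucc, s.2⟩ : (i : Fin (m + 1)) × Fin (n i))) (by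
        rintro ⟨i, j⟩ ⟨i', j'⟩ hij
        simp only [Sigma.mk.injEq] at hij
        obtain ⟨h1, h2⟩ := hij
        obtain rfl := Fin.castSucc_injective _ h1
        simpa using h2)
  noise_indep _ := h.noise_indep _
  noise_mean _ := h.noise_mean _
  noise_subG _ := h.noise_subG _
  x_mean _ := h.x_mean _
  x_subG _ := h.x_subG _
  x_cov _ := h.x_cov _
  cov_cond _ := h.cov_cond _
  cov_scale _ := h.cov_scale _
  B_orth := h.B_orth
  low_dim _ := h.low_dim _
  alpha_bound _ := h.alpha_bound _

lemma IsModel.y_hasSubgaussianMGF (h : IsModel μ n x y Γ θ B α σ2 γ2 κ g a) (hg : 0 < g)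
    (hd : 1 ≤ d) {τ : ℝ≥0} (hτ : (a * κ / g) ^ 2 * γ2 + σ2 ≤ τ) (i : Fin m) (j : Fin (n i)) :
    HasSubgaussianMGF (y i j) τ μ := by
  simpa using h.residual_hasSubgaussianMGF i j 0 (by simpa using h.norm_theta_le hg hd i j) hτ

lemma IsModel.integral_y_mul_inner (h : IsModel μ n x y Γ θ B α σ2 γ2 κ g a) (i : Fin m)
    (j : Fin (n i)) (u : Eucl d) :
    ∫ ω, y i j ω * inner ℝ u (x i j ω) ∂μ = inner ℝ u (mulV B (α i)) := by
  rw [← h.low_dim i]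
  simpa using h.integral_residual_mul_inner i j 0 u

lemma IsModel.abs_inner_le (h : IsModel μ n x y Γ θ B α σ2 γ2 κ g a) (i : Fin m) {u : Eucl d}
    (hu : ‖u‖ ≤ 1) : |inner ℝ u (mulV B (α i))| ≤ a := by
  refine (abs_real_inner_le_norm _ _).trans ?_
  rw [norm_mulV_of_orth h.B_orth]
  exact (mul_le_of_le_one_left (norm_nonneg _) hu).trans (h.alpha_bound i)

/-- Concentration of the bilinear form of the truncated cross matrix at two fixed vectors. -/
lemma IsModel.measure_trunc_le (h : IsModel μ n x y Γ θ B α σ2 γ2 κ g a) (hg : 0 < g)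
    (hd : 1 ≤ d) (hn : ∀ i, 2 ≤ n i) (hm : 1 ≤ m) {τ : ℝ≥0}
    (hτ : (a * κ / g) ^ 2 * γ2 + σ2 ≤ τ) {r s R L K Q β N : ℝ} (hr : 0 < r) (hs : 0 < s)
    (hR : ∀ v : Eucl d, ‖v‖ ≤ 1 → ∑ i, (n i : ℝ) * inner ℝ v (mulV B (α i)) ^ 2 ≤ R)
    (hN : N = ∑ i, (n i : ℝ)) (hL : L = 4 * √((τ + 1) * (12 * r))) (hK : K = 42 * L ^ 2 * (γ2 + 1))
    (hβ : β = (12 * (Real.exp (τ / 2) + Real.exp (γ2 / 2)) + 1) * Real.exp (-r))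
    (hQ : Q = 2 * (R + N * β ^ 2)) {u v : Eucl d} (hu : ‖u‖ ≤ 1) (hv : ‖v‖ ≤ 1) :
    μ {ω | 8 * √(K * Q * s) + (2 * √(K ^ 2 * m * s) + 4 * K * s) + N * (β * (2 * a + β)) ≤
      |∑ i, (n i : ℝ) * (((n i / 2 : ℕ) : ℝ)⁻¹ *
          ∑ j : Fin (n i) with j.val < n i / 2, trunc L (y i j ω) * inner ℝ u (x i j ω)) *
        (((n i - n i / 2 : ℕ) : ℝ)⁻¹ *
          ∑ j : Fin (n i) with n i / 2 ≤ j.val, trunc L (y i j ω) * inner ℝ v (x i j ω)) -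
        ∑ i, (n i : ℝ) * (inner ℝ u (mulV B (α i)) * inner ℝ v (mulV B (α i)))|} ≤
      ENNReal.ofReal (6 * Real.exp (-s)) := by
  have hτ0 : (0 : ℝ) ≤ τ := τ.2
  have hγ0 : (0 : ℝ) ≤ γ2 := γ2.2
  have hLpos : 0 < L := by rw [hL]; positivity
  have hKpos : 0 < K := by rw [hK]; positivity
  have hβpos : 0 < β := by rw [hβ]; positivity
  have ha : 0 ≤ a := h.a_nonneg ⟨0, hm⟩
  have hn0 : ∀ i, (0 : ℝ) ≤ n i := fun i => Nat.cast_nonneg _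
  have hNpos : 0 < N := by
    rw [hN]
    exact Finset.sum_pos (fun i _ => by have := hn i; exact_mod_cast (by omega : 0 < n i)) ⟨⟨0, hm⟩, Finset.mem_univ _⟩
  have hR0 : 0 ≤ R := by simpa using hR 0 (by simp)
  have hQpos : 0 < Q := by rw [hQ]; positivity
  -- truncated projections
  set X : (i : Fin m) → Fin (n i) → Eucl d → Ω → ℝ :=
    fun i j w ω => trunc L (y i j ω) * inner ℝ w (x i j ω) with hX
  set S₁ : (i : Fin m) → Finset (Fin (n i)) := fun i => Finset.univ.filter fun j => j.val < n i / 2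
  set S₂ : (i : Fin m) → Finset (Fin (n i)) := fun i => Finset.univ.filter fun j => n i / 2 ≤ j.val
  have hc₁ : ∀ i, (S₁ i).card = n i / 2 := fun i => (card_filter_lt_half (n i)).1
  have hc₂ : ∀ i, (S₂ i).card = n i - n i / 2 := fun i => (card_filter_lt_half (n i)).2
  have hc₁' : ∀ i, 0 < (S₁ i).card ∧ n i ≤ 3 * (S₁ i).card := fun i => by
    have := hn i; rw [hc₁]; omega
  have hc₂' : ∀ i, 0 < (S₂ i).card ∧ n i ≤ 3 * (S₂ i).card := fun i => by
    have := hn i; rw [hc₂]; omega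
  have hφ : ∀ (w : Eucl d) (c : ℝ),
      Measurable fun z : Eucl d × ℝ => trunc L z.2 * inner ℝ w z.1 - c := by
    intro w c
    have : Measurable fun z : Eucl d × ℝ => trunc L z.2 := (measurable_trunc L).comp measurable_snd
    exact (this.mul (by fun_prop)).sub_const _
  have hdm : ∀ i j, Measurable fun ω => (x i j ω, y i j ω) := fun i j =>
    (h.measurable_x i j).prodMk (h.measurable_y i j)
  set Y : (i : Fin m) → Fin (n i) → Eucl d → Ω → ℝ :=
    fun i j w ω => X i j w ω - ∫ ω', X i j w ω' ∂μ with hY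
  have hYm : ∀ i j w, Measurable (Y i j w) := fun i j w => (hφ w _).comp (hdm i j)
  set c : ℝ≥0 := Real.toNNReal (14 * L ^ 2 * γ2) with hc
  have hc' : (c : ℝ) = 14 * L ^ 2 * γ2 := Real.coe_toNNReal _ (by positivity)
  have hYsub : ∀ i j (w : Eucl d), ‖w‖ ≤ 1 → HasSubgaussianMGF (Y i j w) c μ := fun i j w hw =>
    hasSubgaussianMGF_trunc_mul (h.measurable_y i j).aestronglyMeasurable
      (h.inner_hasSubgaussianMGF i j hw (by simp)) hLpos.le hc'.ge
  have hblock : ∀ i, iIndepFun (fun j ω => (x i j ω, y i j ω)) μ := fun i =>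
    h.samples_indep.precomp (g := fun j : Fin (n i) => (⟨i, j⟩ : (i : Fin m) × Fin (n i)))
      (fun a b hab => by simpa using hab)
  have hYind : ∀ i w, iIndepFun (fun j => Y i j w) μ := fun i w =>
    (hblock i).comp (fun j z => trunc L z.2 * inner ℝ w z.1 - ∫ ω', X i j w ω' ∂μ) fun j => hφ w _
  set E : Fin m → Ω → ℝ := fun i ω => √(n i) * ((S₁ i).card : ℝ)⁻¹ * ∑ j ∈ S₁ i, Y i j u ω
  set F : Fin m → Ω → ℝ := fun i ω => √(n i) * ((S₂ i).card : ℝ)⁻¹ * ∑ j ∈ S₂ i, Y i j v ω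
  -- Samples of one client share a covariance but need not be identically distributed, and
  -- truncation may shift their means differently; so the means are averaged. The weight `n i` is
  -- split as `√(n i)` on each factor.
  set p : Fin m → ℝ := fun i => √(n i) * (((S₁ i).card : ℝ)⁻¹ * ∑ j ∈ S₁ i, ∫ ω, X i j u ω ∂μ)
  set q : Fin m → ℝ := fun i => √(n i) * (((S₂ i).card : ℝ)⁻¹ * ∑ j ∈ S₂ i, ∫ ω, X i j v ω ∂μ)
  have hE : ∀ i, HasSubgaussianMGF (E i) (3 * c) μ := fun i =>
    hasSubgaussianMGF_normalized_sum (hYind i u) (fun j => hYsub i j u hu) (hc₁' i).1 (hc₁' i).2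
  have hF : ∀ i, HasSubgaussianMGF (F i) (3 * c) μ := fun i =>
    hasSubgaussianMGF_normalized_sum (hYind i v) (fun j => hYsub i j v hv) (hc₂' i).1 (hc₂' i).2
  have hEm : ∀ i, Measurable (E i) := fun i =>
    (Finset.measurable_sum _ fun j _ => hYm i j u).const_mul _
  have hFm : ∀ i, Measurable (F i) := fun i =>
    (Finset.measurable_sum _ fun j _ => hYm i j v).const_mul _
  have hEF : ∀ i, IndepFun (E i) (F i) μ := by
    intro i
    have h1 : iIndepFun (fun j ω => (Y i j u ω, Y i j v ω)) μ :=
      (hblock i).comp (fun j z => (trunc L z.2 * inner ℝ u z.1 - ∫ ω', X i j u ω' ∂μ,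
        trunc L z.2 * inner ℝ v z.1 - ∫ ω', X i j v ω' ∂μ)) fun j => (hφ u _).prodMk (hφ v _)
    have hdis : Disjoint (S₁ i) (S₂ i) := by
      rw [Finset.disjoint_filter]
      intro j _ h1; omega
    exact (indepFun_sum_of_disjoint (fun j => (hYm i j u).prodMk (hYm i j v)) h1 hdis).comp
      (φ := fun z => √(n i) * ((S₁ i).card : ℝ)⁻¹ * z)
      (ψ := fun z => √(n i) * ((S₂ i).card : ℝ)⁻¹ * z) (by fun_prop) (by fun_prop)
  have hEFind : iIndepFun (fun i ω => (E i ω, F i ω)) μ := by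
    have h1 := iIndepFun_curry (X := fun i j ω => (x i j ω, y i j ω)) hdm h.samples_indep
    refine h1.comp (fun i z =>
      (√(n i) * ((S₁ i).card : ℝ)⁻¹ * ∑ j ∈ S₁ i,
          (trunc L (z j).2 * inner ℝ u (z j).1 - ∫ ω', X i j u ω' ∂μ),
        √(n i) * ((S₂ i).card : ℝ)⁻¹ * ∑ j ∈ S₂ i,
          (trunc L (z j).2 * inner ℝ v (z j).1 - ∫ ω', X i j v ω' ∂μ))) fun i => ?_
    exact ((Finset.measurable_sum _ fun j _ => (hφ u _).comp (measurable_pi_apply j)).const_mul _).prodMk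
      ((Finset.measurable_sum _ fun j _ => (hφ v _).comp (measurable_pi_apply j)).const_mul _)
  -- bias
  have hbias : ∀ i j (w : Eucl d), ‖w‖ ≤ 1 →
      |∫ ω, X i j w ω ∂μ - inner ℝ w (mulV B (α i))| ≤ β := by
    intro i j w hw
    rw [abs_sub_comm, ← h.integral_y_mul_inner i j w, hβ, hX, hL]
    exact abs_integral_sub_trunc_le (h.y_hasSubgaussianMGF hg hd hτ i j)
      (h.inner_hasSubgaussianMGF i j hw (c := γ2) (by simp)) (by positivity) (by linarith) hr
  have hsq : ∀ (w : Eucl d) (f : Fin m → ℝ), ‖w‖ ≤ 1 →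
      (∀ i, |f i - inner ℝ w (mulV B (α i))| ≤ β) → ∑ i, (√(n i) * f i) ^ 2 ≤ Q := by
    intro w f hw hf
    calc ∑ i, (√(n i) * f i) ^ 2
        ≤ ∑ i, (2 * ((n i : ℝ) * inner ℝ w (mulV B (α i)) ^ 2) + 2 * (n i * β ^ 2)) := by
          refine Finset.sum_le_sum fun i _ => ?_
          rw [mul_pow, Real.sq_sqrt (hn0 i)]
          have h1 := sq_le_sq' (abs_le.1 (hf i)).1 (abs_le.1 (hf i)).2
          have h2 : f i ^ 2 ≤ 2 * inner ℝ w (mulV B (α i)) ^ 2 + 2 * β ^ 2 := by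
            nlinarith [sq_nonneg (f i - 2 * inner ℝ w (mulV B (α i)))]
          nlinarith [mul_le_mul_of_nonneg_left h2 (hn0 i)]
      _ ≤ Q := by
          rw [Finset.sum_add_distrib, ← Finset.mul_sum, ← Finset.mul_sum, ← Finset.sum_mul, ← hN, hQ]
          linarith [hR w hw]
  have hpb : ∀ i, |((S₁ i).card : ℝ)⁻¹ * ∑ j ∈ S₁ i, ∫ ω, X i j u ω ∂μ -
      inner ℝ u (mulV B (α i))| ≤ β := fun i =>
    abs_average_sub_le (hc₁' i).1 fun j => hbias i j u hu
  have hqb : ∀ i, |((S₂ i).card : ℝ)⁻¹ * ∑ j ∈ S₂ i, ∫ ω, X i j v ω ∂μ -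
      inner ℝ v (mulV B (α i))| ≤ β := fun i =>
    abs_average_sub_le (hc₂' i).1 fun j => hbias i j v hv
  -- The constant `42` is `14`, from centring after truncation, times `3`, from the half-sample
  -- averages; `γ2 + 1` keeps `K` positive.
  have hcK : ((3 * c : ℝ≥0) : ℝ) ≤ K := by
    push_cast
    rw [hc', hK]
    nlinarith [sq_nonneg L]
  refine (measure_mono fun ω hω => ?_).trans (measure_sum_mul_sub_le hEm hFm hEFind hEF hE hF p q
    hKpos hcK hQpos (hsq u _ hu hpb) (hsq v _ hv hqb) hs hm)
  rw [Set.mem_ofPred_eq] at hω ⊢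
  have e1 : ∀ i, (p i + E i ω) * (q i + F i ω) = (n i : ℝ) * (((n i / 2 : ℕ) : ℝ)⁻¹ *
      ∑ j ∈ S₁ i, X i j u ω) * (((n i - n i / 2 : ℕ) : ℝ)⁻¹ * ∑ j ∈ S₂ i, X i j v ω) := by
    intro i
    have e2 : p i + E i ω = √(n i) * (((S₁ i).card : ℝ)⁻¹ * ∑ j ∈ S₁ i, X i j u ω) := by
      simp only [p, E, hY, Finset.sum_sub_distrib]; ring
    have e3 : q i + F i ω = √(n i) * (((S₂ i).card : ℝ)⁻¹ * ∑ j ∈ S₂ i, X i j v ω) := by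
      simp only [q, F, hY, Finset.sum_sub_distrib]; ring
    rw [e2, e3, hc₁, hc₂]
    have := Real.mul_self_sqrt (hn0 i)
    linear_combination (((n i / 2 : ℕ) : ℝ)⁻¹ * ∑ j ∈ S₁ i, X i j u ω) *
      (((n i - n i / 2 : ℕ) : ℝ)⁻¹ * ∑ j ∈ S₂ i, X i j v ω) * this
  have e4 : |∑ i, p i * q i -
      ∑ i, (n i : ℝ) * (inner ℝ u (mulV B (α i)) * inner ℝ v (mulV B (α i)))| ≤
        N * (β * (2 * a + β)) := by
    rw [← Finset.sum_sub_distrib, hN, Finset.sum_mul]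
    refine (Finset.abs_sum_le_sum_abs _ _).trans (Finset.sum_le_sum fun i _ => ?_)
    set b := inner ℝ u (mulV B (α i))
    set b' := inner ℝ v (mulV B (α i))
    have hb : |b| ≤ a := h.abs_inner_le i hu
    have hb' : |b'| ≤ a := h.abs_inner_le i hv
    have h1 := hpb i
    have h2 := hqb i
    set f := ((S₁ i).card : ℝ)⁻¹ * ∑ j ∈ S₁ i, ∫ ω, X i j u ω ∂μ
    set f' := ((S₂ i).card : ℝ)⁻¹ * ∑ j ∈ S₂ i, ∫ ω, X i j v ω ∂μ
    have e5 : p i * q i - (n i : ℝ) * (b * b') = n i * ((f - b) * b' + b * (f' - b') +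
        (f - b) * (f' - b')) := by
      have := Real.mul_self_sqrt (hn0 i)
      simp only [p, q]
      linear_combination f * f' * this
    rw [e5, abs_mul, abs_of_nonneg (hn0 i)]
    refine mul_le_mul_of_nonneg_left ((abs_add_three _ _ _).trans ?_) (hn0 i)
    rw [abs_mul, abs_mul, abs_mul]
    have g1 : |f - b| * |b'| ≤ β * a := mul_le_mul h1 hb' (abs_nonneg _) hβpos.le
    have g2 : |b| * |f' - b'| ≤ a * β := mul_le_mul hb h2 (abs_nonneg _) ha
    have g3 : |f - b| * |f' - b'| ≤ β * β := mul_le_mul h1 h2 (abs_nonneg _) hβpos.le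
    linarith
  simp_rw [e1]
  set P := ∑ i, (n i : ℝ) * (((n i / 2 : ℕ) : ℝ)⁻¹ *
      ∑ j ∈ S₁ i, X i j u ω) * (((n i - n i / 2 : ℕ) : ℝ)⁻¹ * ∑ j ∈ S₂ i, X i j v ω)
  have e6 := abs_sub_abs_le_abs_sub (P - ∑ i, p i * q i)
    (P - ∑ i, (n i : ℝ) * (inner ℝ u (mulV B (α i)) * inner ℝ v (mulV B (α i))))
  have e7 := abs_sub_le (P) (∑ i, p i * q i)
    (∑ i, (n i : ℝ) * (inner ℝ u (mulV B (α i)) * inner ℝ v (mulV B (α i))))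
  linarith

/-- Concentration of the cross matrix in operator norm. -/
lemma IsModel.exists_crossMat_sub_le (h : IsModel μ n x y Γ θ B α σ2 γ2 κ g a) (hg : 0 < g)
    (hd : 1 ≤ d) (hn : ∀ i, 2 ≤ n i) (hm : 1 ≤ m) {τ : ℝ≥0}
    (hτ : (a * κ / g) ^ 2 * γ2 + σ2 ≤ τ) {r s R L K Q β N : ℝ} (hr : 0 < r) (hs : 0 < s)
    (hR : ∀ v : Eucl d, ‖v‖ ≤ 1 → ∑ i, (n i : ℝ) * inner ℝ v (mulV B (α i)) ^ 2 ≤ R)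
    (hN : N = ∑ i, (n i : ℝ)) (hL : L = 4 * √((τ + 1) * (12 * r))) (hK : K = 42 * L ^ 2 * (γ2 + 1))
    (hβ : β = (12 * (Real.exp (τ / 2) + Real.exp (γ2 / 2)) + 1) * Real.exp (-r))
    (hQ : Q = 2 * (R + N * β ^ 2)) :
    ∃ A : Set Ω, μ A ≤ ENNReal.ofReal (N * (2 * Real.exp (-(12 * r))) +
        5 ^ d * 5 ^ d * (6 * Real.exp (-s))) ∧
      ∀ ω ∉ A, ∀ u v : Eucl d,
        |inner ℝ u (mulV (crossMat (fun i j => (x i j ω, y i j ω)) -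
          ∑ i, (n i : ℝ) • Matrix.vecMulVec (mulV B (α i)).ofLp (mulV B (α i)).ofLp) v)| ≤
        4 * (8 * √(K * Q * s) + (2 * √(K ^ 2 * m * s) + 4 * K * s) + N * (β * (2 * a + β))) *
          ‖u‖ * ‖v‖ := by
  obtain ⟨T, hTc, hT1, hT⟩ := exists_net d
  set t := 8 * √(K * Q * s) + (2 * √(K ^ 2 * m * s) + 4 * K * s) + N * (β * (2 * a + β)) with ht
  have hτ0 : (0 : ℝ) ≤ τ := τ.2
  -- The exceptional set consists of the outcomes where some truncation is active or the deviation
  -- is large at some pair of net points.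
  let A₁ : Set Ω := ⋃ s : (i : Fin m) × Fin (n i), {ω | L ≤ |y s.1 s.2 ω|}
  let bad : Eucl d × Eucl d → Set Ω := fun w => {ω | t ≤
      |∑ i, (n i : ℝ) * (((n i / 2 : ℕ) : ℝ)⁻¹ *
          ∑ j : Fin (n i) with j.val < n i / 2, trunc L (y i j ω) * inner ℝ w.1 (x i j ω)) *
        (((n i - n i / 2 : ℕ) : ℝ)⁻¹ *
          ∑ j : Fin (n i) with n i / 2 ≤ j.val, trunc L (y i j ω) * inner ℝ w.2 (x i j ω)) -
        ∑ i, (n i : ℝ) * (inner ℝ w.1 (mulV B (α i)) * inner ℝ w.2 (mulV B (α i)))|}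
  refine ⟨A₁ ∪ ⋃ w ∈ T ×ˢ T, bad w, ?_, ?_⟩
  · have h1 : μ A₁ ≤ ENNReal.ofReal (N * (2 * Real.exp (-(12 * r)))) := by
      refine (measure_iUnion_fintype_le _ _).trans ((Finset.sum_le_sum fun s _ =>
        (?_ : _ ≤ ENNReal.ofReal (2 * Real.exp (-(12 * r))))).trans_eq ?_)
      · rw [hL]
        exact (h.y_hasSubgaussianMGF hg hd hτ s.1 s.2).measure_abs_ge_le (by positivity)
          (by linarith) (by positivity)
      · rw [Finset.sum_const, nsmul_eq_mul, ← ENNReal.ofReal_natCast,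
          ← ENNReal.ofReal_mul (Nat.cast_nonneg _), hN]
        simp
    have h2 : μ (⋃ w ∈ T ×ˢ T, bad w) ≤ ENNReal.ofReal (5 ^ d * 5 ^ d * (6 * Real.exp (-s))) := by
      refine (measure_biUnion_finset_le _ _).trans ((Finset.sum_le_sum fun w hw =>
        (?_ : _ ≤ ENNReal.ofReal (6 * Real.exp (-s)))).trans ?_)
      · obtain ⟨hw1, hw2⟩ := Finset.mem_product.1 hw
        exact h.measure_trunc_le hg hd hn hm hτ hr hs hR hN hL hK hβ hQ (hT1 _ hw1) (hT1 _ hw2)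
      · rw [Finset.sum_const, nsmul_eq_mul, ← ENNReal.ofReal_natCast,
          ← ENNReal.ofReal_mul (Nat.cast_nonneg _)]
        refine ENNReal.ofReal_le_ofReal ?_
        rw [Finset.card_product]
        have : (T.card : ℝ) ≤ 5 ^ d := by exact_mod_cast hTc
        push_cast
        gcongr
    have hN0 : 0 ≤ N := by rw [hN]; positivity
    rw [ENNReal.ofReal_add (by positivity) (by positivity)]
    exact (measure_union_le _ _).trans (add_le_add h1 h2)
  · intro ω hω u v
    simp only [Set.mem_union, not_or, A₁, Set.mem_iUnion, not_exists, Set.mem_ofPred_eq, not_le,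
      Finset.mem_product, bad] at hω
    obtain ⟨hω1, hω2⟩ := hω
    set Z := crossMat (fun i j => (x i j ω, y i j ω)) -
      ∑ i, (n i : ℝ) • Matrix.vecMulVec (mulV B (α i)).ofLp (mulV B (α i)).ofLp with hZ
    let f : Eucl d →ₗ[ℝ] Eucl d →ₗ[ℝ] ℝ := LinearMap.mk₂ ℝ (fun u v => inner ℝ u (mulV Z v))
      (fun _ _ _ => inner_add_left _ _ _) (fun _ _ _ => real_inner_smul_left _ _ _)
      (fun _ _ _ => by rw [mulV_add, inner_add_right])
      (fun _ _ _ => by rw [mulV_smul, real_inner_smul_right, smul_eq_mul])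
    refine bilinear_le_of_net hT hT f (fun u hu v hv => ?_) u v
    have h3 := (hω2 (u, v) ⟨hu, hv⟩).le
    refine le_trans (le_of_eq ?_) h3
    simp only [f, LinearMap.mk₂_apply, hZ, crossMat]
    rw [sub_mulV, inner_sub_right, inner_sum_vecMulVec, inner_sum_vecMulVec]
    congr 2
    refine Finset.sum_congr rfl fun i _ => ?_
    simp only [avgFst, avgSnd]
    rw [inner_smul_sum_smul, inner_smul_sum_smul, ← mul_assoc]
    have htr : ∀ j, trunc L (y i j ω) = y i j ω := fun j => trunc_of_le (hω1 ⟨i, j⟩).le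
    simp_rw [htr]

end CrossMatrix

/-! ### Least squares of the new client in a fixed subspace. -/

section LeastSquares

variable {d k l : ℕ}

/-- On the net `T`, the projected empirical covariance is close to the identity and the projected
noise is at most `t`. -/
def IsGoodSample (T : Finset (Eucl k)) (ρ : Eucl d) (t : ℝ) (V : Matrix (Fin d) (Fin k) ℝ)
    (z : Fin l → Eucl d × ℝ) : Prop :=
  (∀ q ∈ T, ∀ q' ∈ T, |∑ j, inner ℝ (mulV V q) (z j).1 * inner ℝ (mulV V q') (z j).1 -
      l * inner ℝ q q'| ≤ l / 8) ∧
    ∀ q ∈ T, |∑ j, ((z j).2 - inner ℝ (mulV V (mulV Vᵀ ρ)) (z j).1) *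
      inner ℝ (mulV V q) (z j).1| ≤ t

lemma measurableSet_forall_mem {β ι : Type*} [MeasurableSpace β] (T : Finset ι) {P : ι → β → Prop}
    (h : ∀ q, MeasurableSet {w | P q w}) : MeasurableSet {w | ∀ q ∈ T, P q w} := by
  have e : {w | ∀ q ∈ T, P q w} = ⋂ q ∈ T, {w | P q w} := by ext; simp
  rw [e]
  exact T.measurableSet_biInter fun q _ => h q

/-- Joint measurability in the matrix and the sample is what freezing an independent random matrix
requires. -/
lemma measurableSet_isGoodSample (T : Finset (Eucl k)) (ρ : Eucl d) (t : ℝ) :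
    MeasurableSet {w : (Fin d → Fin k → ℝ) × (Fin l → Eucl d × ℝ) |
      ¬ IsGoodSample T ρ t (Matrix.of w.1) w.2} := by
  have hV : ∀ q : Eucl k, Measurable fun w : (Fin d → Fin k → ℝ) × (Fin l → Eucl d × ℝ) =>
      mulV (Matrix.of w.1) q := by
    intro q
    unfold mulV
    refine (WithLp.measurable_toLp 2 _).comp (measurable_pi_lambda _ fun p => ?_)
    simp only [Matrix.mulVec, dotProduct, Matrix.of_apply]
    fun_prop
  have hV' : Measurable fun w : (Fin d → Fin k → ℝ) × (Fin l → Eucl d × ℝ) =>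
      mulV (Matrix.of w.1) (mulV (Matrix.of w.1)ᵀ ρ) := by
    unfold mulV
    refine (WithLp.measurable_toLp 2 _).comp (measurable_pi_lambda _ fun p => ?_)
    simp only [Matrix.mulVec, dotProduct, Matrix.of_apply, Matrix.transpose_apply]
    fun_prop
  have hx : ∀ j, Measurable fun w : (Fin d → Fin k → ℝ) × (Fin l → Eucl d × ℝ) => (w.2 j).1 :=
    fun j => by fun_prop
  have hy : ∀ j, Measurable fun w : (Fin d → Fin k → ℝ) × (Fin l → Eucl d × ℝ) => (w.2 j).2 :=
    fun j => by fun_prop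
  have h1 : MeasurableSet {w : (Fin d → Fin k → ℝ) × (Fin l → Eucl d × ℝ) | ∀ q ∈ T, ∀ q' ∈ T,
      |∑ j, inner ℝ (mulV (Matrix.of w.1) q) (w.2 j).1 * inner ℝ (mulV (Matrix.of w.1) q') (w.2 j).1 -
        l * inner ℝ q q'| ≤ l / 8} :=
    measurableSet_forall_mem T fun q => measurableSet_forall_mem T fun q' =>
      measurableSet_le (Measurable.abs ((Finset.measurable_sum _ fun j _ =>
        ((hV q).inner (hx j)).mul ((hV q').inner (hx j))).sub_const _)) measurable_const
  have h2 : MeasurableSet {w : (Fin d → Fin k → ℝ) × (Fin l → Eucl d × ℝ) | ∀ q ∈ T,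
      |∑ j, ((w.2 j).2 - inner ℝ (mulV (Matrix.of w.1) (mulV (Matrix.of w.1)ᵀ ρ)) (w.2 j).1) *
        inner ℝ (mulV (Matrix.of w.1) q) (w.2 j).1| ≤ t} :=
    measurableSet_forall_mem T fun q => measurableSet_le (Measurable.abs (Finset.measurable_sum _
      fun j _ => ((hy j).sub (hV'.inner (hx j))).mul ((hV q).inner (hx j)))) measurable_const
  have e : {w : (Fin d → Fin k → ℝ) × (Fin l → Eucl d × ℝ) |
      ¬ IsGoodSample T ρ t (Matrix.of w.1) w.2} = ({w | _} ∩ {w | _})ᶜ := rfl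
  rw [e]
  exact (h1.inter h2).compl

/-- Comparing the minimiser with `Vᵀ ρ` bounds the empirical quadratic form at their difference `e`
by twice the noise form. The nets make the former at least `(l / 2) ‖e‖²` and the latter at most `2
t ‖e‖`. Invertibility of the design is not assumed, so any minimiser is covered. -/
lemma IsGoodSample.norm_le {T : Finset (Eucl k)}
    (hT : ∀ v : Eucl k, ‖v‖ ≤ 1 → ∃ u ∈ T, ‖v - u‖ ≤ 1 / 2) {ρ : Eucl d} {t : ℝ}
    {V : Matrix (Fin d) (Fin k) ℝ} {z : Fin l → Eucl d × ℝ} (h : IsGoodSample T ρ t V z)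
    (hl : 1 ≤ l) (hV : Vᵀ * V = 1) {b : Eucl k}
    (hb : IsLeastSquares V (fun j => (z j).1) (fun j => (z j).2) b) :
    ‖mulV V b - ρ‖ ≤ 8 * t / l + ‖ρ - mulV V (mulV Vᵀ ρ)‖ := by
  obtain ⟨h1, h2⟩ := h
  set b₀ := mulV Vᵀ ρ with hb₀
  set e := b - b₀ with he
  set r : Fin l → ℝ := fun j => (z j).2 - inner ℝ (mulV V b₀) (z j).1 with hr
  let f : Eucl k →ₗ[ℝ] Eucl k →ₗ[ℝ] ℝ := LinearMap.mk₂ ℝ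
    (fun q q' => ∑ j, inner ℝ (mulV V q) (z j).1 * inner ℝ (mulV V q') (z j).1 - l * inner ℝ q q')
    (fun q₁ q₂ q' => by
      simp only [mulV_add, inner_add_left, add_mul, mul_add, Finset.sum_add_distrib]; ring)
    (fun c q q' => by
      simp only [mulV_smul, real_inner_smul_left, smul_eq_mul, mul_sub, Finset.mul_sum]
      congr 1
      · exact Finset.sum_congr rfl fun _ _ => by ring
      · ring)
    (fun q q₁ q₂ => by
      simp only [mulV_add, inner_add_left, inner_add_right, mul_add, Finset.sum_add_distrib]; ring)
    (fun c q q' => by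
      simp only [mulV_smul, real_inner_smul_left, real_inner_smul_right, smul_eq_mul, mul_sub,
        Finset.mul_sum]
      congr 1
      · exact Finset.sum_congr rfl fun _ _ => by ring
      · ring)
  let φ : Eucl k →ₗ[ℝ] ℝ :=
    { toFun := fun q => ∑ j, r j * inner ℝ (mulV V q) (z j).1
      map_add' := fun q q' => by
        simp only [mulV_add, inner_add_left, mul_add, Finset.sum_add_distrib]
      map_smul' := fun c q => by
        simp only [mulV_smul, real_inner_smul_left, smul_eq_mul, Finset.mul_sum, RingHom.id_apply]
        exact Finset.sum_congr rfl fun _ _ => by ring }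
  have hf : |f e e| ≤ 4 * (l / 8) * ‖e‖ * ‖e‖ := bilinear_le_of_net hT hT f h1 e e
  have hφ : |φ e| ≤ 2 * t * ‖e‖ := linear_le_of_net hT φ h2 e
  have hfe : f e e = ∑ j, inner ℝ (mulV V e) (z j).1 ^ 2 - l * ‖e‖ ^ 2 := by
    simp only [f, LinearMap.mk₂_apply, real_inner_self_eq_norm_sq]
    congr 1
    exact Finset.sum_congr rfl fun _ _ => by ring
  have hmin : ∑ j, inner ℝ (mulV V e) (z j).1 ^ 2 ≤ 2 * φ e := by
    have h3 := hb b₀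
    have e1 : ∀ j, (inner ℝ (z j).1 (mulV V b) - (z j).2) ^ 2 =
        (inner ℝ (z j).1 (mulV V b₀) - (z j).2) ^ 2 +
          (inner ℝ (mulV V e) (z j).1 ^ 2 - 2 * (r j * inner ℝ (mulV V e) (z j).1)) := by
      intro j
      simp only [hr, he, mulV_sub, real_inner_comm (z j).1, inner_sub_right]
      ring
    simp_rw [e1] at h3
    rw [Finset.sum_add_distrib, Finset.sum_sub_distrib, ← Finset.mul_sum] at h3
    have e2 : φ e = ∑ j, r j * inner ℝ (mulV V e) (z j).1 := rfl
    rw [e2]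
    linarith
  have hl0 : (0 : ℝ) < l := by exact_mod_cast hl
  have hmain : ‖e‖ ≤ 8 * t / l := by
    rw [le_div_iff₀ hl0]
    have h4 := (abs_le.1 hf).1
    have h5 := (abs_le.1 hφ).2
    rw [hfe] at h4
    have h6 : l * ‖e‖ ^ 2 ≤ 8 * t * ‖e‖ := by nlinarith
    obtain ⟨q, hq, _⟩ := hT 0 (by simp)
    have ht : 0 ≤ t := (abs_nonneg _).trans (h2 q hq)
    rcases (norm_nonneg e).eq_or_lt with h0 | h0
    · rw [← h0]; simp; positivity
    · have : ‖e‖ * (‖e‖ * l) ≤ ‖e‖ * (8 * t) := by nlinarith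
      exact le_of_mul_le_mul_left this h0
  have e3 : mulV V b - ρ = mulV V e - (ρ - mulV V b₀) := by
    rw [he, mulV_sub]; abel
  rw [e3]
  refine (norm_sub_le _ _).trans (add_le_add ?_ le_rfl)
  rw [norm_mulV_of_orth hV]
  exact hmain

variable {Ω : Type*} [MeasurableSpace Ω] {μ : Measure Ω} [IsProbabilityMeasure μ] {m : ℕ}
  {n : Fin m → ℕ} {x : (i : Fin m) → Fin (n i) → Ω → Eucl d} {y : (i : Fin m) → Fin (n i) → Ω → ℝ}
  {Γ : Fin m → Matrix (Fin d) (Fin d) ℝ} {θ : Fin m → Eucl d}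
  {B : Matrix (Fin d) (Fin k) ℝ} {α : Fin m → Eucl k} {σ2 γ2 : ℝ≥0} {κ g a : ℝ}

/-- For a fixed matrix with orthonormal columns, samples with identity covariance are good with high
probability. -/
lemma IsModel.measure_not_isGoodSample_le (h : IsModel μ n x y Γ θ B α σ2 γ2 κ g a) {i : Fin m}
    (hΓ : Γ i = 1) (hn : 1 ≤ n i) {V : Matrix (Fin d) (Fin k) ℝ} (hV : Vᵀ * V = 1)
    {T : Finset (Eucl k)} (hTc : T.card ≤ 5 ^ k) (hT1 : ∀ u ∈ T, ‖u‖ ≤ 1) {S : ℝ≥0} (hS0 : 0 < S)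
    (hS : a ^ 2 * γ2 + σ2 + γ2 ≤ S) {s t : ℝ} (hs : 0 < s)
    (ht : t = 2 * √(512 * S ^ 2 * n i * s) + 16 * S * s) (htn : t ≤ n i / 8) :
    μ {ω | ¬ IsGoodSample T (θ i) t V (fun j => (x i j ω, y i j ω))} ≤
      ENNReal.ofReal (5 ^ k * 5 ^ k * (4 * Real.exp (-s))) := by
  have hγ0 : (0 : ℝ) ≤ γ2 := γ2.2
  have hσ0 : (0 : ℝ) ≤ σ2 := σ2.2
  have hS0' : (0 : ℝ) < S := hS0
  have hθ : θ i = mulV B (α i) := by rw [← h.low_dim i, hΓ, one_mulV]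
  have hθa : ‖θ i‖ ≤ a := by
    rw [hθ, norm_mulV_of_orth h.B_orth]; exact h.alpha_bound i
  have hblock : iIndepFun (fun j ω => (x i j ω, y i j ω)) μ :=
    h.samples_indep.precomp (g := fun j : Fin (n i) => (⟨i, j⟩ : (i : Fin m) × Fin (n i)))
      (fun a b hab => by simpa using hab)
  have hn0 : (0 : ℝ) < n i := by exact_mod_cast hn
  have hxq : ∀ (q : Eucl k) j, ‖q‖ ≤ 1 →
      HasSubgaussianMGF (fun ω => inner ℝ (mulV V q) (x i j ω)) S μ := by
    intro q j hq
    refine h.inner_hasSubgaussianMGF i j (u := mulV V q) (r := 1) ?_ ?_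
    · rwa [norm_mulV_of_orth hV]
    · nlinarith [mul_nonneg (sq_nonneg a) hγ0]
  -- sums of products of sub-gaussian variables
  have key : ∀ (f g : Eucl d × ℝ → ℝ), Measurable f → Measurable g →
      (∀ j, HasSubgaussianMGF (fun ω => f (x i j ω, y i j ω)) S μ) →
      (∀ j, HasSubgaussianMGF (fun ω => g (x i j ω, y i j ω)) S μ) → ∀ c : ℝ,
      (∀ j, ∫ ω, f (x i j ω, y i j ω) * g (x i j ω, y i j ω) ∂μ = c) →
      μ {ω | t ≤ |∑ j, f (x i j ω, y i j ω) * g (x i j ω, y i j ω) - n i * c|} ≤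
        ENNReal.ofReal (2 * Real.exp (-s)) := by
    intro f g hf hg hfS hgS c hc
    have hdm : ∀ j, Measurable fun ω => (x i j ω, y i j ω) := fun j =>
      (h.measurable_x i j).prodMk (h.measurable_y i j)
    have h1 : ∀ j, HasSubexpMGF (fun ω => f (x i j ω, y i j ω) * g (x i j ω, y i j ω) - c)
        (512 * S ^ 2) (1 / (8 * S)) μ := by
      intro j
      have := (hasSubexpMGF_sub_integral_of_abs_le hS0
        (X := fun ω => f (x i j ω, y i j ω) * g (x i j ω, y i j ω))
        ((hfS j).aestronglyMeasurable.mul (hgS j).aestronglyMeasurable) (hfS j) (hgS j)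
        fun ω => ?_).2
      · rwa [hc j] at this
      · rw [abs_mul]
        have := two_mul_le_add_sq |f (x i j ω, y i j ω)| |g (x i j ω, y i j ω)|
        rw [sq_abs, sq_abs] at this
        linarith
    have h2 := HasSubexpMGF.sum (s := Finset.univ)
      (hblock.comp (fun _ z => f z * g z - c) fun _ => (hf.mul hg).sub_const _)
      (fun j => ((hf.mul hg).sub_const c).comp (hdm j)) fun j _ => h1 j
    have h3 := h2.measure_abs_ge_le (s := s) (by simp; positivity) (by positivity) hs.le
    have e : 2 * √((∑ _j : Fin (n i), 512 * (S : ℝ) ^ 2) * s) + 2 * s / (1 / (8 * S)) = t := by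
      simp only [Finset.sum_const, Finset.card_univ, Fintype.card_fin, nsmul_eq_mul]
      rw [ht, mul_comm (n i : ℝ)]
      field_simp
      ring
    rw [e] at h3
    simpa [Finset.sum_sub_distrib] using h3
  set ρ := θ i with hρ
  set δ := ρ - mulV V (mulV Vᵀ ρ) with hδ
  let bad₁ : Eucl k × Eucl k → Set Ω := fun w => {ω | t ≤
    |∑ j, inner ℝ (mulV V w.1) (x i j ω) * inner ℝ (mulV V w.2) (x i j ω) - n i * inner ℝ w.1 w.2|}
  let bad₂ : Eucl k → Set Ω := fun q => {ω | t ≤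
    |∑ j, (y i j ω - inner ℝ (mulV V (mulV Vᵀ ρ)) (x i j ω)) * inner ℝ (mulV V q) (x i j ω) -
      n i * 0|}
  have hb₁ : ∀ w ∈ T ×ˢ T, μ (bad₁ w) ≤ ENNReal.ofReal (2 * Real.exp (-s)) := by
    intro w hw
    obtain ⟨hw1, hw2⟩ := Finset.mem_product.1 hw
    refine key (fun z => inner ℝ (mulV V w.1) z.1) (fun z => inner ℝ (mulV V w.2) z.1)
      (by fun_prop) (by fun_prop) (fun j => hxq _ j (hT1 _ hw1)) (fun j => hxq _ j (hT1 _ hw2)) _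
      fun j => ?_
    rw [h.integral_inner_mul_inner, hΓ, one_mulV, inner_mulV_mulV_of_orth hV]
  have hb₂ : ∀ q ∈ T, μ (bad₂ q) ≤ ENNReal.ofReal (2 * Real.exp (-s)) := by
    intro q hq
    refine key (fun z => z.2 - inner ℝ (mulV V (mulV Vᵀ ρ)) z.1) (fun z => inner ℝ (mulV V q) z.1)
      (by fun_prop) (by fun_prop) (fun j => ?_) (fun j => hxq _ j (hT1 _ hq)) _ fun j => ?_
    · refine h.residual_hasSubgaussianMGF i j _ (r := a) ((norm_sub_proj_le hV ρ).trans hθa) ?_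
      linarith
    -- With identity covariance, the residual correlates with `xᵀ V q` through the inner product of
    -- `V q` and `ρ - V Vᵀ ρ`, which is zero.
    · rw [h.integral_residual_mul_inner, hΓ, one_mulV, real_inner_comm, inner_mulV, mulV_sub,
        mulV_mulV Vᵀ V, hV, one_mulV, sub_self, inner_zero_left]
  have hsub : {ω | ¬ IsGoodSample T ρ t V (fun j => (x i j ω, y i j ω))} ⊆
      (⋃ w ∈ T ×ˢ T, bad₁ w) ∪ ⋃ q ∈ T, bad₂ q := by
    intro ω hω
    by_contra hcon
    simp only [Set.mem_union, not_or, Set.mem_iUnion, not_exists, Set.mem_ofPred_eq, not_le,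
      Finset.mem_product, bad₁, bad₂, mul_zero, sub_zero] at hcon
    exact hω ⟨fun q hq q' hq' => (hcon.1 (q, q') ⟨hq, hq'⟩).le.trans htn,
      fun q hq => (hcon.2 q hq).le⟩
  have hTc' : (T.card : ℝ) ≤ 5 ^ k := by exact_mod_cast hTc
  have h5 : (1 : ℝ) ≤ 5 ^ k := one_le_pow₀ (by norm_num)
  have hA : μ (⋃ w ∈ T ×ˢ T, bad₁ w) ≤ ENNReal.ofReal (5 ^ k * 5 ^ k * (2 * Real.exp (-s))) := by
    refine (measure_biUnion_finset_le _ _).trans ((Finset.sum_le_sum hb₁).trans ?_)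
    rw [Finset.sum_const, nsmul_eq_mul, ← ENNReal.ofReal_natCast,
      ← ENNReal.ofReal_mul (Nat.cast_nonneg _), Finset.card_product]
    refine ENNReal.ofReal_le_ofReal ?_
    push_cast
    gcongr
  have hB : μ (⋃ q ∈ T, bad₂ q) ≤ ENNReal.ofReal (5 ^ k * 5 ^ k * (2 * Real.exp (-s))) := by
    refine (measure_biUnion_finset_le _ _).trans ((Finset.sum_le_sum hb₂).trans ?_)
    rw [Finset.sum_const, nsmul_eq_mul, ← ENNReal.ofReal_natCast,
      ← ENNReal.ofReal_mul (Nat.cast_nonneg _)]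
    refine ENNReal.ofReal_le_ofReal (mul_le_mul_of_nonneg_right ?_ (by positivity))
    nlinarith
  refine (measure_mono hsub).trans ((measure_union_le _ _).trans ((add_le_add hA hB).trans_eq ?_))
  rw [← ENNReal.ofReal_add (by positivity) (by positivity)]
  congr 1
  ring

/-- The samples of the last client are good for an estimator built from the other clients. -/
lemma IsModel.measure_not_isGoodSample_estimator_le {n : Fin (m + 1) → ℕ}
    {x : (i : Fin (m + 1)) → Fin (n i) → Ω → Eucl d} {y : (i : Fin (m + 1)) → Fin (n i) → Ω → ℝ}
    {Γ : Fin (m + 1) → Matrix (Fin d) (Fin d) ℝ} {θ : Fin (m + 1) → Eucl d}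
    {α : Fin (m + 1) → Eucl k} (h : IsModel μ n x y Γ θ B α σ2 γ2 κ g a)
    {Bhat : Dataset (fun i : Fin m => n i.castSucc) d → Matrix (Fin d) (Fin k) ℝ}
    (hBm : ∀ p r, Measurable fun S => Bhat S p r) (hBo : ∀ S, (Bhat S)ᵀ * Bhat S = 1)
    {T : Finset (Eucl k)} {ρ : Eucl d} {t : ℝ} {δ : ℝ≥0∞}
    (hδ : ∀ V : Matrix (Fin d) (Fin k) ℝ, Vᵀ * V = 1 → μ {ω | ¬ IsGoodSample T ρ t V
      (fun j => (x (Fin.last m) j ω, y (Fin.last m) j ω))} ≤ δ) :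
    μ {ω | ¬ IsGoodSample T ρ t (Bhat (fun i j => (x i.castSucc j ω, y i.castSucc j ω)))
      (fun j => (x (Fin.last m) j ω, y (Fin.last m) j ω))} ≤ δ := by
  have hdm : ∀ i j, Measurable fun ω => (x i j ω, y i j ω) := fun i j =>
    (h.measurable_x i j).prodMk (h.measurable_y i j)
  have hind := iIndepFun_curry (X := fun i j ω => (x i j ω, y i j ω)) hdm h.samples_indep
  have hBm' : Measurable fun (S : Dataset (fun i : Fin m => n i.castSucc) d) p r => Bhat S p r :=
    measurable_pi_lambda _ fun p => measurable_pi_lambda _ fun r => hBm p r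
  have hXY : IndepFun (fun ω p r => Bhat (fun i j => (x i.castSucc j ω, y i.castSucc j ω)) p r)
      (fun ω j => (x (Fin.last m) j ω, y (Fin.last m) j ω)) μ := by
    -- The clients are split into the last one and all others; the estimator is a function of the
    -- second block only.
    have h1 := hind.indepFun_finset (Finset.univ.erase (Fin.last m)) {Fin.last m} (by simp)
      fun i => measurable_pi_lambda _ fun j => hdm i j
    refine h1.comp
      (φ := fun z p r => Bhat (fun i j => z ⟨i.castSucc, by simp [Fin.castSucc_ne_last]⟩ j) p r)
      (ψ := fun (z : (i : ({Fin.last m} : Finset (Fin (m + 1)))) → Fin (n i) → Eucl d × ℝ)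
        (j : Fin (n (Fin.last m))) => z ⟨Fin.last m, by simp⟩ j) ?_
      (measurable_pi_lambda _ fun j => (measurable_pi_apply j).comp (measurable_pi_apply _))
    exact hBm'.comp (measurable_pi_lambda _ fun i => measurable_pi_lambda _ fun j => by fun_prop)
  have hX : Measurable (fun ω p r => Bhat (fun i j => (x i.castSucc j ω, y i.castSucc j ω)) p r) :=
    hBm'.comp (measurable_pi_lambda _ fun i => measurable_pi_lambda _ fun j => hdm _ j)
  have hY : Measurable (fun ω j => (x (Fin.last m) j ω, y (Fin.last m) j ω)) :=
    measurable_pi_lambda _ fun j => hdm _ j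
  exact measure_le_of_indepFun hX hY hXY (measurableSet_isGoodSample T ρ t) fun ω' => hδ _ (hBo _)

end LeastSquares

/-! ### From the diversity matrix to the spectral gap. -/

section Diversity

variable {M k d : ℕ}

lemma diversity_isHermitian (n : Fin M → ℕ) (α : Fin M → Eucl k) : (diversity n α).IsHermitian := by
  ext p q
  simp only [Matrix.conjTranspose_apply, star_trivial, diversity, Matrix.smul_apply,
    Matrix.sum_apply, Matrix.vecMulVec_apply, smul_eq_mul]
  congr 1
  exact Finset.sum_congr rfl fun _ _ => by ring

lemma inner_diversity (n : Fin M → ℕ) (α : Fin M → Eucl k) (w : Eucl k) :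
    inner ℝ w (mulV (diversity n α) w) =
      (∑ i, (n i : ℝ))⁻¹ * ∑ i, (n i : ℝ) * inner ℝ w (α i) ^ 2 := by
  have e : mulV (diversity n α) w = (∑ i, (n i : ℝ))⁻¹ •
      mulV (∑ i, (n i : ℝ) • Matrix.vecMulVec (α i).ofLp (α i).ofLp) w := by
    ext p
    simp only [mulV_apply, diversity, Matrix.smul_apply, PiLp.smul_apply, smul_eq_mul,
      Finset.mul_sum, Nat.cast_sum, mul_assoc]
  rw [e, real_inner_smul_right, inner_sum_vecMulVec]
  congr 1
  exact Finset.sum_congr rfl fun _ _ => by rw [sq]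

lemma mul_sum_vecMulVec_mul (B : Matrix (Fin d) (Fin k) ℝ) (c : Fin M → ℝ) (α : Fin M → Eucl k) :
    B * (∑ i, c i • Matrix.vecMulVec (α i).ofLp (α i).ofLp) * Bᵀ =
      ∑ i, c i • Matrix.vecMulVec (mulV B (α i)).ofLp (mulV B (α i)).ofLp := by
  rw [Matrix.mul_sum, Matrix.sum_mul]
  refine Finset.sum_congr rfl fun i _ => ?_
  rw [Matrix.mul_smul, Matrix.smul_mul, Matrix.mul_vecMulVec, Matrix.vecMulVec_mul,
    Matrix.vecMul_transpose]
  rfl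

/-- The gap of `N D` is `N c₁ / k`. The target `B (N D) Bᵀ` is symmetric, so transposing the
perturbation bound handles left singular vectors. -/
lemma norm_sub_proj_le_of_crossMat_sub_le {n : Fin M → ℕ} {α : Fin M → Eucl k}
    {B V : Matrix (Fin d) (Fin k) ℝ} {Z : Matrix (Fin d) (Fin d) ℝ} (hB : Bᵀ * B = 1) {c₁ N ε a : ℝ}
    (hc₁ : 0 < c₁) (hk : 1 ≤ k) (hN : N = ∑ i, (n i : ℝ)) (hN0 : 0 < N)
    (hD : c₁ / k ≤ eig (diversity n α) k) (hV : IsTopRightSingular Z V ∨ IsTopRightSingular Zᵀ V)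
    (hε : 0 ≤ ε) (hZ : ∀ u v : Eucl d, |inner ℝ u (mulV (Z -
      ∑ i, (n i : ℝ) • Matrix.vecMulVec (mulV B (α i)).ofLp (mulV B (α i)).ofLp) v)| ≤
        ε * ‖u‖ * ‖v‖) {α' : Eucl k} (hα' : ‖α'‖ ≤ a) :
    ‖mulV B α' - mulV V (mulV Vᵀ (mulV B α'))‖ ≤ 2 * ε * a / (N * c₁ / k) := by
  have hk0 : (0 : ℝ) < k := by exact_mod_cast hk
  set D' := ∑ i, (n i : ℝ) • Matrix.vecMulVec (α i).ofLp (α i).ofLp with hD'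
  have hZA : ∀ u v, |inner ℝ u (mulV (Z - B * D' * Bᵀ) v)| ≤ ε * ‖u‖ * ‖v‖ := by
    rw [hD', mul_sum_vecMulVec_mul]
    exact hZ
  have hDlow : ∀ w : Eucl k, N * c₁ / k * ‖w‖ ^ 2 ≤ inner ℝ w (mulV D' w) := by
    intro w
    have h1 := (eig_bounds (diversity_isHermitian n α) hk w).1
    have e : inner ℝ w (mulV D' w) = N * inner ℝ w (mulV (diversity n α) w) := by
      rw [hD', inner_sum_vecMulVec, inner_diversity, ← hN, mul_inv_cancel_left₀ hN0.ne']
      exact Finset.sum_congr rfl fun _ _ => by rw [sq]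
    have h2 := mul_le_mul_of_nonneg_right hD (sq_nonneg ‖w‖)
    rw [e, mul_div_assoc, mul_assoc]
    exact mul_le_mul_of_nonneg_left (h2.trans h1) hN0.le
  have hc0 : 0 < N * c₁ / k := by positivity
  rcases hV with ht | ht
  · exact ht.norm_sub_proj_le hB hε hc0 hDlow hZA α' hα'
  · refine ht.norm_sub_proj_le hB hε hc0 hDlow (fun u v => ?_) α' hα'
    have hsym : (B * D' * Bᵀ)ᵀ = B * D' * Bᵀ := by
      have hDs : D'ᵀ = D' := by
        rw [hD', Matrix.transpose_sum]
        refine Finset.sum_congr rfl fun i _ => ?_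
        rw [Matrix.transpose_smul, Matrix.transpose_vecMulVec]
      rw [Matrix.transpose_mul, Matrix.transpose_mul, Matrix.transpose_transpose, hDs,
        Matrix.mul_assoc]
    have e : Zᵀ - B * D' * Bᵀ = (Z - B * D' * Bᵀ)ᵀ := by
      rw [Matrix.transpose_sub, hsym]
    rw [e, inner_mulV, Matrix.transpose_transpose, real_inner_comm]
    exact (hZA v u).trans_eq (by ring)

end Diversity

/-! ### Numerical bounds for the rates. -/

section Numerics

/-- Here `k / N` is the inverse gap, and up to constants `K` is `r`, `Q` is at most `N / k` and `s`
at most `d r`. The term `K s` produces the power `r²`. -/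
lemma error_term_le {d k M N r K Q s β C₁ C₂ C₃ a : ℝ} (hk : 1 ≤ k) (hkd : k ≤ d)
    (hM : 0 ≤ M) (hN : 0 < N) (hdk : d * k ≤ N) (hr : 1 ≤ r) (hC₁ : 0 ≤ C₁) (hC₂ : 0 ≤ C₂)
    (hC₃ : 0 ≤ C₃) (ha : 0 ≤ a) (hK : K = C₁ * r) (hQ : Q ≤ 2 * (N * C₂ / k))
    (hs0 : 0 ≤ s) (hs : s ≤ 14 * d * r) (hβ0 : 0 ≤ β) (hβ : β ≤ C₃ / (d + N)) :
    4 * (8 * √(K * Q * s) + (2 * √(K ^ 2 * M * s) + 4 * K * s) + N * (β * (2 * a + β))) * (k / N) ≤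
      4 * (8 * √(28 * C₁ * C₂) + 64 * C₁ + C₃ * (2 * a + C₃)) * r ^ 2 *
        (√(d * k / N) + √(M * d * k ^ 2 / N ^ 2)) := by
  have hd : 1 ≤ d := hk.trans hkd
  have hk0 : 0 < k := by linarith
  have hK0 : 0 ≤ K := by rw [hK]; positivity
  set A := √(d * k / N) with hA
  set D := √(M * d * k ^ 2 / N ^ 2) with hD
  have hA0 : 0 ≤ A := Real.sqrt_nonneg _
  have hD0 : 0 ≤ D := Real.sqrt_nonneg _
  have hr2 : r ≤ r ^ 2 := by nlinarith
  have h1 : √(K * Q * s) * (k / N) ≤ √(28 * C₁ * C₂) * r ^ 2 * A := by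
    have e : √(K * Q * s) ≤ √(28 * C₁ * C₂) * (r * √(N * d / k)) := by
      rw [← Real.sqrt_sq (by linarith : 0 ≤ r), ← Real.sqrt_mul (by positivity),
        ← Real.sqrt_mul (by positivity)]
      refine Real.sqrt_le_sqrt ?_
      calc K * Q * s ≤ (C₁ * r) * (2 * (N * C₂ / k)) * (14 * d * r) := by rw [hK]; gcongr
        _ = 28 * C₁ * C₂ * (r ^ 2 * (N * d / k)) := by ring
    have e2 : √(N * d / k) * (k / N) = A := by
      rw [hA, ← Real.sqrt_sq (show 0 ≤ k / N by positivity), ← Real.sqrt_mul (by positivity)]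
      congr 1
      field_simp
    calc √(K * Q * s) * (k / N) ≤ √(28 * C₁ * C₂) * (r * √(N * d / k)) * (k / N) := by gcongr
      _ = √(28 * C₁ * C₂) * r * (√(N * d / k) * (k / N)) := by ring
      _ ≤ _ := by rw [e2]; gcongr
  have h2 : √(K ^ 2 * M * s) * (k / N) ≤ 4 * C₁ * r ^ 2 * D := by
    have e : √(K ^ 2 * M * s) ≤ 4 * C₁ * r ^ 2 * √(M * d) := by
      rw [← Real.sqrt_sq (by positivity : 0 ≤ 4 * C₁ * r ^ 2), ← Real.sqrt_mul (by positivity)]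
      refine Real.sqrt_le_sqrt ?_
      have hr3 : r ^ 3 ≤ r ^ 4 := pow_le_pow_right₀ hr (by norm_num)
      calc K ^ 2 * M * s ≤ (C₁ * r) ^ 2 * M * (14 * d * r) := by rw [hK]; gcongr
        _ = 14 * C₁ ^ 2 * M * d * r ^ 3 := by ring
        _ ≤ 16 * C₁ ^ 2 * M * d * r ^ 4 := by gcongr; norm_num
        _ = (4 * C₁ * r ^ 2) ^ 2 * (M * d) := by ring
    have e2 : √(M * d) * (k / N) = D := by
      rw [hD, ← Real.sqrt_sq (show 0 ≤ k / N by positivity), ← Real.sqrt_mul (by positivity)]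
      congr 1
      field_simp
    calc √(K ^ 2 * M * s) * (k / N) ≤ 4 * C₁ * r ^ 2 * √(M * d) * (k / N) := by gcongr
      _ = 4 * C₁ * r ^ 2 * (√(M * d) * (k / N)) := by ring
      _ = _ := by rw [e2]
  have h3 : 4 * K * s * (k / N) ≤ 56 * C₁ * r ^ 2 * A := by
    -- Since `d k ≤ N`, the ratio is at most its square root.
    have hz : d * k / N ≤ A := by
      refine Real.le_sqrt_of_sq_le ?_
      have h0 : 0 ≤ d * k / N := by positivity
      have h1 : d * k / N ≤ 1 := (div_le_one hN).2 hdk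
      nlinarith
    calc 4 * K * s * (k / N) ≤ 4 * (C₁ * r) * (14 * d * r) * (k / N) := by rw [hK]; gcongr
      _ = 56 * C₁ * r ^ 2 * (d * k / N) := by ring
      _ ≤ _ := by gcongr
  have h4 : N * (β * (2 * a + β)) * (k / N) ≤ C₃ * (2 * a + C₃) * r ^ 2 * A := by
    have hβ1 : β ≤ C₃ := hβ.trans (div_le_self hC₃ (by linarith))
    have hz : k / (d + N) ≤ A := by
      refine Real.le_sqrt_of_sq_le ?_
      rw [div_pow, div_le_div_iff₀ (by positivity) hN]
      have h5 : N ≤ (d + N) ^ 2 := by nlinarith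
      calc k ^ 2 * N ≤ (d * k) * (d + N) ^ 2 := by
            rw [sq k]; gcongr
        _ = _ := by ring
    calc N * (β * (2 * a + β)) * (k / N) = β * (2 * a + β) * k := by field_simp
      _ ≤ C₃ / (d + N) * (2 * a + C₃) * k := by gcongr
      _ = C₃ * (2 * a + C₃) * 1 * (k / (d + N)) := by ring
      _ ≤ C₃ * (2 * a + C₃) * r ^ 2 * A := by gcongr; nlinarith
  have h5 : √(28 * C₁ * C₂) * r ^ 2 * A ≤ √(28 * C₁ * C₂) * r ^ 2 * (A + D) := by gcongr; linarith
  have h6 : C₁ * r ^ 2 * A ≤ C₁ * r ^ 2 * (A + D) := by gcongr; linarith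
  have h7 : C₁ * r ^ 2 * D ≤ C₁ * r ^ 2 * (A + D) := by gcongr; linarith
  have h8 : C₃ * (2 * a + C₃) * r ^ 2 * A ≤ C₃ * (2 * a + C₃) * r ^ 2 * (A + D) := by
    gcongr; linarith
  linarith

lemma two_mul_log_five_le : 2 * Real.log 5 ≤ 4 := by
  have : Real.log 5 ≤ 2 := by
    rw [Real.log_le_iff_le_exp (by norm_num)]
    have := Real.exp_one_gt_d9
    have e : Real.exp 2 = Real.exp 1 * Real.exp 1 := by rw [← Real.exp_add]; norm_num
    rw [e]
    nlinarith
  linarith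

/-- The summand `2 k log 5` of the exponent pays for a union bound over pairs of net points, and `v`
is the confidence that remains. -/
lemma five_pow_mul_exp (k : ℕ) (v : ℝ) :
    (5 : ℝ) ^ k * 5 ^ k * Real.exp (-(2 * k * Real.log 5 + v)) = Real.exp (-v) := by
  have e : (5 : ℝ) ^ k = Real.exp (k * Real.log 5) := by
    rw [Real.exp_nat_mul, Real.exp_log (by norm_num)]
  rw [e, ← Real.exp_add, ← Real.exp_add]
  congr 1
  ring

lemma exp_neg_mul_log {z : ℝ} (hz : 0 < z) (m : ℕ) :
    Real.exp (-((m : ℝ) * Real.log z)) = z ^ (-(m : ℤ)) := by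
  rw [Real.exp_neg, Real.exp_nat_mul, Real.exp_log hz, zpow_neg, zpow_natCast]

/-- A sample size from which the least squares step is well conditioned. -/
lemma exists_sample_size (S : ℝ) : ∃ n₀ : ℕ, ∀ n : ℕ, n₀ ≤ n →
    1 ≤ Real.log n ∧ 4 / Real.log n + 100 * (Real.log n / n) ≤ 1 ∧
      62 * S * √(4 / Real.log n + 100 * (Real.log n / n)) ≤ 1 / 8 := by
  have hlog : Filter.Tendsto (fun n : ℕ => Real.log n) Filter.atTop Filter.atTop :=
    Real.tendsto_log_atTop.comp tendsto_natCast_atTop_atTop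
  have h1 : Filter.Tendsto (fun n : ℕ => 4 / Real.log n) Filter.atTop (nhds 0) :=
    Filter.Tendsto.div_atTop tendsto_const_nhds hlog
  have h2 : Filter.Tendsto (fun n : ℕ => Real.log n / n) Filter.atTop (nhds 0) :=
    (Real.isLittleO_log_id_atTop.tendsto_div_nhds_zero).comp tendsto_natCast_atTop_atTop
  have h3 : Filter.Tendsto (fun n : ℕ => 4 / Real.log n + 100 * (Real.log n / n)) Filter.atTop
      (nhds 0) := by simpa using h1.add (h2.const_mul 100)
  have h4 : Filter.Tendsto (fun n : ℕ => 62 * S * √(4 / Real.log n + 100 * (Real.log n / n)))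
      Filter.atTop (nhds 0) := by
    have := (Real.continuous_sqrt.tendsto 0).comp h3
    rw [Real.sqrt_zero] at this
    simpa using this.const_mul (62 * S)
  have h5 := (hlog.eventually_ge_atTop 1).and ((h3.eventually_le_const (by norm_num : (0 : ℝ) < 1)).and
    (h4.eventually_le_const (by norm_num : (0 : ℝ) < 1 / 8)))
  obtain ⟨n₀, hn₀⟩ := Filter.eventually_atTop.1 h5
  exact ⟨n₀, hn₀⟩

/-- With `ρ = s / n`, the hypothesis `k log n ≤ n` gives `k / n ≤ 1 / log n`, so `ρ` is small for
large `n`; then `ρ ≤ √ρ` merges both Bernstein terms. The constants are `62 = 2 * 23 + 16`, where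
`512 ≤ 23²`, and `5456 = 8 * 62 * 11`, where `104 ≤ 11²`. -/
lemma threshold_le {n k S s t : ℝ} (hn : 0 < n) (hk : 1 ≤ k) (hS : 0 ≤ S)
    (hl : 1 ≤ Real.log n) (hkn : k * Real.log n ≤ n)
    (hρ : 4 / Real.log n + 100 * (Real.log n / n) ≤ 1)
    (hS' : 62 * S * √(4 / Real.log n + 100 * (Real.log n / n)) ≤ 1 / 8)
    (hs0 : 0 ≤ s) (hs : s ≤ 4 * k + 100 * Real.log n)
    (ht : t = 2 * √(512 * S ^ 2 * n * s) + 16 * S * s) :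
    t ≤ n / 8 ∧ 8 * t / n ≤ 5456 * S * (Real.log n * √(k / n)) := by
  have hl0 : 0 < Real.log n := by linarith
  set ρ := s / n with hρdef
  have hρ0 : 0 ≤ ρ := by positivity
  have hρ1 : ρ ≤ 4 / Real.log n + 100 * (Real.log n / n) := by
    have h1 : k / n ≤ 1 / Real.log n := by
      rw [div_le_div_iff₀ hn hl0]; linarith
    calc ρ ≤ (4 * k + 100 * Real.log n) / n := by rw [hρdef]; gcongr
      _ = 4 * (k / n) + 100 * (Real.log n / n) := by ring
      _ ≤ 4 * (1 / Real.log n) + 100 * (Real.log n / n) := by gcongr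
      _ = _ := by ring
  have hρle : ρ ≤ √ρ := Real.le_sqrt_of_sq_le (by nlinarith)
  have htn : t ≤ 62 * S * √ρ * n := by
    have e1 : √(512 * S ^ 2 * n * s) ≤ 23 * S * n * √ρ := by
      rw [← Real.sqrt_sq (show 0 ≤ 23 * S * n by positivity), ← Real.sqrt_mul (by positivity)]
      refine Real.sqrt_le_sqrt ?_
      have e : (23 * S * n) ^ 2 * ρ = 529 * (S ^ 2 * n * s) := by rw [hρdef]; field_simp; ring
      rw [e]
      have : 0 ≤ S ^ 2 * n * s := by positivity
      linarith
    have e2 : s = ρ * n := by rw [hρdef]; field_simp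
    have e3 : 16 * S * s ≤ 16 * S * n * √ρ := by
      rw [e2]
      calc 16 * S * (ρ * n) = 16 * S * n * ρ := by ring
        _ ≤ _ := by gcongr
    rw [ht]
    linarith
  refine ⟨?_, ?_⟩
  · have : 62 * S * √ρ ≤ 1 / 8 := le_trans (by gcongr) hS'
    have := mul_le_mul_of_nonneg_right this hn.le
    linarith
  · have e1 : √ρ ≤ 11 * (Real.log n * √(k / n)) := by
      rw [← mul_assoc, ← Real.sqrt_sq (show 0 ≤ 11 * Real.log n by positivity),
        ← Real.sqrt_mul (by positivity)]
      refine Real.sqrt_le_sqrt ?_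
      rw [hρdef, ← mul_div_assoc]
      gcongr
      have h1 : 4 * k + 100 * Real.log n ≤ 104 * (k * Real.log n) := by nlinarith
      have h2 : k * Real.log n ≤ k * Real.log n ^ 2 := by
        gcongr; nlinarith
      have h3 : 0 ≤ k * Real.log n ^ 2 := by positivity
      nlinarith
    rw [div_le_iff₀ hn]
    calc 8 * t ≤ 8 * (62 * S * √ρ * n) := by gcongr
      _ ≤ 8 * (62 * S * (11 * (Real.log n * √(k / n))) * n) := by gcongr
      _ = _ := by ring

end Numerics

/-! ### Recovery of the shared subspace. -/

section Main

variable {Ω : Type*} [MeasurableSpace Ω] {μ : Measure Ω} [IsProbabilityMeasure μ] {m d k : ℕ}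
  {n : Fin m → ℕ} {x : (i : Fin m) → Fin (n i) → Ω → Eucl d} {y : (i : Fin m) → Fin (n i) → Ω → ℝ}
  {Γ : Fin m → Matrix (Fin d) (Fin d) ℝ} {θ : Fin m → Eucl d}
  {B : Matrix (Fin d) (Fin k) ℝ} {α : Fin m → Eucl k} {σ2 γ2 : ℝ≥0} {κ g a c₁ c₂ : ℝ}

set_option maxHeartbeats 1000000 in
/-- The spectral estimator recovers the shared subspace with high probability. -/
lemma IsModel.exists_residual_le (h : IsModel μ n x y Γ θ B α σ2 γ2 κ g a) (hg : 0 < g)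
    (hc₁ : 0 < c₁) (hk : 1 ≤ k) (hkd : k ≤ d) (hn : ∀ i, 2 ≤ n i) (hm : 1 ≤ m)
    (hD1 : c₁ / k ≤ eig (diversity n α) k) (hD2 : eig (diversity n α) 1 ≤ c₂ / k)
    {Bhat : Dataset n d → Matrix (Fin d) (Fin k) ℝ} (hB : IsSpectralEstimator Bhat)
    {τ : ℝ≥0} (hτ : (a * κ / g) ^ 2 * γ2 + σ2 ≤ τ) {N C₁ C₃ : ℝ} (hN : N = ∑ i, (n i : ℝ))
    (hC₁ : C₁ = 8064 * (τ + 1) * (γ2 + 1))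
    (hC₃ : C₃ = 12 * (Real.exp (τ / 2) + Real.exp (γ2 / 2)) + 1) :
    ∃ A : Set Ω, μ A ≤ ENNReal.ofReal (8 * (d + N) ^ (-10 : ℤ)) ∧
      ∀ ω ∉ A, ∀ α' : Eucl k, ‖α'‖ ≤ a →
        ‖mulV B α' - mulV (Bhat fun i j => (x i j ω, y i j ω))
          (mulV (Bhat fun i j => (x i j ω, y i j ω))ᵀ (mulV B α'))‖ ≤
        (a + 2 * a / c₁ * (4 * (8 * √(28 * C₁ * (|c₂| + C₃ ^ 2)) + 64 * C₁ + C₃ * (2 * a + C₃)))) *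
          Real.log (d + N) ^ 2 * (√(d * k / N) + √(m * d * k ^ 2 / N ^ 2)) := by
  have hτ0 : (0 : ℝ) ≤ τ := τ.2
  have hγ0 : (0 : ℝ) ≤ γ2 := γ2.2
  have hd : 1 ≤ d := hk.trans hkd
  have ha : 0 ≤ a := h.a_nonneg ⟨0, hm⟩
  have hk' : (1 : ℝ) ≤ k := by exact_mod_cast hk
  have hk0 : (0 : ℝ) < k := by linarith
  have hkd' : (k : ℝ) ≤ d := by exact_mod_cast hkd
  have hd' : (1 : ℝ) ≤ d := by linarith
  have hN2 : 2 ≤ N := by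
    rw [hN]
    refine le_trans ?_ (Finset.single_le_sum (f := fun i => (n i : ℝ)) (fun i _ => Nat.cast_nonneg _)
      (Finset.mem_univ ⟨0, hm⟩))
    exact_mod_cast hn ⟨0, hm⟩
  have hN0 : 0 < N := by linarith
  have hdN : 0 < d + N := by linarith
  set r := Real.log (d + N) with hr
  have hr1 : 1 ≤ r := by
    rw [hr, Real.le_log_iff_exp_le hdN]
    linarith [Real.exp_one_lt_d9]
  have hC₁0 : 0 ≤ C₁ := by rw [hC₁]; positivity
  have hC₃0 : 0 ≤ C₃ := by rw [hC₃]; positivity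
  set s := 2 * d * Real.log 5 + 10 * r with hs
  have hlog5 : 0 ≤ Real.log 5 := Real.log_nonneg (by norm_num)
  have hs0 : 0 < s := by rw [hs]; positivity
  have hs1 : s ≤ 14 * d * r := by
    have h1 := two_mul_log_five_le
    have h2 : (d : ℝ) ≤ d * r := by nlinarith
    have h3 : r ≤ d * r := by nlinarith
    rw [hs]
    nlinarith
  have hdiv : ∀ w : Eucl k, N * inner ℝ w (mulV (diversity n α) w) =
      ∑ i, (n i : ℝ) * inner ℝ w (α i) ^ 2 := by
    intro w
    rw [inner_diversity, ← hN, mul_inv_cancel_left₀ hN0.ne']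
  have hR : ∀ v : Eucl d, ‖v‖ ≤ 1 →
      ∑ i, (n i : ℝ) * inner ℝ v (mulV B (α i)) ^ 2 ≤ N * |c₂| / k := by
    intro v hv
    have h1 := (eig_bounds (diversity_isHermitian n α) hk (mulV Bᵀ v)).2
    have h2 : ‖mulV Bᵀ v‖ ^ 2 ≤ 1 :=
      pow_le_one₀ (norm_nonneg _) ((norm_mulV_transpose_le h.B_orth v).trans hv)
    simp_rw [inner_mulV]
    rw [← hdiv, mul_div_assoc]
    gcongr
    have h3 : eig (diversity n α) 1 ≤ |c₂| / k :=
      hD2.trans (div_le_div_of_nonneg_right (le_abs_self _) hk0.le)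
    have h4 : (0 : ℝ) ≤ |c₂| / k := by positivity
    nlinarith [sq_nonneg ‖mulV Bᵀ v‖]
  set L := 4 * √((τ + 1) * (12 * r)) with hL
  set K := 42 * L ^ 2 * (γ2 + 1) with hK
  set β := C₃ * Real.exp (-r) with hβ
  have hβ' : β = C₃ / (d + N) := by rw [hβ, hr, Real.exp_neg, Real.exp_log hdN, div_eq_mul_inv]
  set Q := 2 * (N * |c₂| / k + N * β ^ 2) with hQ
  have hKC : K = C₁ * r := by
    rw [hK, hL, mul_pow, Real.sq_sqrt (by positivity), hC₁]; ring
  have hβ0 : 0 ≤ β := by positivity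
  have hQ0 : 0 ≤ Q := by positivity
  have hQ1 : Q ≤ 2 * (N * (|c₂| + C₃ ^ 2) / k) := by
    have h1 : β ^ 2 ≤ C₃ ^ 2 / k := by
      rw [hβ', div_pow]
      gcongr
      nlinarith
    have h2 : N * (|c₂| + C₃ ^ 2) / k = N * |c₂| / k + N * (C₃ ^ 2 / k) := by ring
    rw [hQ, h2]
    gcongr
  obtain ⟨A, hA, hA'⟩ := h.exists_crossMat_sub_le hg hd hn hm hτ (r := r) (s := s) (by linarith)
    hs0 hR hN hL hK (by rw [hβ, hC₃]) hQ
  refine ⟨A, hA.trans (ENNReal.ofReal_le_ofReal ?_), fun ω hω α' hα' => ?_⟩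
  · have e1 : (5 : ℝ) ^ d * 5 ^ d * (6 * Real.exp (-s)) = 6 * (d + N) ^ (-10 : ℤ) := by
      have := five_pow_mul_exp d (10 * r)
      have e := exp_neg_mul_log hdN 10
      push_cast at e
      rw [← e, ← this]; ring
    -- The union over `N` samples costs a factor `N ≤ (d + N)²`, which is why truncation uses `12 r`
    -- rather than `10 r`.
    have e2 : N * (2 * Real.exp (-(12 * r))) ≤ 2 * (d + N) ^ (-10 : ℤ) := by
      have e3 := exp_neg_mul_log hdN 10
      push_cast at e3
      rw [← e3, ← hr, show -(12 * r) = -(10 * r) + -(2 * r) by ring, Real.exp_add]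
      have e4 : N * Real.exp (-(2 * r)) ≤ 1 := by
        have := exp_neg_mul_log hdN 2
        push_cast at this
        rw [hr, this, zpow_neg, ← div_eq_mul_inv, div_le_one (by positivity)]
        rw [show (2 : ℤ) = ((2 : ℕ) : ℤ) from rfl, zpow_natCast]
        nlinarith
      have := Real.exp_pos (-(10 * r))
      nlinarith
    rw [e1]
    linarith
  · set S : Dataset n d := fun i j => (x i j ω, y i j ω) with hS
    set V := Bhat S with hV
    set ε := 4 * (8 * √(K * Q * s) + (2 * √(K ^ 2 * m * s) + 4 * K * s) + N * (β * (2 * a + β)))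
      with hε
    have hK0 : 0 ≤ K := by positivity
    have hε0 : 0 ≤ ε := by positivity
    have hres : ‖mulV B α' - mulV V (mulV Vᵀ (mulV B α'))‖ ≤ 2 * ε * a / (N * c₁ / k) :=
      norm_sub_proj_le_of_crossMat_sub_le h.B_orth hc₁ hk hN hN0 hD1
        (hB.top.imp (fun ht => ht S) fun ht => ht S) hε0 (hA' ω hω) hα'
    have horth : Vᵀ * V = 1 := by
      rcases hB.top with ht | ht <;> exact (ht S).orth
    set C' := 4 * (8 * √(28 * C₁ * (|c₂| + C₃ ^ 2)) + 64 * C₁ + C₃ * (2 * a + C₃)) with hC'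
    have hC'0 : 0 ≤ C' := by positivity
    set G := √(d * k / N) + √(m * d * k ^ 2 / N ^ 2) with hG
    have hG0 : 0 ≤ G := by positivity
    have e0 : (a + 2 * a / c₁ * C') * r ^ 2 * G = a * r ^ 2 * G + 2 * a / c₁ * (C' * r ^ 2 * G) := by
      ring
    rw [e0]
    rcases le_or_gt ((d : ℝ) * k) N with hdk | hdk
    · have h1 := error_term_le (d := d) (k := k) (M := m) hk' hkd' (Nat.cast_nonneg _) hN0 hdk hr1 hC₁0
        (by positivity : 0 ≤ |c₂| + C₃ ^ 2) hC₃0 ha hKC hQ1 hs0.le hs1 hβ0 hβ'.le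
      have h2 : 2 * ε * a / (N * c₁ / k) = 2 * a / c₁ * (ε * (k / N)) := by
        field_simp
      rw [h2] at hres
      refine hres.trans ?_
      have h3 : 0 ≤ a * r ^ 2 * G := by positivity
      have h4 : 2 * a / c₁ * (ε * (k / N)) ≤ 2 * a / c₁ * (C' * r ^ 2 * G) := by gcongr
      linarith
    -- For `d k > N` the claimed rate is at least one, and the trivial bound `a` on the residual
    -- suffices; this explains the summand `a` in the constant.
    · refine (norm_sub_proj_le horth _).trans ?_
      rw [norm_mulV_of_orth h.B_orth]
      have h1 : 1 ≤ √(d * k / N) := Real.one_le_sqrt.2 ((one_le_div hN0).2 hdk.le)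
      have h2 : 1 ≤ G := h1.trans (by rw [hG]; linarith [Real.sqrt_nonneg ((m : ℝ) * d * k ^ 2 / N ^ 2)])
      have h3 : 1 ≤ r ^ 2 := one_le_pow₀ hr1
      have h4 : a ≤ a * r ^ 2 * G := by
        rw [mul_assoc]
        exact le_mul_of_one_le_right ha (one_le_mul_of_one_le_of_one_le h3 h2)
      have h5 : 0 ≤ 2 * a / c₁ * (C' * r ^ 2 * G) := by positivity
      linarith

end Main

/-! ### Assembly of the main theorem. -/

section MainTheorem

/-- Without training clients the diversity matrix is zero, which contradicts the lower bound on its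
`k`-th eigenvalue. -/
lemma one_le_of_diversity {M k : ℕ} {n : Fin M → ℕ} {α : Fin M → Eucl k} {c₁ : ℝ} (hc₁ : 0 < c₁)
    (hk : 1 ≤ k) (hD : c₁ / k ≤ eig (diversity n α) k) : 1 ≤ M := by
  by_contra hM
  obtain rfl : M = 0 := by omega
  have h1 := (eig_bounds (diversity_isHermitian n α) hk (EuclideanSpace.single ⟨0, hk⟩ 1)).1
  rw [inner_diversity] at h1
  have : (0 : ℝ) < c₁ / k := by positivity
  simp at h1
  linarith

end MainTheorem

end SharedRep

end

set_option maxHeartbeats 2000000 in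
theorem mainTheorem7 :
    ∃ p : ℕ, ∀ (σ2 γ2 : ℝ≥0) (κ g a c₁ c₂ : ℝ), 0 < g → 0 < c₁ →
      ∃ C : ℝ, 0 < C ∧
        ∀ (M d k : ℕ) (n : Fin (M + 1) → ℕ), 1 ≤ k → k ≤ d →
        (∀ i : Fin M, 2 ≤ n i.castSucc) →
        1 ≤ n (Fin.last M) →
        (k : ℝ) * Real.log (n (Fin.last M)) ≤ n (Fin.last M) →
        ∀ (Ω : Type*) [MeasurableSpace Ω] (μ : Measure Ω) [IsProbabilityMeasure μ]
          (x : (i : Fin (M + 1)) → Fin (n i) → Ω → SharedRep.Eucl d)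
          (y : (i : Fin (M + 1)) → Fin (n i) → Ω → ℝ)
          (Γ : Fin (M + 1) → Matrix (Fin d) (Fin d) ℝ) (θ : Fin (M + 1) → SharedRep.Eucl d)
          (B : Matrix (Fin d) (Fin k) ℝ) (α : Fin (M + 1) → SharedRep.Eucl k),
        SharedRep.IsModel μ n x y Γ θ B α σ2 γ2 κ g a →
        Γ (Fin.last M) = 1 →
        c₁ / k ≤ SharedRep.eig
          (SharedRep.diversity (fun i : Fin M => n i.castSucc) (fun i => α i.castSucc)) k →
        SharedRep.eig
          (SharedRep.diversity (fun i : Fin M => n i.castSucc) (fun i => α i.castSucc)) 1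
            ≤ c₂ / k →
        ∀ (Bhat : SharedRep.Dataset (fun i : Fin M => n i.castSucc) d →
            Matrix (Fin d) (Fin k) ℝ),
        SharedRep.IsSpectralEstimator Bhat →
        ∀ (Bω : Ω → Matrix (Fin d) (Fin k) ℝ),
        (∀ ω, Bω ω = Bhat (fun i j => (x i.castSucc j ω, y i.castSucc j ω))) →
        ∀ (αhat : Ω → SharedRep.Eucl k),
        (∀ ω, SharedRep.IsLeastSquares (Bω ω) (fun j => x (Fin.last M) j ω)
          (fun j => y (Fin.last M) j ω) (αhat ω)) →
        ∀ (N n' : ℝ), N = ∑ i : Fin M, (n i.castSucc : ℝ) → n' = n (Fin.last M) →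
        μ {ω | ¬ ‖SharedRep.mulV (Bω ω) (αhat ω) - SharedRep.mulV B (α (Fin.last M))‖ ≤
              C * Real.log (d + N + n') ^ p *
                (√(d * k / N) + √(M * d * k ^ 2 / N ^ 2) + √(k / n'))}
          ≤ ENNReal.ofReal (C * (d + N) ^ (-10 : ℤ) + C * n' ^ (-100 : ℤ)) := by
  -- The exponent `2` comes from the subspace error; the regression step needs only one logarithm.
  refine ⟨2, fun σ2 γ2 κ g a c₁ c₂ hg hc₁ => ?_⟩
  set τ : ℝ≥0 := Real.toNNReal ((a * κ / g) ^ 2 * γ2 + σ2) with hτ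
  set S : ℝ≥0 := Real.toNNReal (a ^ 2 * γ2 + σ2 + γ2 + 1) with hS
  have hγ0 : (0 : ℝ) ≤ γ2 := γ2.2
  have hσ0 : (0 : ℝ) ≤ σ2 := σ2.2
  have hS1 : (S : ℝ) = a ^ 2 * γ2 + σ2 + γ2 + 1 := Real.coe_toNNReal _ (by positivity)
  have hS0 : 0 < S := by
    rw [← NNReal.coe_pos, hS1]; positivity
  obtain ⟨n₀, hn₀⟩ := SharedRep.exists_sample_size S
  set C₁ : ℝ := 8064 * (τ + 1) * (γ2 + 1) with hC₁
  set C₃ : ℝ := 12 * (Real.exp (τ / 2) + Real.exp (γ2 / 2)) + 1 with hC₃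
  -- The constant is chosen before any model is given, so the sign of `a` is not yet known.
  set C₄ : ℝ := |a| + 2 * |a| / c₁ *
    (4 * (8 * √(28 * C₁ * (|c₂| + C₃ ^ 2)) + 64 * C₁ + C₃ * (2 * |a| + C₃))) with hC₄
  have hC₁0 : 0 ≤ C₁ := by positivity
  have hC₃0 : 0 ≤ C₃ := by positivity
  have hC₄0 : 0 ≤ C₄ := by positivity
  refine ⟨8 + (n₀ : ℝ) ^ 100 + C₄ + 5456 * S, by positivity, ?_⟩
  set C : ℝ := 8 + (n₀ : ℝ) ^ 100 + C₄ + 5456 * S with hC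
  have hC8 : 8 ≤ C := by
    rw [hC]; have : (0 : ℝ) ≤ (n₀ : ℝ) ^ 100 + C₄ + 5456 * S := by positivity
    linarith
  have hCn : (n₀ : ℝ) ^ 100 ≤ C := by
    rw [hC]; have : (0 : ℝ) ≤ 8 + C₄ + 5456 * S := by positivity
    linarith
  have hC4 : C₄ ≤ C := by
    rw [hC]; have : (0 : ℝ) ≤ 8 + (n₀ : ℝ) ^ 100 + 5456 * S := by positivity
    linarith
  have hCS : 5456 * S ≤ C := by
    rw [hC]; have : (0 : ℝ) ≤ 8 + (n₀ : ℝ) ^ 100 + C₄ := by positivity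
    linarith
  clear_value C C₁ C₃ C₄
  intro M d k n hk hkd hn hn' hkn Ω _ μ _ x y Γ θ B α h hΓ hD1 hD2 Bhat hB Bω hBω
    αhat hαhat N n' hN hn'N
  have hM := SharedRep.one_le_of_diversity hc₁ hk hD1
  have ha : 0 ≤ a := h.a_nonneg (Fin.last M)
  have hd : 1 ≤ d := hk.trans hkd
  have hd' : (1 : ℝ) ≤ d := by exact_mod_cast hd
  have hn'1 : 1 ≤ n' := by rw [hn'N]; exact_mod_cast hn'
  have hN2 : 2 ≤ N := by
    rw [hN]
    refine le_trans ?_ (Finset.single_le_sum (f := fun i : Fin M => (n i.castSucc : ℝ))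
      (fun i _ => Nat.cast_nonneg _) (Finset.mem_univ ⟨0, hM⟩))
    exact_mod_cast hn ⟨0, hM⟩
  have hdN : 0 < d + N := by linarith
  have hC0 : 0 ≤ C := by linarith
  -- For `n' < n₀` the summand `n₀ ^ 100` of `C` makes the allowed failure probability at least one.
  rcases lt_or_ge (n (Fin.last M)) n₀ with hsmall | hbig
  · refine prob_le_one.trans ?_
    rw [← ENNReal.ofReal_one]
    refine ENNReal.ofReal_le_ofReal ?_
    have h1 : 0 ≤ C * (d + N) ^ (-10 : ℤ) := by positivity
    have h2 : 1 ≤ C * n' ^ (-100 : ℤ) := by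
      rw [zpow_neg, ← div_eq_mul_inv, one_le_div (by positivity)]
      refine le_trans ?_ hCn
      rw [show (100 : ℤ) = ((100 : ℕ) : ℤ) from rfl, zpow_natCast, hn'N]
      gcongr
    linarith
  obtain ⟨hl1, hρ, hS'⟩ := hn₀ _ hbig
  rw [← hn'N] at hl1 hρ hS' hkn
  have hn'0 : 0 < n' := by linarith
  have hk' : (1 : ℝ) ≤ k := by exact_mod_cast hk
  obtain ⟨A, hA, hA'⟩ := h.castSucc.exists_residual_le hg hc₁ hk hkd hn hM hD1 hD2 hB
    (Real.le_coe_toNNReal _) hN hC₁ hC₃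
  obtain ⟨T, hTc, hT1, hT⟩ := SharedRep.exists_net k
  -- After the union over pairs of net points the confidence left is `n' ^ (-100)`.
  set s := 2 * k * Real.log 5 + 100 * Real.log n' with hs
  have hlog5 : 0 ≤ Real.log 5 := Real.log_nonneg (by norm_num)
  have hs0 : 0 < s := by
    have : 0 ≤ 2 * k * Real.log 5 := by positivity
    linarith
  have hs1 : s ≤ 4 * k + 100 * Real.log n' := by
    have := mul_le_mul_of_nonneg_left SharedRep.two_mul_log_five_le (show (0 : ℝ) ≤ k by linarith)
    linarith
  set t := 2 * √(512 * S ^ 2 * n' * s) + 16 * S * s with ht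
  obtain ⟨ht1, ht2⟩ := SharedRep.threshold_le hn'0 hk' S.2 hl1 hkn hρ hS' hs0.le hs1 ht
  have horth : ∀ S, (Bhat S)ᵀ * Bhat S = 1 := by
    intro S
    rcases hB.top with ht | ht <;> exact (ht S).orth
  have hG := h.measure_not_isGoodSample_estimator_le hB.measurable horth (T := T)
    (ρ := θ (Fin.last M)) (t := t) fun V hV => h.measure_not_isGoodSample_le hΓ hn' hV hTc hT1 hS0
      (by rw [hS1]; linarith) hs0 (by rw [ht, hn'N]) (by rw [← hn'N]; exact ht1)
  set bad : Set Ω := {ω | ¬ SharedRep.IsGoodSample T (θ (Fin.last M)) t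
    (Bhat (fun i j => (x i.castSucc j ω, y i.castSucc j ω)))
      (fun j => (x (Fin.last M) j ω, y (Fin.last M) j ω))} with hbad
  refine (measure_mono (t := A ∪ bad) fun ω hω => ?_).trans
    ((measure_union_le _ _).trans ((add_le_add hA hG).trans ?_))
  · by_contra hcon
    simp only [Set.mem_union, not_or, hbad, Set.mem_ofPred_eq, not_not] at hcon
    refine hω ?_
    have hls := hcon.2.norm_le hT hn' (horth _) (b := αhat ω) (by
      have := hαhat ω
      rwa [hBω] at this)
    have hθ : θ (Fin.last M) = SharedRep.mulV B (α (Fin.last M)) := by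
      rw [← h.low_dim, hΓ, SharedRep.one_mulV]
    have hres := hA' ω hcon.1 (α (Fin.last M)) (h.alpha_bound _)
    rw [← hBω, hθ, ← hn'N] at hls
    rw [← hBω] at hres
    refine hls.trans ((add_le_add ht2 hres).trans ?_)
    set lam := Real.log (d + N + n') with hlam
    have hl2 : Real.log n' ≤ lam := Real.log_le_log hn'0 (by linarith)
    have hl3 : Real.log (d + N) ≤ lam := Real.log_le_log hdN (by linarith)
    have hl4 : 0 ≤ Real.log (d + N) := Real.log_nonneg (by linarith)
    have hlam1 : 1 ≤ lam := hl1.trans hl2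
    have e1 : 5456 * S * (Real.log n' * √(k / n')) ≤ C * lam ^ 2 * √(k / n') := by
      rw [← mul_assoc]
      have : Real.log n' ≤ lam ^ 2 := hl2.trans (by nlinarith)
      gcongr
    have e2 : C₄ * Real.log (d + N) ^ 2 * (√(d * k / N) + √(M * d * k ^ 2 / N ^ 2)) ≤
        C * lam ^ 2 * (√(d * k / N) + √(M * d * k ^ 2 / N ^ 2)) := by gcongr
    rw [hC₄, abs_of_nonneg ha] at e2
    exact (add_le_add e1 e2).trans_eq (by ring)
  · rw [hs, ← mul_assoc, mul_comm ((5 : ℝ) ^ k * 5 ^ k) 4, mul_assoc (4 : ℝ),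
      SharedRep.five_pow_mul_exp]
    have e := SharedRep.exp_neg_mul_log hn'0 100
    push_cast at e
    rw [e, ← ENNReal.ofReal_add (by positivity) (by positivity)]
    refine ENNReal.ofReal_le_ofReal (add_le_add ?_ ?_)
    · gcongr
    · gcongr; linarith
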